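/- **Theorem 3.2.** *The model.* Let $q_0^w<q_1^w<\dots<q_{n+1}^w$ ($n\ge 0$) be the positions of walls on the line. The two exterior walls cannot be passed; the interior walls have pairwise distinct heights $h_1,\dots,h_n>0$, and a particle of speed $v$ passes the interior wall $k$ iff $v>h_k$. A *well* $i$ is a region between two walls all of whose interior walls are lower than both of them (exterior walls count as infinitely high); $m_i$ is its width. Between collisions the particle moves freely, with energy $H=p^2/2$, in the well bounded by the nearest walls to its left and right that it cannot pass. Let $c_1^{(i)},c_2^{(i)}>0$ be constants. For $\varepsilon,\delta>0$, at its $k$-th collision with the left (right) boundary of well $i$ the particle is reflected and its speed is multiplied by $1-\varepsilon c_1^{(i)}-\varepsilon\delta\xi_k^{(i)}$ (respectively $1-\varepsilon c_2^{(i)}-\varepsilon\delta\eta_k^{(i)}$). All the random variables $\xi_k^{(i)},\eta_k^{(i)}$ are independent, each of the sequences $(\xi^{(i)}_k)_k$, $(\eta^{(i)}_k)_k$ is identically distributed with a continuous density, and all the variables take values a.s. in an interval $(\alpha,\beta)$, $0<\alpha<\beta<\infty$. *The graph.* Let $\Gamma$ be the tree obtained from the phase space by identifying the points of each connected component of each level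 set of $H$, with the path metric in which length is measured by $H$, and let $Y(q,p)$ be the identification map. The edges $I_i$ of $\Gamma$ correspond to the wells $i$, and each interior wall $l$ gives an interior vertex $O_l$ of energy $h_l^2/2$, with one edge above it and two edges, left and right, below it. *The slow motion.* The particle starts at $(q_0,p_0)$, $p_0\neq 0$, where $q_0$ lies between the two exterior walls (if $q_0$ is the position of a wall that reflects speed $|p_0|$, the particle starts on the face of that wall from which it is moving away), and $Y(q_0,p_0)$ is not an interior vertex. Let $0=\tau_0<\tau_1<\tau_2<\dots$ be the starting time and the collision times, multiplied by $\varepsilon$. Let $\widehat Y^{\varepsilon,\delta}_t$ be the path in $\Gamma$ that at time $\tau_m$ is at the projection to $\Gamma$ of the state right after the $m$-th collision (for $m=0$, of the initial state) and that on $[\tau_m,\tau_{m+1}]$ runs along the path of $\Gamma$ between the two projections, with energy linear in $t$. *Claim.* Fix $T>0$. There is a process $Y_t$, $0\le t\le T$, unique in law, with continuous paths in $\Gamma$, such that $Y_0=Y(q_0,p_0)$; inside each edge $I_i$ its energy satisfies $$\frac{dH}{dt}=-2\,\frac{c_1^{(i)}+c_2^{(i)}}{T_i(H)}\,H,\qquad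 T_i(H)=\frac{\sqrt2\,m_i}{\sqrt H};$$ when it reaches an interior vertex $O_l$ along the edge $I_i$ above $O_l$, it instantaneously leaves $O_l$ along the left or the right edge below $O_l$, with probabilities $$\frac{c_1^{(i)}}{c_1^{(i)}+c_2^{(i)}}\quad\text{and}\quad\frac{c_2^{(i)}}{c_1^{(i)}+c_2^{(i)}}$$ respectively; and the choices at different interior vertices are independent. For each $\delta>0$ and all small enough $\varepsilon>0$, $\widehat Y^{\varepsilon,\delta}$ is almost surely continuous and is a random element of the space $C([0,T],\Gamma)$ with the uniform topology. As first $\varepsilon\downarrow0$ and then $\delta\downarrow0$, $\widehat Y^{\varepsilon,\delta}$ converges weakly in $C([0,T],\Gamma)$ to $Y$: for each $\delta>0$ the laws of $\widehat Y^{\varepsilon,\delta}$ converge weakly as $\varepsilon\downarrow0$ to some probability law $\nu_\delta$, and $\nu_\delta$ converges weakly to the law of $Y$ as $\delta\downarrow0$. -/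

import Mathlib

open MeasureTheory ProbabilityTheory Filter Topology Set
open scoped NNReal ENNReal

/-- The two sides, left and right. -/
inductive Side where
  | left
  | right
  deriving DecidableEq

/-- The opposite side. -/
def Side.flip : Side → Side
  | .left => .right
  | .right => .left

instance : Fintype Side := ⟨{.left, .right}, fun s => by cases s <;> simp⟩

instance : MeasurableSpace Side := ⊤

instance : DiscreteMeasurableSpace Side := ⟨fun _ => trivial⟩

/-- A one-dimensional multi-well model. There are `n + 2` walls at the positions
`pos 0 < ⋯ < pos (n + 1)`. The two exterior walls cannot be passed. The `n` interior walls have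
pairwise distinct positive heights, measured as velocities: a particle of speed `v` passes an
interior wall iff `v` exceeds its height. -/
structure WallSystem (n : ℕ) where
  pos : Fin (n + 2) → ℝ
  pos_strictMono : StrictMono pos
  height : Fin n → ℝ
  height_pos : ∀ i, 0 < height i
  height_injective : Function.Injective height

namespace WallSystem

variable {n : ℕ}

/-- The `i`-th interior wall as one of the `n + 2` walls. The walls cut the interval into `n + 1`
cells; cell `j` lies between the walls `j.castSucc` and `j.succ`, so that the interior wall `i`
separates the cells `i.castSucc` and `i.succ`. -/
def inner (i : Fin n) : Fin (n + 2) := i.succ.castSucc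

variable (S : WallSystem n)

/-- The wall `k` reflects a particle of speed `v`. (Exterior walls always do.) -/
def Blocks (k : Fin (n + 2)) (v : ℝ) : Prop := ∀ i, inner i = k → v ≤ S.height i

theorem inner_ne_zero (i : Fin n) : inner i ≠ 0 := by
  simp [inner, Fin.ext_iff]

theorem inner_ne_last (i : Fin n) : inner i ≠ Fin.last (n + 1) := by
  simp only [inner, ne_eq, Fin.ext_iff, Fin.val_castSucc, Fin.val_succ, Fin.val_last]
  omega

theorem blocks_zero (v : ℝ) : S.Blocks 0 v := fun i h => absurd h (inner_ne_zero i)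

theorem blocks_last (v : ℝ) : S.Blocks (Fin.last (n + 1)) v :=
  fun i h => absurd h (inner_ne_last i)

/-- A (simple or composite) well: the region between two walls `left < right` all of whose interior
walls are lower than both of them. The wells number the edges of the graph `Γ`. -/
structure Well where
  left : Fin (n + 2)
  right : Fin (n + 2)
  left_lt_right : left < right
  lower : ∀ i, left < inner i → inner i < right →
    ∀ i', (inner i' = left ∨ inner i' = right) → S.height i < S.height i'
  deriving DecidableEq

variable {S}

namespace Well

/-- The left or right boundary wall of a well. -/
def wall (w : S.Well) : Side → Fin (n + 2)
  | .left => w.left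
  | .right => w.right

/-- The cell of the well adjacent to its left or right boundary wall. -/
def cellAt (w : S.Well) : Side → Fin (n + 1)
  | .left => w.left.castPred ((w.left_lt_right.trans_le (Fin.le_last _)).ne)
  | .right => w.right.pred ((Fin.zero_le _).trans_lt w.left_lt_right).ne'

/-- The width of a well. -/
noncomputable def width (w : S.Well) : ℝ := S.pos w.right - S.pos w.left

/-- The period `T(H) = √2 m / √H` of the unperturbed motion with energy `H` in a well of
width `m`. -/
noncomputable def period (w : S.Well) (H : ℝ) : ℝ := √2 * w.width / √H

end Well

variable (S)

open Classical in
/-- The well in which a particle in the cell `j` with speed `v` moves: it reaches from the nearest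
blocking wall on the left to the nearest blocking wall on the right. -/
noncomputable def wellAt (j : Fin (n + 1)) (v : ℝ) : S.Well where
  left := (Finset.univ.filter fun k => k ≤ j.castSucc ∧ S.Blocks k v).max'
    ⟨0, by simp [S.blocks_zero v]⟩
  right := (Finset.univ.filter fun k => j.succ ≤ k ∧ S.Blocks k v).min'
    ⟨Fin.last _, by simp [S.blocks_last v, Fin.le_last]⟩
  left_lt_right := by
    have h1 := Finset.max'_mem (Finset.univ.filter fun k => k ≤ j.castSucc ∧ S.Blocks k v)
      ⟨0, by simp [S.blocks_zero v]⟩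
    have h2 := Finset.min'_mem (Finset.univ.filter fun k => j.succ ≤ k ∧ S.Blocks k v)
      ⟨Fin.last _, by simp [S.blocks_last v, Fin.le_last]⟩
    rw [Finset.mem_filter] at h1 h2
    exact h1.2.1.trans_lt ((Fin.castSucc_lt_succ (i := j)).trans_le h2.2.1)
  lower := by
    intro i hl hr i' hi'
    have h1 := Finset.max'_mem (Finset.univ.filter fun k => k ≤ j.castSucc ∧ S.Blocks k v)
      ⟨0, by simp [S.blocks_zero v]⟩
    have h2 := Finset.min'_mem (Finset.univ.filter fun k => j.succ ≤ k ∧ S.Blocks k v)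
      ⟨Fin.last _, by simp [S.blocks_last v, Fin.le_last]⟩
    rw [Finset.mem_filter] at h1 h2
    have hv' : v ≤ S.height i' := hi'.elim (h1.2.2 i') (h2.2.2 i')
    have hnb : ¬ S.Blocks (inner i) v := by
      intro hb
      rcases le_or_gt (inner i) j.castSucc with h | h
      · exact absurd (Finset.le_max' _ (inner i)
          (Finset.mem_filter.2 ⟨Finset.mem_univ _, h, hb⟩)) (not_le.2 hl)
      · have h' : j.succ ≤ inner i := by
          simp only [Fin.lt_def, Fin.le_def, Fin.val_castSucc, Fin.val_succ] at h ⊢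
          omega
        exact absurd (Finset.min'_le _ (inner i)
          (Finset.mem_filter.2 ⟨Finset.mem_univ _, h', hb⟩)) (not_le.2 hr)
    have hv : S.height i < v := by
      by_contra hc
      refine hnb fun i'' h'' => ?_
      have : i'' = i := by
        simpa [inner] using h''
      rw [this]
      exact not_lt.1 hc
    exact hv.trans_le hv'

/-! ### The graph -/

/-- A pair (cell, energy). The points of the phase space over the cell `j` with velocity `p` or `-p`
all lie in the same connected component of the level set of the energy `p ^ 2 / 2`; they are
represented by the pair `(j, p ^ 2 / 2)`. -/
structure Level (S : WallSystem n) where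
  cell : Fin (n + 1)
  energy : ℝ≥0

/-- The least energy above which one passes from cell `j` to cell `j'`: the maximum of the energies
`height i ^ 2 / 2` of the walls between the two cells (zero if there are none). -/
noncomputable def barrier (j j' : Fin (n + 1)) : ℝ≥0 :=
  (Finset.univ.filter fun i : Fin n => min j j' ≤ i.castSucc ∧ i.succ ≤ max j j').sup
    fun i => (S.height i ^ 2 / 2).toNNReal

theorem barrier_self (j : Fin (n + 1)) : S.barrier j j = 0 := by
  rw [barrier, Finset.filter_eq_empty_iff.2]
  · simp
  · intro i _ h
    rw [min_self, max_self] at h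
    exact absurd (h.2.trans h.1) (not_le.2 Fin.castSucc_lt_succ)

theorem barrier_comm (j j' : Fin (n + 1)) : S.barrier j j' = S.barrier j' j := by
  simp only [barrier, min_comm, max_comm]

theorem le_barrier {j j' : Fin (n + 1)} {i : Fin n}
    (h : min j j' ≤ i.castSucc ∧ i.succ ≤ max j j') :
    (S.height i ^ 2 / 2).toNNReal ≤ S.barrier j j' := by
  have hi : i ∈ Finset.univ.filter
      fun i : Fin n => min j j' ≤ i.castSucc ∧ i.succ ≤ max j j' :=
    Finset.mem_filter.2 ⟨Finset.mem_univ i, h⟩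
  exact Finset.le_sup (f := fun i => (S.height i ^ 2 / 2).toNNReal) hi

theorem barrier_le (a b c : Fin (n + 1)) : S.barrier a c ≤ max (S.barrier a b) (S.barrier b c) := by
  refine Finset.sup_le fun i hi => ?_
  rw [Finset.mem_filter] at hi
  have key : (min a b ≤ i.castSucc ∧ i.succ ≤ max a b) ∨
      (min b c ≤ i.castSucc ∧ i.succ ≤ max b c) := by
    have h := hi.2
    simp only [min_le_iff, le_max_iff, Fin.le_def, Fin.val_castSucc, Fin.val_succ] at h ⊢
    omega
  rcases key with h | h
  · exact le_max_of_le_left (S.le_barrier h)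
  · exact le_max_of_le_right (S.le_barrier h)

variable {S} in
/-- The energy of the top of the path in the graph between two levels. -/
noncomputable def Level.peak (x y : S.Level) : ℝ :=
  max (max (x.energy : ℝ) y.energy) (S.barrier x.cell y.cell)

/-- The length of the path between two levels in the graph: up from `x` to the top of the path and
then down to `y`. -/
noncomputable instance : PseudoMetricSpace S.Level where
  dist x y := 2 * x.peak y - x.energy - y.energy
  dist_self x := by
    have h : x.peak x = x.energy := by
      unfold Level.peak
      rw [barrier_self, max_self]
      exact max_eq_left x.energy.2
    rw [h]
    ring
  dist_comm x y := by
    simp only [Level.peak, S.barrier_comm x.cell y.cell, max_comm (x.energy : ℝ) y.energy]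
    ring
  dist_triangle x y z := by
    have h : (S.barrier x.cell z.cell : ℝ) ≤
        max (S.barrier x.cell y.cell : ℝ) (S.barrier y.cell z.cell) := by
      exact_mod_cast S.barrier_le x.cell y.cell z.cell
    have a1 : (x.energy : ℝ) ≤ x.peak y := le_max_of_le_left (le_max_left _ _)
    have a2 : (y.energy : ℝ) ≤ x.peak y := le_max_of_le_left (le_max_right _ _)
    have a3 : (S.barrier x.cell y.cell : ℝ) ≤ x.peak y := le_max_right _ _
    have b1 : (y.energy : ℝ) ≤ y.peak z := le_max_of_le_left (le_max_left _ _)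
    have b2 : (z.energy : ℝ) ≤ y.peak z := le_max_of_le_left (le_max_right _ _)
    have b3 : (S.barrier y.cell z.cell : ℝ) ≤ y.peak z := le_max_right _ _
    have : x.peak z + y.energy ≤ x.peak y + y.peak z := by
      rw [← le_sub_iff_add_le]
      refine max_le (max_le (by linarith) (by linarith)) (h.trans (max_le (by linarith) ?_))
      linarith
    linarith

/-- The graph `Γ`, obtained by identifying the points of each connected component of each level set
of the energy; its metric is the path metric, length being measured by the energy. Two levels of the
same energy are at distance zero iff no wall between their cells exceeds that energy. -/
abbrev Graph (S : WallSystem n) : Type := SeparationQuotient S.Level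

/-- The point of `Γ` given by a cell and an energy. -/
noncomputable def point (j : Fin (n + 1)) (h : ℝ≥0) : S.Graph := SeparationQuotient.mk ⟨j, h⟩

/-- The identification map: the point of `Γ` to which a point of the phase space over the cell `j`
with velocity `v` is projected. -/
noncomputable def proj (j : Fin (n + 1)) (v : ℝ) : S.Graph := S.point j (v ^ 2 / 2).toNNReal

/-- The energy coordinate `H` on `Γ`. -/
noncomputable def energy : S.Graph → ℝ :=
  SeparationQuotient.lift (fun x : S.Level => (x.energy : ℝ)) (by
    intro x y h
    have h0 : 2 * x.peak y - x.energy - y.energy = 0 := Metric.inseparable_iff.1 h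
    have a1 : (x.energy : ℝ) ≤ x.peak y := le_max_of_le_left (le_max_left _ _)
    have a2 : (y.energy : ℝ) ≤ x.peak y := le_max_of_le_left (le_max_right _ _)
    show (x.energy : ℝ) = y.energy
    linarith)

/-- The interior vertex of `Γ` that corresponds to the interior wall `k`. -/
noncomputable def vertex (k : Fin n) : S.Graph := S.proj k.castSucc (S.height k)

variable {S}

namespace Well

/-- The open edge of `Γ` that belongs to the well `w`. -/
def edge (w : S.Well) : Set S.Graph :=
  {x | ∃ (j : Fin (n + 1)) (h : ℝ≥0), x = S.point j h ∧ 0 < h ∧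
    w.left ≤ j.castSucc ∧ j.succ ≤ w.right ∧
    (∀ i, w.left < inner i → inner i < w.right → S.height i ^ 2 / 2 < h) ∧
    (∀ i, inner i = w.left ∨ inner i = w.right → h < S.height i ^ 2 / 2)}

/-- The edge of `w` is situated directly above the vertex of the interior wall `k`: this wall is the
highest one inside `w`. -/
def IsAbove (w : S.Well) (k : Fin n) : Prop :=
  w.left < inner k ∧ inner k < w.right ∧
    ∀ i, w.left < inner i → inner i < w.right → S.height i ≤ S.height k

/-- The edge of `w` is attached to the vertex of the interior wall `k`, below it and on the
side `s`: the wall `k` bounds `w`, and the other wall that bounds `w` is higher. -/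
def IsBelow (w : S.Well) (s : Side) (k : Fin n) : Prop :=
  w.wall s.flip = inner k ∧ ∀ i, inner i = w.wall s → S.height k < S.height i

end Well

/-! ### The nearly-elastic motion -/

/-- The state of the particle right after a collision (or at the start): the cell it is in, its
position, its speed, the direction of its motion, the present time, and the number of collisions so
far with each boundary wall of each well. -/
structure State (S : WallSystem n) where
  cell : Fin (n + 1)
  pos : ℝ
  speed : ℝ
  heading : Side
  time : ℝ
  hits : S.Well × Side → ℕ

/-- The motion up to and including the next collision: free motion to the boundary wall of the
present well towards which the particle is heading, and reflection. `r w s k` is the restitution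
coefficient of the wall of `w` on the side `s` at its collision number `k` (`k = 0` is the first). -/
noncomputable def State.next (r : S.Well → Side → ℕ → ℝ) (x : S.State) : S.State :=
  let w := S.wellAt x.cell x.speed
  let s := x.heading
  { cell := w.cellAt s
    pos := S.pos (w.wall s)
    speed := x.speed * r w s (x.hits (w, s))
    heading := s.flip
    time := x.time + |S.pos (w.wall s) - x.pos| / x.speed
    hits := Function.update x.hits (w, s) (x.hits (w, s) + 1) }

/-- The initial state for the phase point `(q₀, p₀)` over the cell `j₀`. -/
noncomputable def start (S : WallSystem n) (j₀ : Fin (n + 1)) (q₀ p₀ : ℝ) : S.State where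
  cell := j₀
  pos := q₀
  speed := |p₀|
  heading := if 0 < p₀ then .right else .left
  time := 0
  hits := fun _ => 0

/-- The successive states of the motion. -/
noncomputable def orbit (r : S.Well → Side → ℕ → ℝ) (x : S.State) (m : ℕ) : S.State :=
  (State.next r)^[m] x

/-- The rescaled (`t ↦ t / ε`) slow motion on `Γ`, made continuous. Let `τ m = ε * (orbit r x m).time`
be the rescaled collision times (`τ 0 = 0` is the start) and `e m` the energy right after time `τ m`.
Between `τ m` and `τ (m + 1)` the energy is interpolated linearly from `e m` to `e (m + 1)`, and the
path runs in `Γ` from the projection of the state at `τ m` down to the projection of the state at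
`τ (m + 1)`: the cell of the latter state belongs to the well in which the particle moves between
these times, so the path starts at the right point. -/
noncomputable def slowPath (ε : ℝ) (r : S.Well → Side → ℕ → ℝ) (x : S.State) (t : ℝ) : S.Graph :=
  let τ : ℕ → ℝ := fun m => ε * (orbit r x m).time
  let e : ℕ → ℝ := fun m => (orbit r x m).speed ^ 2 / 2
  let m : ℕ := sInf {m | t < τ (m + 1)}
  S.point (orbit r x (m + 1)).cell
    (e m + (t - τ m) / (τ (m + 1) - τ m) * (e (m + 1) - e m)).toNNReal

open Classical in
/-- A function as an element of the space of continuous functions (a constant one if the function is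
not continuous). -/
noncomputable def toPath {T : ℝ} (f : ℝ → S.Graph) : C(Icc (0 : ℝ) T, S.Graph) :=
  if h : Continuous fun t : Icc (0 : ℝ) T => f t then ⟨fun t => f t, h⟩
  else ContinuousMap.const _ (S.point 0 0)

/-- The restitution coefficients `1 - ε c - ε δ ξ`. -/
def restitution (c : S.Well → Side → ℝ) (ε δ : ℝ) (ξ : S.Well → Side → ℕ → ℝ) :
    S.Well → Side → ℕ → ℝ :=
  fun w s k => 1 - ε * c w s - ε * δ * ξ w s k

/-- The random variables that perturb the restitution coefficients: all of them are independent,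
for each boundary wall of each well they are identically distributed with a continuous density, and
they take values in a bounded interval `(α, β)`, `0 < α`. -/
structure IsNoise {Ω : Type*} [MeasurableSpace Ω] (P : Measure Ω)
    (ξ : S.Well → Side → ℕ → Ω → ℝ) : Prop where
  measurable : ∀ w s k, Measurable (ξ w s k)
  indep : iIndepFun (fun a : S.Well × Side × ℕ => ξ a.1 a.2.1 a.2.2) P
  density : ∀ w s, ∃ f : ℝ → ℝ≥0, Continuous f ∧
    ∀ k, P.map (ξ w s k) = volume.withDensity fun x => (f x : ℝ≥0∞)
  bounded : ∃ α β : ℝ, 0 < α ∧ α < β ∧ ∀ w s k, ∀ᵐ ω ∂P, ξ w s k ω ∈ Ioo α β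

/-! ### The limiting process -/

noncomputable instance (T : ℝ) : MeasurableSpace C(Icc (0 : ℝ) T, S.Graph) := borel _

instance (T : ℝ) : BorelSpace C(Icc (0 : ℝ) T, S.Graph) := ⟨rfl⟩

/-- The right-hand side of the averaged equation `dH/dt = -2 (c₁ + c₂) / T(H) * H` on the edge of
the well `w`. -/
noncomputable def drift (c : S.Well → Side → ℝ) (w : S.Well) (H : ℝ) : ℝ :=
  -2 * (c w .left + c w .right) / w.period H * H

/-- A path of the limiting process that starts at `y₀` and turns at each interior vertex to the
side `turn k`: inside the edges its energy solves the averaged equation, and whenever it is at an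
interior vertex, it leaves it immediately along the edge below the vertex on the chosen side. -/
structure IsLimitPath {T : ℝ} (hT : 0 < T) (c : S.Well → Side → ℝ) (y₀ : S.Graph)
    (turn : Fin n → Side) (y : C(Icc (0 : ℝ) T, S.Graph)) : Prop where
  init : y ⟨0, left_mem_Icc.2 hT.le⟩ = y₀
  ode : ∀ (w : S.Well) (t : Icc (0 : ℝ) T), y t ∈ w.edge →
    HasDerivWithinAt (fun s => S.energy (y (projIcc 0 T hT.le s)))
      (drift c w (S.energy (y t))) (Icc 0 T) t
  branch : ∀ (k : Fin n) (t : Icc (0 : ℝ) T), (t : ℝ) < T → y t = S.vertex k →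
    ∃ w : S.Well, w.IsBelow (turn k) k ∧
      ∀ᶠ s in 𝓝[>] (t : ℝ), y (projIcc 0 T hT.le s) ∈ w.edge

/-- `μ` is the law in `C([0,T], Γ)` of the limiting process with initial point `y₀`: the process
solves the averaged equation inside the edges and branches at the interior vertices; the turns at
different vertices are independent, and at the vertex below the edge of `w` the process turns left
with probability `c₁ / (c₁ + c₂)` and right with probability `c₂ / (c₁ + c₂)`, where `c₁, c₂` are
the coefficients of `w`. -/
def IsLimitLaw {T : ℝ} (hT : 0 < T) (c : S.Well → Side → ℝ) (y₀ : S.Graph)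
    (μ : ProbabilityMeasure C(Icc (0 : ℝ) T, S.Graph)) : Prop :=
  ∃ (Ω : Type) (_ : MeasurableSpace Ω) (P : Measure Ω) (_ : IsProbabilityMeasure P)
    (Y : Ω → C(Icc (0 : ℝ) T, S.Graph)) (turn : Fin n → Ω → Side),
    Measurable Y ∧ (∀ k, Measurable (turn k)) ∧ iIndepFun turn P ∧
    (∀ (k : Fin n) (w : S.Well), w.IsAbove k → ∀ s : Side,
      P {ω | turn k ω = s} = ENNReal.ofReal (c w s / (c w .left + c w .right))) ∧
    (∀ᵐ ω ∂P, IsLimitPath hT c y₀ (fun k => turn k ω) (Y ω)) ∧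
    P.map Y = μ

end WallSystem

namespace WallSystem

variable {n : ℕ} {S : WallSystem n}

/-! All restitution coefficients in play lie in `(0, 1)`. So the speed decreases strictly, the wells
through which the particle moves are nested, and in the end it is trapped in a single cell `J`. This
cell lies in all the earlier wells as well, so the whole slow path is a path over `J`
(`slowPath_eq`). A random path in the tree thus reduces to two data: the final cell, and the energy
as a function of time.

The limit has the same form. In terms of the speed `v = √(2H)`, the averaged equation says that on
each edge the slowness `1 / v` grows at the constant rate `1 / pace`, where `pace = 2 m / (c₁ +
c₂)`. For every cell `j` this gives one path `limitPath`, found by inverting the increasing function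
`clock`. The turns determine the cell (`terminal`) and hence the path (`IsLimitPath.eq_limitPath`).
The expectation of `F` under the limiting law is therefore `value`, a recursion down the binary tree
of wells in which each well averages over its two parts with weights proportional to `c₁, c₂`
(`IsLimitLaw.integral_eq`). Uniqueness in law follows, and weak convergence becomes convergence to
such a value.

For fixed `δ`, let `b` be the mean losses `c + δ E ξ`. The limit `ε → 0` rests on two independent
facts.

Energy, by the law of large numbers. At a collision with loss `a`, the clock advances by about `ε *
pace * a / v`, and the rescaled time by `ε * width / v`. Collisions with the two walls of a well
alternate, and `pace * (b₁ + b₂) = 2 * width`, so these advances agree on average. Summation by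
parts keeps the accumulated difference small up to time `T`. Almost surely, then, the slow path
approaches the averaged path over its own final cell (`eventually_dist_limitPath_le`). The final
cell itself need not converge along the way.

Final cell, by renewal theory. Let `h` be the height of the highest wall in the present well. Then
`log (v / h) / ε` descends from a level of order `1 / ε` by steps close to the losses, with two
alternating laws, and the particle is caught on the side of the wall at which the level jumps over
`0`. The probability of a side tends to its share of the mean step, `b₁ / (b₁ + b₂)` or `b₂ / (b₁ +
b₂)` (`exists_renewal`). The density of the noise enters here: the laws of the steps dominate a
multiple of Lebesgue measure on an interval, uniformly in `ε`, so bounded harmonic functions of the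
walk flatten geometrically (`exists_contraction`); a conservation law finds the constant
(`sum_integral_eq`). A supermartingale adds up the errors made in successive wells
(`eventually_integral_cell_le`).

Finally `b → c` as `δ → 0`, and both `value` and `limitPath` depend continuously on the
coefficients. -/

theorem inner_val (i : Fin n) : ((inner i : Fin (n + 2)) : ℕ) = i + 1 := by
  simp [inner]

theorem inner_injective : Function.Injective (inner : Fin n → Fin (n + 2)) := by
  intro i j h
  have := congrArg (fun k : Fin (n + 2) => (k : ℕ)) h
  simp only [inner_val] at this
  exact Fin.ext (by omega)

theorem exists_inner_eq {k : Fin (n + 2)} (h0 : 0 < (k : ℕ)) (h1 : (k : ℕ) < n + 1) :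
    ∃ i : Fin n, inner i = k :=
  ⟨⟨k - 1, by omega⟩, Fin.ext (by rw [inner_val]; simp only; omega)⟩

theorem Blocks.mono {k : Fin (n + 2)} {v v' : ℝ} (h : S.Blocks k v) (hv : v' ≤ v) :
    S.Blocks k v' := fun i hi => hv.trans (h i hi)

/-! ### The binary tree of wells -/

namespace Well

/-- The cell `j` lies in the well. -/
def HasCell (w : S.Well) (j : Fin (n + 1)) : Prop := w.left ≤ j.castSucc ∧ j.succ ≤ w.right

/-- The interior wall `i` lies strictly inside the well. -/
def HasWall (w : S.Well) (i : Fin n) : Prop := w.left < inner i ∧ inner i < w.right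

theorem hasCell_iff {w : S.Well} {j : Fin (n + 1)} :
    w.HasCell j ↔ (w.left : ℕ) ≤ j ∧ (j : ℕ) + 1 ≤ w.right := by
  simp [HasCell, Fin.le_def]

theorem hasWall_iff {w : S.Well} {i : Fin n} :
    w.HasWall i ↔ (w.left : ℕ) < i + 1 ∧ (i : ℕ) + 1 < w.right := by
  simp [HasWall, Fin.lt_def, inner_val]

theorem ext_walls {w w' : S.Well} (hl : w.left = w'.left) (hr : w.right = w'.right) : w = w' := by
  cases w; cases w'; simp_all

instance : Finite S.Well :=
  Finite.of_injective (fun w : S.Well => (w.left, w.right))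
    fun _ _ h => ext_walls (congrArg Prod.fst h) (congrArg Prod.snd h)

noncomputable instance : Fintype S.Well := Fintype.ofFinite _

instance : MeasurableSpace S.Well := ⊤

instance : DiscreteMeasurableSpace S.Well := ⟨fun _ => trivial⟩

theorem cellAt_left_val (w : S.Well) : (w.cellAt .left : ℕ) = w.left := by
  simp [cellAt]

theorem cellAt_right_val (w : S.Well) : (w.cellAt .right : ℕ) + 1 = w.right := by
  have := w.left_lt_right
  rw [Fin.lt_def] at this
  simp only [cellAt, Fin.val_pred]
  omega

theorem hasCell_cellAt (w : S.Well) (s : Side) : w.HasCell (w.cellAt s) := by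
  have h := w.left_lt_right
  rw [Fin.lt_def] at h
  rw [hasCell_iff]
  have h1 := w.cellAt_left_val
  have h2 := w.cellAt_right_val
  cases s <;> omega

theorem width_pos (w : S.Well) : 0 < w.width := sub_pos.2 (S.pos_strictMono w.left_lt_right)

/-- The height of a wall inside a well is less than the heights of its boundary walls. -/
theorem height_lt_of_hasWall {w : S.Well} {i i' : Fin n} (h : w.HasWall i) {s : Side}
    (h' : inner i' = w.wall s) : S.height i < S.height i' :=
  w.lower i h.1 h.2 i' (by cases s <;> simp_all [wall])

theorem exists_isAbove {w : S.Well} {i : Fin n} (h : w.HasWall i) : ∃ k, w.IsAbove k := by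
  classical
  obtain ⟨k, hk, hmax⟩ := Finset.exists_max_image (Finset.univ.filter fun i => w.HasWall i)
    S.height ⟨i, by simpa using h⟩
  simp only [Finset.mem_filter, Finset.mem_univ, true_and] at hk hmax
  exact ⟨k, hk.1, hk.2, fun i h1 h2 => hmax i ⟨h1, h2⟩⟩

theorem IsAbove.hasWall {w : S.Well} {k : Fin n} (h : w.IsAbove k) : w.HasWall k := ⟨h.1, h.2.1⟩

theorem IsAbove.le {w : S.Well} {k i : Fin n} (h : w.IsAbove k) (hi : w.HasWall i) :
    S.height i ≤ S.height k := h.2.2 i hi.1 hi.2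

theorem IsAbove.lt {w : S.Well} {k i : Fin n} (h : w.IsAbove k) (hi : w.HasWall i) (hne : i ≠ k) :
    S.height i < S.height k :=
  (h.le hi).lt_of_ne fun e => hne (S.height_injective e)

theorem IsAbove.eq_wall {w : S.Well} {k k' : Fin n} (h : w.IsAbove k) (h' : w.IsAbove k') :
    k = k' := S.height_injective (le_antisymm (h'.le h.hasWall) (h.le h'.hasWall))

/-- The well directly above the vertex of an interior wall is unique. -/
theorem IsAbove.eq_well {w w' : S.Well} {k : Fin n} (h : w.IsAbove k) (h' : w'.IsAbove k) :
    w = w' := by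
  have key : ∀ {w w' : S.Well}, w.IsAbove k → w'.IsAbove k →
      (w'.left : ℕ) ≤ w.left ∧ (w.right : ℕ) ≤ w'.right := by
    intro w w' h h'
    have a := hasWall_iff.1 h.hasWall
    have b := hasWall_iff.1 h'.hasWall
    have e := w'.right.isLt
    constructor
    -- If `w'` began strictly inside `w`, its left boundary would be an interior wall of `w`, hence
    -- not higher than `k`. But `k` lies inside `w'` and so is lower than the boundaries of `w'`.
    · by_contra hc
      obtain ⟨i, hi⟩ := exists_inner_eq (n := n) (k := w'.left) (by omega) (by omega)
      have hv := congrArg (fun k : Fin (n + 2) => (k : ℕ)) hi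
      simp only [inner_val] at hv
      exact absurd (h.le (hasWall_iff.2 (by omega)))
        (not_le.2 (height_lt_of_hasWall (s := .left) h'.hasWall hi))
    · by_contra hc
      obtain ⟨i, hi⟩ := exists_inner_eq (n := n) (k := w'.right) (by omega)
        (by have := w.right.isLt; omega)
      have hv := congrArg (fun k : Fin (n + 2) => (k : ℕ)) hi
      simp only [inner_val] at hv
      exact absurd (h.le (hasWall_iff.2 (by omega)))
        (not_le.2 (height_lt_of_hasWall (s := .right) h'.hasWall hi))
  have h1 := key h h'
  have h2 := key h' h
  exact ext_walls (Fin.ext (by omega)) (Fin.ext (by omega))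

/-- The part of a well on the side `s` of its highest interior wall. -/
def child {w : S.Well} {k : Fin n} (h : w.IsAbove k) : Side → S.Well
  | .left =>
    { left := w.left
      right := inner k
      left_lt_right := h.1
      lower := by
        intro i h1 h2 i' h'
        have hi : w.HasWall i := ⟨h1, h2.trans h.2.1⟩
        rcases h' with h' | h'
        · exact w.lower i hi.1 hi.2 i' (Or.inl h')
        · rw [inner_injective h']
          exact h.lt hi fun e => by rw [e] at h2; exact lt_irrefl _ h2 }
  | .right =>
    { left := inner k
      right := w.right
      left_lt_right := h.2.1
      lower := by
        intro i h1 h2 i' h'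
        have hi : w.HasWall i := ⟨h.1.trans h1, h2⟩
        rcases h' with h' | h'
        · rw [inner_injective h']
          exact h.lt hi fun e => by rw [e] at h1; exact lt_irrefl _ h1
        · exact w.lower i hi.1 hi.2 i' (Or.inr h') }

theorem child_size_lt {w : S.Well} {k : Fin n} (h : w.IsAbove k) (s : Side) :
    ((child h s).right : ℕ) - (child h s).left < (w.right : ℕ) - w.left := by
  have h1 := hasWall_iff.1 h.hasWall
  cases s <;> simp only [child, inner_val] <;> omega

theorem hasWall_of_child {w : S.Well} {k : Fin n} (h : w.IsAbove k) {s : Side} {i : Fin n}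
    (hi : (child h s).HasWall i) : w.HasWall i ∧ i ≠ k := by
  have h1 := hasWall_iff.1 h.hasWall
  rw [hasWall_iff] at hi ⊢
  refine ⟨?_, ?_⟩
  · cases s <;> simp only [child, inner_val] at hi <;> omega
  · rintro rfl
    cases s <;> simp only [child, inner_val] at hi <;> omega

theorem hasCell_of_child {w : S.Well} {k : Fin n} (h : w.IsAbove k) {s : Side} {j : Fin (n + 1)}
    (hj : (child h s).HasCell j) : w.HasCell j := by
  have h1 := hasWall_iff.1 h.hasWall
  rw [hasCell_iff] at hj ⊢
  cases s <;> simp only [child, inner_val] at hj <;> omega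

theorem child_cellAt {w : S.Well} {k : Fin n} (h : w.IsAbove k) (s : Side) :
    (child h s).cellAt s = w.cellAt s := by
  cases s <;> rfl

/-- The edge below a vertex on a given side is unique. -/
theorem IsBelow.eq_well {w w' : S.Well} {s : Side} {k : Fin n} (h : w.IsBelow s k)
    (h' : w'.IsBelow s k) : w = w' := by
  have key : ∀ {w w' : S.Well}, w.IsBelow s k → w'.IsBelow s k →
      ((s = .left → (w.left : ℕ) ≤ w'.left) ∧ (s = .right → (w'.right : ℕ) ≤ w.right)) := by
    intro w w' h h'
    have e := w.left_lt_right
    have e' := w'.left_lt_right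
    rw [Fin.lt_def] at e e'
    constructor
    · rintro rfl
      have a : w.right = inner k := h.1
      have a' : w'.right = inner k := h'.1
      have b := congrArg (fun k : Fin (n + 2) => (k : ℕ)) a
      have b' := congrArg (fun k : Fin (n + 2) => (k : ℕ)) a'
      simp only [inner_val] at b b'
      -- If `w` were shorter than `w'`, its outer boundary would be a wall inside `w'`, hence lower
      -- than `k`; by `IsBelow` it is higher than `k`.
      by_contra hc
      obtain ⟨i, hi⟩ := exists_inner_eq (n := n) (k := w.left) (by omega)
        (by have := w.right.isLt; omega)
      have hv := congrArg (fun k : Fin (n + 2) => (k : ℕ)) hi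
      simp only [inner_val] at hv
      have h1 := h.2 i hi
      have h2 := height_lt_of_hasWall (w := w') (i := i) (i' := k) (s := .right)
        (hasWall_iff.2 (by omega)) a'.symm
      exact lt_asymm h1 h2
    · rintro rfl
      have a : w.left = inner k := h.1
      have a' : w'.left = inner k := h'.1
      have b := congrArg (fun k : Fin (n + 2) => (k : ℕ)) a
      have b' := congrArg (fun k : Fin (n + 2) => (k : ℕ)) a'
      simp only [inner_val] at b b'
      by_contra hc
      obtain ⟨i, hi⟩ := exists_inner_eq (n := n) (k := w.right) (by omega)
        (by have := w'.right.isLt; omega)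
      have hv := congrArg (fun k : Fin (n + 2) => (k : ℕ)) hi
      simp only [inner_val] at hv
      have h1 := h.2 i hi
      have h2 := height_lt_of_hasWall (w := w') (i := i) (i' := k) (s := .left)
        (hasWall_iff.2 (by omega)) a'.symm
      exact lt_asymm h1 h2
  have h1 := key h h'
  have h2 := key h' h
  cases s
  · exact ext_walls (Fin.ext (le_antisymm (h1.1 rfl) (h2.1 rfl)))
      ((show w.right = inner k from h.1).trans (show w'.right = inner k from h'.1).symm)
  · exact ext_walls
      ((show w.left = inner k from h.1).trans (show w'.left = inner k from h'.1).symm)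
      (Fin.ext (le_antisymm (h2.2 rfl) (h1.2 rfl)))

/-- Induction on wells, from the parts of a well to the well. -/
theorem induction_on {motive : S.Well → Prop} (w : S.Well)
    (leaf : ∀ w : S.Well, (∀ i, ¬ w.HasWall i) → motive w)
    (node : ∀ (w : S.Well) (k : Fin n) (h : w.IsAbove k), (∀ s, motive (child h s)) → motive w) :
    motive w := by
  induction' hN : (w.right : ℕ) - w.left using Nat.strong_induction_on with N ih generalizing w
  by_cases h : ∃ i, w.HasWall i
  · obtain ⟨i, hi⟩ := h
    obtain ⟨k, hk⟩ := exists_isAbove hi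
    exact node w k hk fun s => ih _ (hN ▸ child_size_lt hk s) _ rfl
  · exact leaf w (not_exists.1 h)

/-- Without interior walls the boundary walls are consecutive, so the well consists of one cell.
Such wells are the leaves of the tree. -/
theorem cellAt_eq_of_forall_not_hasWall {w : S.Well} (h : ∀ i, ¬ w.HasWall i) {j : Fin (n + 1)}
    (hj : w.HasCell j) (s : Side) : w.cellAt s = j := by
  have h1 := w.cellAt_left_val
  have h2 := w.cellAt_right_val
  have h3 := w.left_lt_right
  rw [Fin.lt_def] at h3
  rw [hasCell_iff] at hj
  have h4 : (w.right : ℕ) = w.left + 1 := by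
    by_contra hc
    have h5 := w.right.isLt
    exact h ⟨w.left, by omega⟩ (hasWall_iff.2 (by simp only; omega))
  apply Fin.ext
  cases s <;> omega

end Well

/-- The well of a particle is determined by: it contains the cell of the particle, its boundary walls
reflect the particle, and the particle passes the walls inside. -/
theorem wellAt_eq_iff {j : Fin (n + 1)} {v : ℝ} {w : S.Well} :
    S.wellAt j v = w ↔ w.HasCell j ∧ S.Blocks w.left v ∧ S.Blocks w.right v ∧
      ∀ i, w.HasWall i → S.height i < v := by
  classical
  have hl := Finset.max'_mem (Finset.univ.filter fun k => k ≤ j.castSucc ∧ S.Blocks k v)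
      ⟨0, by simp [S.blocks_zero v]⟩
  have hr := Finset.min'_mem (Finset.univ.filter fun k => j.succ ≤ k ∧ S.Blocks k v)
      ⟨Fin.last _, by simp [S.blocks_last v, Fin.le_last]⟩
  rw [Finset.mem_filter] at hl hr
  have key : ∀ k, S.Blocks k v → k ≤ (S.wellAt j v).left ∨ (S.wellAt j v).right ≤ k := by
    intro k hb
    rcases le_or_gt k j.castSucc with h | h
    · left
      exact Finset.le_max' _ k (Finset.mem_filter.2 ⟨Finset.mem_univ _, h, hb⟩)
    · right
      refine Finset.min'_le _ k (Finset.mem_filter.2 ⟨Finset.mem_univ _, ?_, hb⟩)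
      rw [Fin.lt_def] at h
      rw [Fin.le_def]
      simp only [Fin.val_castSucc, Fin.val_succ] at h ⊢
      omega
  have hj : (S.wellAt j v).HasCell j := ⟨hl.2.1, hr.2.1⟩
  have hbl : S.Blocks (S.wellAt j v).left v := hl.2.2
  have hbr : S.Blocks (S.wellAt j v).right v := hr.2.2
  have pass : ∀ {w : S.Well}, (∀ i, w.HasWall i → S.height i < v) →
      ∀ k, S.Blocks k v → k ≤ w.left ∨ w.right ≤ k := by
    intro w hw k hk
    by_contra! hc
    have h1 := hc.1
    have h2 := hc.2
    rw [Fin.lt_def] at h1 h2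
    obtain ⟨i, hi⟩ := exists_inner_eq (n := n) (k := k) (by omega)
      (by have := w.right.isLt; omega)
    exact absurd (hk i hi) (not_le.2 (hw i ⟨hi ▸ hc.1, hi ▸ hc.2⟩))
  constructor
  · rintro rfl
    refine ⟨hj, hbl, hbr, fun i hi => ?_⟩
    by_contra hc
    have hb : S.Blocks (inner i) v := fun i' h' => by
      rw [inner_injective h']; exact not_lt.1 hc
    rcases key _ hb with h | h
    · exact absurd hi.1 (not_lt.2 h)
    · exact absurd hi.2 (not_lt.2 h)
  -- The ends of both wells reflect the particle, and no reflecting wall lies inside either of them.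
  -- So the ends of each lie outside the other; as both wells contain the cell `j`, they coincide.
  · rintro ⟨h1, h2, h3, h4⟩
    have a1 := key _ h2
    have a2 := key _ h3
    have a3 := pass h4 _ hbl
    have a4 := pass h4 _ hbr
    rw [Well.hasCell_iff] at h1 hj
    simp only [Fin.le_def] at a1 a2 a3 a4
    exact Well.ext_walls (Fin.ext (by omega)) (Fin.ext (by omega))

theorem wellAt_spec (S : WallSystem n) (j : Fin (n + 1)) (v : ℝ) :
    (S.wellAt j v).HasCell j ∧ S.Blocks (S.wellAt j v).left v ∧ S.Blocks (S.wellAt j v).right v ∧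
      ∀ i, (S.wellAt j v).HasWall i → S.height i < v :=
  wellAt_eq_iff.1 rfl

theorem hasCell_wellAt (S : WallSystem n) (j : Fin (n + 1)) (v : ℝ) : (S.wellAt j v).HasCell j :=
  (S.wellAt_spec j v).1

theorem blocks_wall_wellAt (S : WallSystem n) (j : Fin (n + 1)) (v : ℝ) (s : Side) :
    S.Blocks ((S.wellAt j v).wall s) v := by
  have h := S.wellAt_spec j v
  cases s
  exacts [h.2.1, h.2.2.1]

theorem lt_of_hasWall_wellAt {j : Fin (n + 1)} {v : ℝ} {i : Fin n}
    (h : (S.wellAt j v).HasWall i) : S.height i < v := (S.wellAt_spec j v).2.2.2 i h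

theorem wellAt_eq_of_hasCell {j j' : Fin (n + 1)} {v : ℝ} (h : (S.wellAt j v).HasCell j') :
    S.wellAt j' v = S.wellAt j v :=
  wellAt_eq_iff.2 ⟨h, (S.wellAt_spec j v).2⟩

theorem wellAt_congr {j : Fin (n + 1)} {v v' : ℝ} (h : ∀ i, S.height i < v ↔ S.height i < v') :
    S.wellAt j v = S.wellAt j v' := by
  have h1 := S.wellAt_spec j v'
  refine wellAt_eq_iff.2 ⟨h1.1, fun i hi => ?_, fun i hi => ?_, fun i hi => (h i).2 (h1.2.2.2 i hi)⟩
  · exact not_lt.1 fun h' => absurd (h1.2.1 i hi) (not_le.2 ((h i).1 h'))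
  · exact not_lt.1 fun h' => absurd (h1.2.2.1 i hi) (not_le.2 ((h i).1 h'))

/-- The wells in which a cell lies decrease with the speed. -/
theorem wellAt_mono (j : Fin (n + 1)) {v v' : ℝ} (h : v' ≤ v) :
    (S.wellAt j v).left ≤ (S.wellAt j v').left ∧ (S.wellAt j v').right ≤ (S.wellAt j v).right := by
  have h1 := S.wellAt_spec j v
  have h2 := S.wellAt_spec j v'
  have c1 := Well.hasCell_iff.1 h1.1
  have c2 := Well.hasCell_iff.1 h2.1
  have e1 := (S.wellAt j v).right.isLt
  have e2 := (S.wellAt j v').right.isLt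
  constructor
  · rw [Fin.le_def]
    by_contra hc
    obtain ⟨i, hi⟩ := exists_inner_eq (n := n) (k := (S.wellAt j v).left) (by omega) (by omega)
    have hv := congrArg (fun k : Fin (n + 2) => (k : ℕ)) hi
    simp only [inner_val] at hv
    have := h2.2.2.2 i (Well.hasWall_iff.2 (by omega))
    exact absurd (h1.2.1 i hi) (not_le.2 (this.trans_le h))
  · rw [Fin.le_def]
    by_contra hc
    obtain ⟨i, hi⟩ := exists_inner_eq (n := n) (k := (S.wellAt j v).right) (by omega) (by omega)
    have hv := congrArg (fun k : Fin (n + 2) => (k : ℕ)) hi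
    simp only [inner_val] at hv
    have := h2.2.2.2 i (Well.hasWall_iff.2 (by omega))
    exact absurd (h1.2.2.1 i hi) (not_le.2 (this.trans_le h))

/-- The wall from which a particle is reflected remains a boundary of its well. -/
theorem wall_wellAt_cellAt (j : Fin (n + 1)) {v v' : ℝ} (h : v' ≤ v) (s : Side) :
    (S.wellAt ((S.wellAt j v).cellAt s) v').wall s = (S.wellAt j v).wall s := by
  have h0 := wellAt_eq_of_hasCell ((S.wellAt j v).hasCell_cellAt s)
  have h1 := S.wellAt_mono ((S.wellAt j v).cellAt s) h
  rw [h0] at h1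
  -- The new well lies inside the old one and contains the cell adjacent to the wall, so it still
  -- extends to that wall.
  have h2 := Well.hasCell_iff.1 (S.hasCell_wellAt ((S.wellAt j v).cellAt s) v')
  rw [Fin.le_def, Fin.le_def] at h1
  cases s
  · have := (S.wellAt j v).cellAt_left_val
    exact Fin.ext (by simp only [Well.wall]; omega)
  · have := (S.wellAt j v).cellAt_right_val
    exact Fin.ext (by simp only [Well.wall]; omega)

/-- After the passage of the highest wall of its well the particle is in the part of the well on
the side of its present cell. -/
theorem wellAt_cellAt_eq_child {w : S.Well} {k : Fin n} (h : w.IsAbove k) {s : Side} {v v' : ℝ}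
    (hb : ∀ s, S.Blocks (w.wall s) v) (hv : v' ≤ v) (hk : v' ≤ S.height k)
    (hlow : ∀ i, w.HasWall i → i ≠ k → S.height i < v') :
    S.wellAt (w.cellAt s) v' = Well.child h s := by
  refine wellAt_eq_iff.2 ⟨?_, ?_, ?_, ?_⟩
  · rw [← Well.child_cellAt h s]
    exact Well.hasCell_cellAt _ s
  · cases s
    · exact (hb .left).mono hv
    · intro i hi
      rw [inner_injective hi]
      exact hk
  · cases s
    · intro i hi
      rw [inner_injective hi]
      exact hk
    · exact (hb .right).mono hv
  · intro i hi
    have := Well.hasWall_of_child h hi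
    exact hlow i this.1 this.2

/-! ### Points of the graph -/

/-- The interior wall `i` lies between the cells `j` and `j'`. -/
def Between (i : Fin n) (j j' : Fin (n + 1)) : Prop := min j j' ≤ i.castSucc ∧ i.succ ≤ max j j'

theorem between_iff {i : Fin n} {j j' : Fin (n + 1)} : Between i j j' ↔
    ((j : ℕ) ≤ i ∧ (i : ℕ) + 1 ≤ j') ∨ ((j' : ℕ) ≤ i ∧ (i : ℕ) + 1 ≤ j) := by
  simp only [Between, min_le_iff, le_max_iff, Fin.le_def, Fin.val_castSucc, Fin.val_succ]
  omega

theorem barrier_le_iff {j j' : Fin (n + 1)} {h : ℝ≥0} :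
    S.barrier j j' ≤ h ↔ ∀ i, Between i j j' → S.height i ^ 2 / 2 ≤ h := by
  rw [barrier, Finset.sup_le_iff]
  simp only [Finset.mem_filter, Finset.mem_univ, true_and, Real.toNNReal_le_iff_le_coe]
  rfl

theorem Well.HasCell.hasWall_of_between {w : S.Well} {j j' : Fin (n + 1)} (h : w.HasCell j)
    (h' : w.HasCell j') {i : Fin n} (hi : Between i j j') : w.HasWall i := by
  rw [Well.hasCell_iff] at h h'
  rw [between_iff] at hi
  rw [Well.hasWall_iff]
  omega

theorem dist_point (j j' : Fin (n + 1)) (h h' : ℝ≥0) :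
    dist (S.point j h) (S.point j' h') = 2 * max (max (h : ℝ) h') (S.barrier j j') - h - h' := rfl

theorem dist_point_same (j : Fin (n + 1)) (h h' : ℝ≥0) :
    dist (S.point j h) (S.point j h') = |(h : ℝ) - h'| := by
  rw [dist_point, barrier_self, NNReal.coe_zero, max_eq_left (le_max_of_le_left h.coe_nonneg)]
  rcases le_total (h : ℝ) h' with hh | hh
  · rw [max_eq_right hh, abs_of_nonpos (by linarith)]; ring
  · rw [max_eq_left hh, abs_of_nonneg (by linarith)]; ring

theorem point_eq_point_iff {j j' : Fin (n + 1)} {h h' : ℝ≥0} :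
    S.point j h = S.point j' h' ↔ h = h' ∧ S.barrier j j' ≤ h := by
  rw [← dist_eq_zero, dist_point]
  have a1 : (h : ℝ) ≤ max (max (h : ℝ) h') (S.barrier j j') := le_max_of_le_left (le_max_left _ _)
  have a2 : (h' : ℝ) ≤ max (max (h : ℝ) h') (S.barrier j j') :=
    le_max_of_le_left (le_max_right _ _)
  have a3 : (S.barrier j j' : ℝ) ≤ max (max (h : ℝ) h') (S.barrier j j') := le_max_right _ _
  constructor
  · intro e
    exact ⟨NNReal.coe_injective (by linarith), NNReal.coe_le_coe.1 (by linarith)⟩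
  · rintro ⟨rfl, hb⟩
    rw [max_self, max_eq_left (NNReal.coe_le_coe.2 hb)]
    ring

theorem energy_point (j : Fin (n + 1)) (h : ℝ≥0) : S.energy (S.point j h) = h := rfl

theorem exists_eq_point (x : S.Graph) : ∃ j h, x = S.point j h := by
  obtain ⟨⟨j, h⟩, rfl⟩ := SeparationQuotient.surjective_mk x
  exact ⟨j, h, rfl⟩

theorem sq_half_lt_iff {a b : ℝ} (ha : 0 ≤ a) (hb : 0 ≤ b) : a ^ 2 / 2 < b ^ 2 / 2 ↔ a < b := by
  rw [div_lt_div_iff_of_pos_right two_pos]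
  exact pow_lt_pow_iff_left₀ ha hb two_ne_zero

theorem sq_half_le_iff {a b : ℝ} (ha : 0 ≤ a) (hb : 0 ≤ b) : a ^ 2 / 2 ≤ b ^ 2 / 2 ↔ a ≤ b := by
  rw [div_le_div_iff_of_pos_right two_pos]
  exact pow_le_pow_iff_left₀ ha hb two_ne_zero

theorem coe_toNNReal_sq_half (v : ℝ) : ((v ^ 2 / 2).toNNReal : ℝ) = v ^ 2 / 2 :=
  Real.coe_toNNReal _ (by positivity)

theorem energy_proj (j : Fin (n + 1)) (v : ℝ) : S.energy (S.proj j v) = v ^ 2 / 2 :=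
  coe_toNNReal_sq_half v

theorem proj_eq_proj_iff {j j' : Fin (n + 1)} {v v' : ℝ} (hv : 0 ≤ v) (hv' : 0 ≤ v') :
    S.proj j v = S.proj j' v' ↔ v = v' ∧ ∀ i, Between i j j' → S.height i ≤ v := by
  rw [proj, proj, point_eq_point_iff, barrier_le_iff]
  refine and_congr ?_ (forall_congr' fun i => imp_congr_right fun _ => ?_)
  · rw [← NNReal.coe_inj, coe_toNNReal_sq_half, coe_toNNReal_sq_half]
    constructor
    · intro h
      exact le_antisymm ((sq_half_le_iff hv hv').1 h.le) ((sq_half_le_iff hv' hv).1 h.ge)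
    · rintro rfl; rfl
  · rw [coe_toNNReal_sq_half, sq_half_le_iff (S.height_pos i).le hv]

theorem proj_abs (j : Fin (n + 1)) (v : ℝ) : S.proj j |v| = S.proj j v := by
  rw [proj, proj, sq_abs]

theorem proj_eq_vertex_iff {j : Fin (n + 1)} {v : ℝ} (hv : 0 ≤ v) {k : Fin n} :
    S.proj j v = S.vertex k ↔
      v = S.height k ∧ ∀ i, Between i j k.castSucc → S.height i ≤ v :=
  proj_eq_proj_iff hv (S.height_pos k).le

/-- The definition of an edge asks for some representative; in fact every representative has the
required properties. A cell outside `w` is separated from the cells of `w` by a boundary wall, whose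
barrier exceeds the energy, so its point is not identified with a point of the edge. -/
theorem point_mem_edge_iff {w : S.Well} {j : Fin (n + 1)} {h : ℝ≥0} :
    S.point j h ∈ w.edge ↔ 0 < h ∧ w.HasCell j ∧ (∀ i, w.HasWall i → S.height i ^ 2 / 2 < h) ∧
      ∀ i, inner i = w.left ∨ inner i = w.right → h < S.height i ^ 2 / 2 := by
  constructor
  · rintro ⟨j', h', e, h0, hl, hr, h1, h2⟩
    obtain ⟨rfl, hb⟩ := point_eq_point_iff.1 e
    rw [barrier_le_iff] at hb
    refine ⟨h0, ?_, fun i hi => h1 i hi.1 hi.2, h2⟩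
    have hj' : w.HasCell j' := ⟨hl, hr⟩
    rw [Well.hasCell_iff] at hj' ⊢
    have e2 := w.right.isLt
    by_contra hc
    have : (j : ℕ) < w.left ∨ (w.right : ℕ) ≤ j := by omega
    rcases this with h3 | h3
    · obtain ⟨i, hi⟩ := exists_inner_eq (n := n) (k := w.left) (by omega) (by omega)
      have hv := congrArg (fun k : Fin (n + 2) => (k : ℕ)) hi
      simp only [inner_val] at hv
      exact absurd (hb i (between_iff.2 (by omega))) (not_le.2 (h2 i (Or.inl hi)))
    · obtain ⟨i, hi⟩ := exists_inner_eq (n := n) (k := w.right) (by omega)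
        (by have := j.isLt; omega)
      have hv := congrArg (fun k : Fin (n + 2) => (k : ℕ)) hi
      simp only [inner_val] at hv
      exact absurd (hb i (between_iff.2 (by omega))) (not_le.2 (h2 i (Or.inr hi)))
  · rintro ⟨h0, hj, h1, h2⟩
    exact ⟨j, h, rfl, h0, hj.1, hj.2, fun i a b => h1 i ⟨a, b⟩, h2⟩

theorem proj_mem_edge_iff {w : S.Well} {j : Fin (n + 1)} {v : ℝ} (hv : 0 < v) :
    S.proj j v ∈ w.edge ↔ w.HasCell j ∧ (∀ i, w.HasWall i → S.height i < v) ∧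
      ∀ i, inner i = w.left ∨ inner i = w.right → v < S.height i := by
  rw [proj, point_mem_edge_iff]
  have h0 : 0 < (v ^ 2 / 2).toNNReal := Real.toNNReal_pos.2 (by positivity)
  simp only [h0, true_and, coe_toNNReal_sq_half]
  refine and_congr_right fun _ => and_congr (forall_congr' fun i => imp_congr_right fun _ => ?_)
    (forall_congr' fun i => imp_congr_right fun _ => ?_)
  · exact sq_half_lt_iff (S.height_pos i).le hv.le
  · exact sq_half_lt_iff hv.le (S.height_pos i).le

/-- A point of positive energy is a vertex or lies on the edge of the well of the motion. -/
theorem proj_mem_edge_or_eq_vertex (j : Fin (n + 1)) {v : ℝ} (hv : 0 < v) :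
    S.proj j v ∈ (S.wellAt j v).edge ∨ ∃ k, S.proj j v = S.vertex k := by
  by_cases h : ∀ i, inner i = (S.wellAt j v).left ∨ inner i = (S.wellAt j v).right →
      v < S.height i
  · exact Or.inl ((proj_mem_edge_iff hv).2
      ⟨S.hasCell_wellAt j v, fun i hi => lt_of_hasWall_wellAt hi, h⟩)
  -- Some boundary wall is not higher than `v`. Since it reflects the particle, its height is
  -- exactly `v`.
  · push Not at h
    obtain ⟨k, hk, hle⟩ := h
    right
    refine ⟨k, ?_⟩
    have hs := S.wellAt_spec j v
    have hvk : v = S.height k :=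
      le_antisymm (hk.elim (hs.2.1 k) (hs.2.2.1 k)) hle
    rw [proj_eq_vertex_iff hv.le]
    refine ⟨hvk, fun i hi => ?_⟩
    have hj := Well.hasCell_iff.1 hs.1
    rw [between_iff] at hi
    by_cases hik : i = k
    · rw [hik, hvk]
    have hne : (i : ℕ) ≠ k := fun e => hik (Fin.ext e)
    refine (lt_of_hasWall_wellAt (j := j) (v := v) (Well.hasWall_iff.2 ?_)).le
    rcases hk with hk | hk <;> have hv' := congrArg (fun k : Fin (n + 2) => (k : ℕ)) hk <;>
      simp only [inner_val] at hv' <;> simp only [Fin.val_castSucc] at hi <;> omega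

theorem proj_mem_edge_of_forall_ne_vertex {j : Fin (n + 1)} {v : ℝ} (hv : 0 < v)
    (h : ∀ k, S.proj j v ≠ S.vertex k) : S.proj j v ∈ (S.wellAt j v).edge :=
  (proj_mem_edge_or_eq_vertex j hv).resolve_right fun ⟨k, hk⟩ => h k hk

/-- The inequalities for the energy are strict, hence stable. For the cell, a distance below `r`
forces the barrier between the two cells below `h + r`. Both cells then give the same point at
energy `h + r`, which still belongs to the edge if `r` is small. -/
theorem isOpen_edge (w : S.Well) : IsOpen w.edge := by
  rw [Metric.isOpen_iff]
  intro x hx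
  obtain ⟨j, h, rfl⟩ := exists_eq_point x
  obtain ⟨h0, hj, h1, h2⟩ := point_mem_edge_iff.1 hx
  have ev : ∀ᶠ r in 𝓝[>] (0 : ℝ), 0 < r ∧ (r : ℝ) < h ∧
      (∀ i, w.HasWall i → S.height i ^ 2 / 2 + r < h) ∧
      ∀ i, inner i = w.left ∨ inner i = w.right → h + r < S.height i ^ 2 / 2 := by
    have small : ∀ {c : ℝ}, 0 < c → ∀ᶠ r in 𝓝[>] (0 : ℝ), r < c := fun hc =>
      (eventually_lt_nhds hc).filter_mono nhdsWithin_le_nhds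
    refine (eventually_mem_nhdsWithin).and ((small (NNReal.coe_pos.2 h0)).and
      ((eventually_all.2 fun i => ?_).and (eventually_all.2 fun i => ?_)))
    · by_cases hi : w.HasWall i
      · filter_upwards [small (sub_pos.2 (h1 i hi))] with r hr _
        linarith
      · exact Eventually.of_forall fun _ h => absurd h hi
    · by_cases hi : inner i = w.left ∨ inner i = w.right
      · filter_upwards [small (sub_pos.2 (h2 i hi))] with r hr _
        linarith
      · exact Eventually.of_forall fun _ h => absurd h hi
  obtain ⟨r, hr0, hrh, hr1, hr2⟩ := ev.exists
  refine ⟨r, hr0, fun y hy => ?_⟩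
  obtain ⟨j', h', rfl⟩ := exists_eq_point y
  rw [Metric.mem_ball, dist_point] at hy
  have a1 : (h' : ℝ) ≤ max (max (h' : ℝ) h) (S.barrier j' j) := le_max_of_le_left (le_max_left _ _)
  have a2 : (h : ℝ) ≤ max (max (h' : ℝ) h) (S.barrier j' j) := le_max_of_le_left (le_max_right _ _)
  have a3 : (S.barrier j' j : ℝ) ≤ max (max (h' : ℝ) h) (S.barrier j' j) := le_max_right _ _
  have b1 : (h : ℝ) - r < h' := by linarith
  have b2 : (h' : ℝ) < h + r := by linarith
  have hb : (S.barrier j' j : ℝ) < h + r := by linarith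
  -- the two cells lie in the same well
  have hmid : S.point j (h + r.toNNReal) = S.point j' (h + r.toNNReal) := by
    rw [point_eq_point_iff]
    refine ⟨rfl, ?_⟩
    rw [barrier_comm, ← NNReal.coe_le_coe, NNReal.coe_add, Real.coe_toNNReal r hr0.le]
    exact hb.le
  have hj' : w.HasCell j' := by
    have hin : S.point j (h + r.toNNReal) ∈ w.edge := by
      refine point_mem_edge_iff.2 ⟨by positivity, hj, fun i hi => ?_, fun i hi => ?_⟩ <;>
        rw [NNReal.coe_add, Real.coe_toNNReal r hr0.le]
      · have := h1 i hi; have : 0 < r := hr0; linarith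
      · exact hr2 i hi
    rw [hmid] at hin
    exact (point_mem_edge_iff.1 hin).2.1
  refine point_mem_edge_iff.2 ⟨NNReal.coe_pos.1 (by linarith), hj', fun i hi => ?_, fun i hi => ?_⟩
  · have := hr1 i hi; linarith
  · have := hr2 i hi; linarith

end WallSystem

namespace WallSystem

variable {n : ℕ} {S : WallSystem n}

/-! ### The cell in which a descending path ends -/

open Classical in
/-- The cell to which one descends from the well `w`, turning to the side `turn k` at each
vertex `k`. -/
noncomputable def terminal (turn : Fin n → Side) (w : S.Well) : Fin (n + 1) :=
  if h : ∃ k, w.IsAbove k then terminal turn (Well.child h.choose_spec (turn h.choose))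
  else w.cellAt .left
termination_by (w.right : ℕ) - w.left
decreasing_by exact Well.child_size_lt _ _

theorem terminal_of_isAbove (turn : Fin n → Side) {w : S.Well} {k : Fin n} (h : w.IsAbove k) :
    terminal turn w = terminal turn (Well.child h (turn k)) := by
  have hex : ∃ k, w.IsAbove k := ⟨k, h⟩
  rw [terminal, dif_pos hex]
  obtain rfl : hex.choose = k := hex.choose_spec.eq_wall h
  rfl

theorem terminal_of_forall_not (turn : Fin n → Side) {w : S.Well} (h : ∀ i, ¬ w.HasWall i) :
    terminal turn w = w.cellAt .left := by
  rw [terminal, dif_neg]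
  rintro ⟨k, hk⟩
  exact h k hk.hasWall

theorem hasCell_terminal (turn : Fin n → Side) (w : S.Well) : w.HasCell (terminal turn w) := by
  induction w using Well.induction_on with
  | leaf w h =>
    rw [terminal_of_forall_not turn h]
    exact w.hasCell_cellAt _
  | node w k h ih =>
    rw [terminal_of_isAbove turn h]
    exact Well.hasCell_of_child h (ih _)

/-- The cell in which a descending path ends lies on the chosen side of each vertex passed. -/
theorem terminal_side (turn : Fin n → Side) (w : S.Well) {k : Fin n} (hk : w.HasWall k)
    (hb : ∀ i, Between i (terminal turn w) k.castSucc → S.height i ≤ S.height k) :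
    (turn k = .left → (terminal turn w : ℕ) ≤ k) ∧
      (turn k = .right → (k : ℕ) + 1 ≤ terminal turn w) := by
  induction w using Well.induction_on with
  | leaf w h => exact absurd hk (h k)
  | node w l h ih =>
    have hc := hasCell_terminal turn (Well.child h (turn l))
    rw [terminal_of_isAbove turn h] at hb ⊢
    have ih' := ih (turn l)
    generalize terminal turn (Well.child h (turn l)) = j at hc hb ih' ⊢
    by_cases hkl : k = l
    · subst hkl
      rw [Well.hasCell_iff] at hc
      constructor <;> intro hs <;> rw [hs] at hc <;>
        simp only [Well.child, inner_val] at hc <;> omega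
    · refine ih' ?_ hb
      have hlt := h.lt hk hkl
      -- The wall `l` is higher than `k`, so by `hb` it does not separate the final cell from `k`.
      -- Hence `k` lies inside the part of the well that was entered, and induction applies.
      have hne : ¬ Between l j k.castSucc := fun hl =>
        absurd (hb l hl) (not_le.2 hlt)
      have hv : (k : ℕ) ≠ l := fun e => hkl (Fin.ext e)
      rw [between_iff] at hne
      rw [Well.hasCell_iff] at hc
      rw [Well.hasWall_iff] at hk ⊢
      simp only [Fin.val_castSucc] at hne
      cases hs : turn l <;> rw [hs] at hc <;>
        simp only [Well.child, inner_val] at hc ⊢ <;> omega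

/-- At speed exactly `S.height k` the wall `k` reflects. By `hb`, any other reflecting wall on the
way to `k` would have the same height, which is excluded because heights are distinct; so `k` bounds
the well. The opposite boundary also reflects, and for the same reason it is strictly higher. -/
theorem wellAt_isBelow {j : Fin (n + 1)} {k : Fin n} {s : Side}
    (hb : ∀ i, Between i j k.castSucc → S.height i ≤ S.height k)
    (hs : (s = .left → (j : ℕ) ≤ k) ∧ (s = .right → (k : ℕ) + 1 ≤ j)) :
    (S.wellAt j (S.height k)).IsBelow s k := by
  have hj := Well.hasCell_iff.1 (S.hasCell_wellAt j (S.height k))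
  have hnot : ¬ (S.wellAt j (S.height k)).HasWall k := fun h =>
    lt_irrefl _ (lt_of_hasWall_wellAt h)
  rw [Well.hasWall_iff] at hnot
  have hbl := S.blocks_wall_wellAt j (S.height k)
  have hflip : (S.wellAt j (S.height k)).wall s.flip = inner k := by
    have e2 := (S.wellAt j (S.height k)).right.isLt
    have step : ∀ i : Fin n, inner i = (S.wellAt j (S.height k)).wall s.flip →
        Between i j k.castSucc → inner k = (S.wellAt j (S.height k)).wall s.flip := by
      intro i hi hbt
      rw [S.height_injective (le_antisymm (hb i hbt) (hbl _ i hi))] at hi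
      exact hi
    by_contra hne
    cases s
    · have h1 := hs.1 rfl
      have hne' : (k : ℕ) + 1 ≠ (S.wellAt j (S.height k)).right := fun e =>
        hne (Fin.ext (by rw [inner_val]; exact e.symm))
      obtain ⟨i, hi⟩ := exists_inner_eq (n := n) (k := (S.wellAt j (S.height k)).right) (by omega)
        (by have := k.isLt; omega)
      have hv := congrArg (fun k : Fin (n + 2) => (k : ℕ)) hi
      simp only [inner_val] at hv
      exact hne (step i hi (between_iff.2 (by simp only [Fin.val_castSucc]; omega))).symm
    · have h1 := hs.2 rfl
      have hne' : (k : ℕ) + 1 ≠ (S.wellAt j (S.height k)).left := fun e =>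
        hne (Fin.ext (by rw [inner_val]; exact e.symm))
      obtain ⟨i, hi⟩ := exists_inner_eq (n := n) (k := (S.wellAt j (S.height k)).left) (by omega)
        (by have := j.isLt; omega)
      have hv := congrArg (fun k : Fin (n + 2) => (k : ℕ)) hi
      simp only [inner_val] at hv
      exact hne (step i hi (between_iff.2 (by simp only [Fin.val_castSucc]; omega))).symm
  refine ⟨hflip, fun i hi => (hbl s i hi).lt_of_ne fun e => ?_⟩
  rw [← S.height_injective e] at hi
  have hlr := (S.wellAt j (S.height k)).left_lt_right.ne
  cases s
  · exact hlr (hi.symm.trans hflip.symm)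
  · exact hlr (hflip.trans hi)

/-- A vertex that lies below a point of the edge of `w` and above the cell `j` of `w` corresponds to
a wall inside `w`. -/
theorem hasWall_of_proj_eq_vertex {w : S.Well} {j j₀ : Fin (n + 1)} {v₀ v : ℝ} {k : Fin n}
    (hj : w.HasCell j) (hv₀ : 0 < v₀) (h₀ : S.proj j₀ v₀ ∈ w.edge) (hv : v ≤ v₀)
    (hv' : v = S.height k) (hb : ∀ i, Between i j k.castSucc → S.height i ≤ v) :
    w.HasWall k := by
  have hbd := ((proj_mem_edge_iff hv₀).1 h₀).2.2
  rw [Well.hasCell_iff] at hj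
  rw [Well.hasWall_iff]
  have e2 := w.right.isLt
  -- Otherwise a boundary wall of `w` separates `j` from `k` or is `k` itself. Its height is then at
  -- most `v ≤ v₀`, whereas the starting point lies below the boundaries of `w`.
  by_contra hc
  have hcases : (k : ℕ) + 1 ≤ w.left ∨ (w.right : ℕ) ≤ k + 1 := by omega
  have fin : ∀ i, (inner i = w.left ∨ inner i = w.right) → S.height i ≤ v → False :=
    fun i hi hle => absurd (hbd i hi) (not_lt.2 (hle.trans hv))
  have hk := k.isLt
  rcases hcases with h | h
  · obtain ⟨i, hi⟩ := exists_inner_eq (n := n) (k := w.left) (by omega)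
      (by have := j.isLt; omega)
    have hval := congrArg (fun k : Fin (n + 2) => (k : ℕ)) hi
    simp only [inner_val] at hval
    refine fin i (Or.inl hi) ?_
    by_cases hik : (i : ℕ) = k
    · rw [Fin.ext hik, hv']
    · exact hb i (between_iff.2 (by simp only [Fin.val_castSucc]; omega))
  · obtain ⟨i, hi⟩ := exists_inner_eq (n := n) (k := w.right) (by omega) (by omega)
    have hval := congrArg (fun k : Fin (n + 2) => (k : ℕ)) hi
    simp only [inner_val] at hval
    refine fin i (Or.inr hi) ?_
    by_cases hik : (i : ℕ) = k
    · rw [Fin.ext hik, hv']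
    · exact hb i (between_iff.2 (by simp only [Fin.val_castSucc]; omega))

/-! ### The averaged motion -/

theorem measurable_wellAt (S : WallSystem n) (j : Fin (n + 1)) : Measurable (S.wellAt j) := by
  refine measurable_to_countable' fun w => ?_
  have : S.wellAt j ⁻¹' {w} = {v | w.HasCell j ∧ S.Blocks w.left v ∧ S.Blocks w.right v ∧
      ∀ i, w.HasWall i → S.height i < v} := by
    ext v
    exact wellAt_eq_iff
  rw [this]
  have hb : ∀ k, MeasurableSet {v | S.Blocks k v} := fun k => by
    have : {v | S.Blocks k v} = ⋂ i, ⋂ _ : inner i = k, Iic (S.height i) := by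
      ext v; simp [Blocks]
    rw [this]
    exact MeasurableSet.iInter fun i => MeasurableSet.iInter fun _ => measurableSet_Iic
  have hw : MeasurableSet {v | ∀ i, w.HasWall i → S.height i < v} := by
    have : {v | ∀ i, w.HasWall i → S.height i < v} = ⋂ i, ⋂ _ : w.HasWall i, Ioi (S.height i) := by
      ext v; simp
    rw [this]
    exact MeasurableSet.iInter fun i => MeasurableSet.iInter fun _ => measurableSet_Ioi
  exact (MeasurableSet.const _).inter ((hb _).inter ((hb _).inter hw))

/-- The rate at which the time elapses in the averaged motion as the slowness (the inverse of the
speed) increases. -/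
noncomputable def pace (c : S.Well → Side → ℝ) (w : S.Well) : ℝ :=
  2 * w.width / (c w .left + c w .right)

theorem pace_pos {c : S.Well → Side → ℝ} (hc : ∀ w s, 0 < c w s) (w : S.Well) : 0 < pace c w :=
  div_pos (mul_pos two_pos w.width_pos) (add_pos (hc w .left) (hc w .right))

theorem exists_pace_bounds {c : S.Well → Side → ℝ} (hc : ∀ w s, 0 < c w s) :
    ∃ a b : ℝ, 0 < a ∧ 0 < b ∧ ∀ w, a ≤ pace c w ∧ pace c w ≤ b := by
  have : Nonempty S.Well := ⟨S.wellAt 0 0⟩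
  obtain ⟨w, hw⟩ := Finite.exists_min (pace c)
  obtain ⟨w', hw'⟩ := Finite.exists_max (pace c)
  exact ⟨_, _, pace_pos hc w, pace_pos hc w', fun x => ⟨hw x, hw' x⟩⟩

/-- The time at which the averaged motion descending to the cell `j` has the slowness `u`, when it
starts with the slowness `u₀`. -/
noncomputable def clock (c : S.Well → Side → ℝ) (j : Fin (n + 1)) (u₀ u : ℝ) : ℝ :=
  ∫ s in u₀..u, pace c (S.wellAt j s⁻¹)

section Clock

variable {c : S.Well → Side → ℝ} (hc : ∀ w s, 0 < c w s) (j : Fin (n + 1)) (u₀ : ℝ)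

include hc

omit hc in
theorem measurable_pace_wellAt : Measurable fun s : ℝ => pace c (S.wellAt j s⁻¹) :=
  (measurable_of_finite (pace c)).comp ((S.measurable_wellAt j).comp measurable_inv)

theorem intervalIntegrable_pace (a b : ℝ) :
    IntervalIntegrable (fun s : ℝ => pace c (S.wellAt j s⁻¹)) volume a b := by
  obtain ⟨_, B, _, _, h⟩ := exists_pace_bounds hc
  refine (intervalIntegrable_const (c := B)).mono_fun
    (measurable_pace_wellAt j).aestronglyMeasurable (Eventually.of_forall fun s => ?_)
  simp only []
  rw [Real.norm_of_nonneg (pace_pos hc _).le]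
  exact (h _).2.trans (le_abs_self B)

theorem clock_sub (a b : ℝ) :
    clock c j u₀ b - clock c j u₀ a = ∫ s in a..b, pace c (S.wellAt j s⁻¹) :=
  intervalIntegral.integral_interval_sub_left (intervalIntegrable_pace hc j _ _)
    (intervalIntegrable_pace hc j _ _)

theorem le_clock_sub {A : ℝ} (hA : ∀ w, A ≤ pace c w) {a b : ℝ} (hab : a ≤ b) :
    A * (b - a) ≤ clock c j u₀ b - clock c j u₀ a := by
  rw [clock_sub hc]
  have := intervalIntegral.integral_mono_on (μ := volume) hab (intervalIntegrable_const (c := A))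
    (intervalIntegrable_pace hc j a b) fun s _ => hA _
  simpa [mul_comm] using this

theorem clock_sub_le {B : ℝ} (hB : ∀ w, pace c w ≤ B) {a b : ℝ} (hab : a ≤ b) :
    clock c j u₀ b - clock c j u₀ a ≤ B * (b - a) := by
  rw [clock_sub hc]
  have := intervalIntegral.integral_mono_on (μ := volume) hab
    (intervalIntegrable_pace hc j a b) (intervalIntegrable_const (c := B)) fun s _ => hB _
  simpa [mul_comm] using this

theorem abs_sub_le_of_clock {A : ℝ} (hA0 : 0 < A) (hA : ∀ w, A ≤ pace c w) (a b : ℝ) :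
    |a - b| ≤ |clock c j u₀ a - clock c j u₀ b| / A := by
  rw [le_div_iff₀ hA0]
  rcases le_total a b with h | h
  · have := le_clock_sub hc j u₀ hA h
    rw [abs_of_nonpos (by linarith), abs_of_nonpos (by nlinarith)]
    linarith
  · have := le_clock_sub hc j u₀ hA h
    rw [abs_of_nonneg (by linarith), abs_of_nonneg (by nlinarith)]
    linarith

theorem strictMono_clock : StrictMono (clock c j u₀) := by
  obtain ⟨A, _, hA0, _, h⟩ := exists_pace_bounds hc
  intro a b hab
  have := le_clock_sub hc j u₀ (fun w => (h w).1) hab.le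
  nlinarith [mul_pos hA0 (sub_pos.2 hab)]

theorem continuous_clock : Continuous (clock c j u₀) :=
  intervalIntegral.continuous_primitive (fun a b => intervalIntegrable_pace hc j a b) u₀

omit hc in
theorem clock_self : clock c j u₀ u₀ = 0 := intervalIntegral.integral_same

theorem bijective_clock : Function.Bijective (clock c j u₀) := by
  refine ⟨(strictMono_clock hc j u₀).injective, (continuous_clock hc j u₀).surjective ?_ ?_⟩
  · obtain ⟨A, _, hA0, _, h⟩ := exists_pace_bounds hc
    refine tendsto_atTop_mono' atTop ?_
      ((tendsto_id.atTop_add (tendsto_const_nhds (x := -u₀))).const_mul_atTop hA0)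
    filter_upwards [eventually_ge_atTop u₀] with b hb
    have := le_clock_sub hc j u₀ (fun w => (h w).1) hb
    rw [clock_self] at this
    simpa [sub_eq_add_neg] using this
  · obtain ⟨A, _, hA0, _, h⟩ := exists_pace_bounds hc
    refine tendsto_atBot_mono' atBot ?_
      ((tendsto_id.atBot_add (tendsto_const_nhds (x := -u₀))).const_mul_atBot hA0)
    filter_upwards [eventually_le_atBot u₀] with b hb
    have := le_clock_sub hc j u₀ (fun w => (h w).1) hb
    rw [clock_self] at this
    simp only [id]
    linarith

end Clock

/-- The slowness (the inverse of the speed) in the averaged motion that descends to the cell `j`. -/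
noncomputable def slowness (c : S.Well → Side → ℝ) (j : Fin (n + 1)) (u₀ : ℝ) : ℝ → ℝ :=
  Function.invFun (clock c j u₀)

section Slowness

variable {c : S.Well → Side → ℝ} (hc : ∀ w s, 0 < c w s) (j : Fin (n + 1)) (u₀ : ℝ)

include hc

theorem clock_slowness (t : ℝ) : clock c j u₀ (slowness c j u₀ t) = t :=
  Function.rightInverse_invFun (bijective_clock hc j u₀).2 t

theorem slowness_clock (u : ℝ) : slowness c j u₀ (clock c j u₀ u) = u :=
  Function.leftInverse_invFun (bijective_clock hc j u₀).1 u

theorem slowness_zero : slowness c j u₀ 0 = u₀ := by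
  rw [← clock_self j u₀, slowness_clock hc]

theorem strictMono_slowness : StrictMono (slowness c j u₀) := by
  intro a b hab
  rw [← (strictMono_clock hc j u₀).lt_iff_lt, clock_slowness hc, clock_slowness hc]
  exact hab

theorem le_slowness {t : ℝ} (ht : 0 ≤ t) : u₀ ≤ slowness c j u₀ t := by
  have := (strictMono_slowness hc j u₀).monotone ht
  rwa [slowness_zero hc] at this

/-- A slowness at which the clock nearly shows the time `t` is nearly the slowness at time `t`. -/
theorem abs_slowness_sub_le {A : ℝ} (hA0 : 0 < A) (hA : ∀ w, A ≤ pace c w) (t u : ℝ) :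
    |slowness c j u₀ t - u| ≤ |t - clock c j u₀ u| / A := by
  have := abs_sub_le_of_clock hc j u₀ hA0 hA (slowness c j u₀ t) u
  rwa [clock_slowness hc] at this

theorem continuous_slowness : Continuous (slowness c j u₀) := by
  obtain ⟨A, _, hA0, _, h⟩ := exists_pace_bounds hc
  refine LipschitzWith.continuous (K := (A⁻¹).toNNReal) (LipschitzWith.of_dist_le_mul fun x y => ?_)
  rw [Real.dist_eq, Real.dist_eq, Real.coe_toNNReal _ (inv_nonneg.2 hA0.le), inv_mul_eq_div]
  have := abs_slowness_sub_le hc j u₀ hA0 (fun w => (h w).1) x (slowness c j u₀ y)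
  rwa [clock_slowness hc] at this

/-- Inside an edge the speed is strictly between the relevant heights, so the well is locally
constant in the slowness. The clock therefore has the derivative `pace c w` there, and the slowness
is its inverse function. -/
theorem hasDerivAt_slowness {w : S.Well} {t : ℝ} (ht : 0 < slowness c j u₀ t)
    (hw : S.proj j (slowness c j u₀ t)⁻¹ ∈ w.edge) :
    HasDerivAt (slowness c j u₀) (pace c w)⁻¹ t := by
  set u := slowness c j u₀ t with hu
  obtain ⟨h1, h2, h3⟩ := (proj_mem_edge_iff (inv_pos.2 ht)).1 hw
  have hcont : ContinuousAt (fun s : ℝ => s⁻¹) u := continuousAt_inv₀ ht.ne'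
  have hev : ∀ᶠ s : ℝ in 𝓝 u, S.wellAt j s⁻¹ = w := by
    have e2 : ∀ᶠ s : ℝ in 𝓝 u, ∀ i, w.HasWall i → S.height i < s⁻¹ :=
      eventually_all.2 fun i => by
        by_cases hi : w.HasWall i
        · filter_upwards [hcont.eventually (eventually_gt_nhds (h2 i hi))] with s hs _ using hs
        · exact Eventually.of_forall fun _ h => absurd h hi
    have e3 : ∀ᶠ s : ℝ in 𝓝 u, ∀ i, inner i = w.left ∨ inner i = w.right → s⁻¹ < S.height i :=
      eventually_all.2 fun i => by
        by_cases hi : inner i = w.left ∨ inner i = w.right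
        · filter_upwards [hcont.eventually (eventually_lt_nhds (h3 i hi))] with s hs _ using hs
        · exact Eventually.of_forall fun _ h => absurd h hi
    filter_upwards [e2, e3] with s hs2 hs3
    exact wellAt_eq_iff.2 ⟨h1, fun i hi => (hs3 i (Or.inl hi)).le,
      fun i hi => (hs3 i (Or.inr hi)).le, hs2⟩
  have hder : HasDerivAt (clock c j u₀) (pace c w) u := by
    have hca : ContinuousAt (fun s : ℝ => pace c (S.wellAt j s⁻¹)) u :=
      (continuousAt_const (y := pace c w)).congr
        (hev.mono fun s hs => by simp only [hs])
    have := intervalIntegral.integral_hasDerivAt_right (intervalIntegrable_pace hc j u₀ u)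
      (measurable_pace_wellAt j).stronglyMeasurable.stronglyMeasurableAtFilter hca
    rwa [hev.self_of_nhds] at this
  exact HasDerivAt.of_local_left_inverse (continuous_slowness hc j u₀).continuousAt hder
    (pace_pos hc w).ne' (Eventually.of_forall fun t => clock_slowness hc j u₀ t)

end Slowness

/-- For `H = v ^ 2 / 2` the period is `2 m / v`. Since `dH/dt = v * dv/dt`, the equation becomes
`dv/dt = -v ^ 2 / pace`, that is, the slowness `1 / v` grows at the rate `1 / pace`. -/
theorem drift_sq_half {c : S.Well → Side → ℝ} (hc : ∀ w s, 0 < c w s) (w : S.Well) {v : ℝ}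
    (hv : 0 < v) : drift c w (v ^ 2 / 2) = -v ^ 3 / pace c w := by
  have h1 : √(v ^ 2 / 2) = v / √2 := by
    rw [Real.sqrt_div (sq_nonneg v), Real.sqrt_sq hv.le]
  have h2 : √2 * √2 = 2 := Real.mul_self_sqrt (by norm_num)
  have h3 : √2 * w.width / (v / √2) = 2 * w.width / v := by
    rw [div_div_eq_mul_div]
    congr 1
    linear_combination w.width * h2
  have h4 := w.width_pos.ne'
  have h5 := (add_pos (hc w .left) (hc w .right)).ne'
  rw [drift, Well.period, h1, h3, pace]
  field_simp

theorem dist_proj_same (j : Fin (n + 1)) (v v' : ℝ) :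
    dist (S.proj j v) (S.proj j v') = |v ^ 2 / 2 - v' ^ 2 / 2| := by
  rw [proj, proj, dist_point_same, coe_toNNReal_sq_half, coe_toNNReal_sq_half]

theorem continuous_proj (j : Fin (n + 1)) : Continuous (S.proj j) := by
  rw [Metric.continuous_iff']
  intro v ε hε
  have : Tendsto (fun v' : ℝ => |v' ^ 2 / 2 - v ^ 2 / 2|) (𝓝 v) (𝓝 0) := by
    have h : Continuous fun v' : ℝ => |v' ^ 2 / 2 - v ^ 2 / 2| := by fun_prop
    have := h.tendsto v
    simpa using this
  filter_upwards [this.eventually (eventually_lt_nhds hε)] with v' h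
  rwa [dist_proj_same]

/-- The path of the averaged motion from speed `v₀` that descends to the cell `j`. -/
noncomputable def limitPath {c : S.Well → Side → ℝ} (hc : ∀ w s, 0 < c w s) (j : Fin (n + 1))
    {v₀ : ℝ} (hv₀ : 0 < v₀) (T : ℝ) : C(Icc (0 : ℝ) T, S.Graph) where
  toFun t := S.proj j (slowness c j v₀⁻¹ t)⁻¹
  continuous_toFun := by
    refine (continuous_proj j).comp (((continuous_slowness hc j v₀⁻¹).comp
      continuous_subtype_val).inv₀ fun t => ?_)
    exact ((inv_pos.2 hv₀).trans_le (le_slowness hc j v₀⁻¹ t.2.1)).ne'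

end WallSystem

namespace WallSystem

variable {n : ℕ} {S : WallSystem n}

/-! ### The limiting paths -/

/-- Two points of the same edge with the same energy are equal. -/
theorem eq_of_mem_edge {w : S.Well} {x y : S.Graph} (hx : x ∈ w.edge) (hy : y ∈ w.edge)
    (h : S.energy x = S.energy y) : x = y := by
  obtain ⟨j, a, rfl⟩ := exists_eq_point x
  obtain ⟨j', b, rfl⟩ := exists_eq_point y
  rw [energy_point, energy_point, NNReal.coe_inj] at h
  subst h
  obtain ⟨_, h1, h2, _⟩ := point_mem_edge_iff.1 hx
  obtain ⟨_, h1', _, _⟩ := point_mem_edge_iff.1 hy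
  refine point_eq_point_iff.2 ⟨rfl, barrier_le_iff.2 fun i hi => ?_⟩
  exact (h2 i (h1.hasWall_of_between h1' hi)).le

theorem energy_pos_of_mem_edge {w : S.Well} {x : S.Graph} (hx : x ∈ w.edge) : 0 < S.energy x := by
  obtain ⟨j, a, rfl⟩ := exists_eq_point x
  exact NNReal.coe_pos.2 (point_mem_edge_iff.1 hx).1

theorem continuous_energy : Continuous S.energy := by
  rw [Metric.continuous_iff]
  intro x ε hε
  refine ⟨ε, hε, fun y hy => lt_of_le_of_lt ?_ hy⟩
  obtain ⟨j, a, rfl⟩ := exists_eq_point x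
  obtain ⟨j', b, rfl⟩ := exists_eq_point y
  rw [energy_point, energy_point, dist_point, Real.dist_eq, abs_le]
  have a1 : (a : ℝ) ≤ max (max (b : ℝ) a) (S.barrier j' j) := le_max_of_le_left (le_max_right _ _)
  have a2 : (b : ℝ) ≤ max (max (b : ℝ) a) (S.barrier j' j) := le_max_of_le_left (le_max_left _ _)
  constructor <;> linarith

theorem limitPath_apply {c : S.Well → Side → ℝ} (hc : ∀ w s, 0 < c w s) (j : Fin (n + 1))
    {v₀ : ℝ} (hv₀ : 0 < v₀) (T : ℝ) (t : Icc (0 : ℝ) T) :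
    limitPath hc j hv₀ T t = S.proj j (slowness c j v₀⁻¹ t)⁻¹ := rfl

theorem slowness_pos {c : S.Well → Side → ℝ} (hc : ∀ w s, 0 < c w s) (j : Fin (n + 1))
    {v₀ : ℝ} (hv₀ : 0 < v₀) {t : ℝ} (ht : 0 ≤ t) : 0 < slowness c j v₀⁻¹ t :=
  (inv_pos.2 hv₀).trans_le (le_slowness hc j v₀⁻¹ ht)

theorem inv_slowness_le {c : S.Well → Side → ℝ} (hc : ∀ w s, 0 < c w s) (j : Fin (n + 1))
    {v₀ : ℝ} (hv₀ : 0 < v₀) {t : ℝ} (ht : 0 ≤ t) : (slowness c j v₀⁻¹ t)⁻¹ ≤ v₀ :=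
  inv_le_of_inv_le₀ hv₀ (le_slowness hc j v₀⁻¹ ht)

/-- The path that descends to the cell determined by the turns is a path of the limiting process. -/
theorem isLimitPath_limitPath {c : S.Well → Side → ℝ} (hc : ∀ w s, 0 < c w s) {T : ℝ} (hT : 0 < T)
    {j₀ : Fin (n + 1)} {v₀ : ℝ} (hv₀ : 0 < v₀) {w₀ : S.Well} (h₀ : S.proj j₀ v₀ ∈ w₀.edge)
    (turn : Fin n → Side) :
    IsLimitPath hT c (S.proj j₀ v₀) turn (limitPath hc (terminal turn w₀) hv₀ T) := by
  have hj := hasCell_terminal turn w₀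
  have hside := fun k hk => terminal_side turn w₀ (k := k) hk
  set j := terminal turn w₀ with hjdef
  have h₀' := (proj_mem_edge_iff hv₀).1 h₀
  refine ⟨?_, ?_, ?_⟩
  · rw [limitPath_apply, slowness_zero hc, inv_inv, proj_eq_proj_iff hv₀.le hv₀.le]
    exact ⟨rfl, fun i hi => (h₀'.2.1 i (hj.hasWall_of_between h₀'.1 hi)).le⟩
  · intro w t ht
    have hpos := slowness_pos hc j hv₀ t.2.1
    have hd := hasDerivAt_slowness hc j v₀⁻¹ hpos ht
    rw [limitPath_apply, energy_proj, drift_sq_half hc w (inv_pos.2 hpos)]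
    have hd2 : HasDerivAt (fun s => (slowness c j v₀⁻¹ s)⁻¹ ^ 2 / 2)
        (-(slowness c j v₀⁻¹ t)⁻¹ ^ 3 / pace c w) t := by
      have := ((hd.inv hpos.ne').pow 2).div_const 2
      refine this.congr_deriv ?_
      have hp := (pace_pos hc w).ne'
      have hq := hpos.ne'
      simp only [Pi.inv_apply, Nat.cast_ofNat, show (2 - 1 : ℕ) = 1 from rfl, pow_one]
      field_simp
    refine hd2.hasDerivWithinAt.congr (fun s hs => ?_) ?_
    · rw [projIcc_of_mem hT.le hs, limitPath_apply, energy_proj]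
    · rw [projIcc_of_mem hT.le t.2, limitPath_apply, energy_proj]
  · intro k t htT ht
    have hpos := slowness_pos hc j hv₀ t.2.1
    rw [limitPath_apply, proj_eq_vertex_iff (inv_pos.2 hpos).le] at ht
    -- A vertex met on the way belongs to a wall inside the initial well, so `terminal_side` tells
    -- on which side of it the final cell lies.
    have hkw : w₀.HasWall k :=
      hasWall_of_proj_eq_vertex hj hv₀ h₀ (inv_slowness_le hc j hv₀ t.2.1) ht.1 ht.2
    have hb := fun i hi => (ht.2 i hi).trans ht.1.le
    refine ⟨S.wellAt j (S.height k), wellAt_isBelow hb (hside k hkw hb), ?_⟩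
    have hspec := S.wellAt_spec j (S.height k)
    have hcont : ContinuousAt (fun s => (slowness c j v₀⁻¹ s)⁻¹) t :=
      (continuous_slowness hc j v₀⁻¹).continuousAt.inv₀ hpos.ne'
    have e1 : ∀ᶠ s in 𝓝[>] (t : ℝ), ∀ i, (S.wellAt j (S.height k)).HasWall i →
        S.height i < (slowness c j v₀⁻¹ s)⁻¹ :=
      eventually_all.2 fun i => by
        by_cases hi : (S.wellAt j (S.height k)).HasWall i
        · filter_upwards [(hcont.eventually (eventually_gt_nhds
            ((hspec.2.2.2 i hi).trans_eq ht.1.symm))).filter_mono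
            nhdsWithin_le_nhds] with s hs _ using hs
        · exact Eventually.of_forall fun _ h => absurd h hi
    filter_upwards [e1, Ioo_mem_nhdsGT htT] with s hs1 hs2
    have hs0 : 0 ≤ s := t.2.1.trans hs2.1.le
    -- The speed has strictly decreased, so the inequality at the boundary walls of the new well
    -- becomes strict right after `t`.
    have hlt : (slowness c j v₀⁻¹ s)⁻¹ < S.height k := by
      rw [← ht.1]
      exact inv_strictAnti₀ hpos (strictMono_slowness hc j v₀⁻¹ hs2.1)
    rw [projIcc_of_mem hT.le ⟨hs0, hs2.2.le⟩, limitPath_apply,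
      proj_mem_edge_iff (inv_pos.2 (slowness_pos hc j hv₀ hs0))]
    refine ⟨hspec.1, hs1, fun i hi => hlt.trans_le ?_⟩
    exact hi.elim (hspec.2.1 i) (hspec.2.2.1 i)

/-- The inverse speed grows linearly along an edge. -/
theorem IsLimitPath.slowness_eq {c : S.Well → Side → ℝ} (hc : ∀ w s, 0 < c w s) {T : ℝ}
    {hT : 0 < T} {y₀ : S.Graph} {turn : Fin n → Side} {y : C(Icc (0 : ℝ) T, S.Graph)}
    (h : IsLimitPath hT c y₀ turn y) {w : S.Well} {t t₁ : ℝ} (ht : 0 ≤ t) (htt : t < t₁)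
    (ht₁ : t₁ ≤ T) (hpos : 0 < S.energy (y (projIcc 0 T hT.le t)))
    (hedge : ∀ s ∈ Ioc t t₁, y (projIcc 0 T hT.le s) ∈ w.edge) :
    (√(2 * S.energy (y (projIcc 0 T hT.le t₁))))⁻¹ =
      (√(2 * S.energy (y (projIcc 0 T hT.le t))))⁻¹ + (t₁ - t) / pace c w := by
  set e : ℝ → ℝ := fun s => S.energy (y (projIcc 0 T hT.le s)) with he
  have hepos : ∀ s ∈ Icc t t₁, 0 < e s := by
    intro s hs
    rcases hs.1.eq_or_lt with rfl | h'
    · exact hpos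
    · exact energy_pos_of_mem_edge (hedge s ⟨h', hs.2⟩)
  have hcont : Continuous e :=
    continuous_energy.comp (y.continuous.comp continuous_projIcc)
  have hd : ∀ s ∈ Ioo t t₁, HasDerivAt (fun s => (√(2 * e s))⁻¹) (1 / pace c w) s := by
    intro s hs
    have hsT : s ∈ Icc 0 T := ⟨ht.trans hs.1.le, hs.2.le.trans ht₁⟩
    have hE := hedge s ⟨hs.1, hs.2.le⟩
    rw [projIcc_of_mem hT.le hsT] at hE
    have h1 : HasDerivAt e _ s := (h.ode w ⟨s, hsT⟩ hE).hasDerivAt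
      (Icc_mem_nhds (ht.trans_lt hs.1) (hs.2.trans_le ht₁))
    have hes : S.energy (y ⟨s, hsT⟩) = e s := by
      rw [he]; simp only [projIcc_of_mem hT.le hsT]
    rw [hes] at h1
    have hp : 0 < e s := hepos s ⟨hs.1.le, hs.2.le⟩
    have hv : 0 < √(2 * e s) := Real.sqrt_pos.2 (by linarith)
    have hsq : √(2 * e s) ^ 2 = 2 * e s := Real.sq_sqrt (by linarith)
    have h2 : drift c w (e s) = -√(2 * e s) ^ 3 / pace c w := by
      rw [← drift_sq_half hc w hv, hsq]; congr 1; ring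
    rw [h2] at h1
    have h3 := ((h1.const_mul 2).sqrt (by linarith)).inv hv.ne'
    refine h3.congr_deriv ?_
    have hpp := (pace_pos hc w).ne'
    have hvv := hv.ne'
    field_simp
  have hcont' : ContinuousOn (fun s => (√(2 * e s))⁻¹) (Icc t t₁) := by
    refine ContinuousOn.inv₀ (by fun_prop) fun s hs => ?_
    exact (Real.sqrt_pos.2 (by have := hepos s hs; linarith)).ne'
  -- The left endpoint may be a vertex, where the equation says nothing. The mean value theorem
  -- needs the derivative, which is constant, only in the open interval.
  obtain ⟨s, hs, hs'⟩ := exists_hasDerivAt_eq_slope _ _ htt hcont' hd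
  have hne : t₁ - t ≠ 0 := (sub_pos.2 htt).ne'
  rw [eq_div_iff hne] at hs'
  simp only [he] at hs'
  linarith [hs', show 1 / pace c w * (t₁ - t) = (t₁ - t) / pace c w by ring]

/-- A path of the limiting process is determined by the turns. -/
theorem IsLimitPath.eq_limitPath {c : S.Well → Side → ℝ} (hc : ∀ w s, 0 < c w s) {T : ℝ}
    {hT : 0 < T} {j₀ : Fin (n + 1)} {v₀ : ℝ} (hv₀ : 0 < v₀) {w₀ : S.Well}
    (h₀ : S.proj j₀ v₀ ∈ w₀.edge) {turn : Fin n → Side} {y : C(Icc (0 : ℝ) T, S.Graph)}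
    (h : IsLimitPath hT c (S.proj j₀ v₀) turn y) :
    y = limitPath hc (terminal turn w₀) hv₀ T := by
  have h' := isLimitPath_limitPath hc hT hv₀ h₀ turn
  set z := limitPath hc (terminal turn w₀) hv₀ T with hz
  set A : Set ℝ := {t | y (projIcc 0 T hT.le t) = z (projIcc 0 T hT.le t)} with hA
  have hclosed : IsClosed A := isClosed_eq (y.continuous.comp continuous_projIcc)
    (z.continuous.comp continuous_projIcc)
  -- Continuous induction: the set of times of agreement is closed, contains `0`, and extends to the
  -- right of each of its points.
  have hsub : Icc 0 T ⊆ A := by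
    refine (hclosed.inter isClosed_Icc).Icc_subset_of_forall_exists_gt ?_ ?_
    · show y (projIcc 0 T hT.le 0) = z (projIcc 0 T hT.le 0)
      rw [projIcc_left]
      exact h.init.trans h'.init.symm
    · rintro t ⟨htA, ht⟩ b hb
      have htA' : y (projIcc 0 T hT.le t) = z (projIcc 0 T hT.le t) := htA
      have htI : t ∈ Icc 0 T := ⟨ht.1, ht.2.le⟩
      have hpos : 0 < slowness c (terminal turn w₀) v₀⁻¹ t := slowness_pos hc _ hv₀ ht.1
      have hzt : z (projIcc 0 T hT.le t) =
          S.proj (terminal turn w₀) (slowness c (terminal turn w₀) v₀⁻¹ t)⁻¹ := by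
        rw [projIcc_of_mem hT.le htI, hz, limitPath_apply]
      -- Right after `t` both paths are on one common edge. If they are inside an edge at time `t`,
      -- it is open; at a vertex the turn prescribes the edge below, which is unique.
      obtain ⟨w, hw1, hw2⟩ : ∃ w : S.Well,
          (∀ᶠ s in 𝓝[>] t, y (projIcc 0 T hT.le s) ∈ w.edge) ∧
            ∀ᶠ s in 𝓝[>] t, z (projIcc 0 T hT.le s) ∈ w.edge := by
        rcases proj_mem_edge_or_eq_vertex (S := S) (terminal turn w₀) (inv_pos.2 hpos) with hE | ⟨k, hk⟩
        · refine ⟨S.wellAt (terminal turn w₀) (slowness c (terminal turn w₀) v₀⁻¹ t)⁻¹, ?_, ?_⟩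
          · exact ((y.continuous.comp continuous_projIcc).continuousAt.eventually
              ((isOpen_edge _).mem_nhds (by
                rw [← hzt, ← htA'] at hE; exact hE))).filter_mono nhdsWithin_le_nhds
          · exact ((z.continuous.comp continuous_projIcc).continuousAt.eventually
              ((isOpen_edge _).mem_nhds (by
                rw [← hzt] at hE; exact hE))).filter_mono nhdsWithin_le_nhds
        · rw [← hzt] at hk
          have hk' := htA'.trans hk
          rw [projIcc_of_mem hT.le htI] at hk hk'
          obtain ⟨w, hw, hev⟩ := h.branch k ⟨t, htI⟩ ht.2 hk'
          obtain ⟨w', hw', hev'⟩ := h'.branch k ⟨t, htI⟩ ht.2 hk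
          rw [hw'.eq_well hw] at hev'
          exact ⟨w, hev, hev'⟩
      obtain ⟨t₁, ht₁, hsub⟩ := mem_nhdsGT_iff_exists_Ioc_subset.1 (hw1.and hw2)
      have ht₁' : t < t₁ := ht₁
      refine ⟨min t₁ (min b T), ?_, lt_min ht₁' (lt_min hb ht.2),
        (min_le_right _ _).trans (min_le_left _ _)⟩
      set s := min t₁ (min b T) with hs
      have hts : t < s := lt_min ht₁' (lt_min hb ht.2)
      have hs1 : s ≤ t₁ := min_le_left _ _
      have hsT : s ≤ T := (min_le_right _ _).trans (min_le_right _ _)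
      have hep : 0 < S.energy (z (projIcc 0 T hT.le t)) := by
        rw [hzt, energy_proj]
        have := inv_pos.2 hpos
        positivity
      have e1 := h.slowness_eq hc ht.1 hts hsT (by rw [htA']; exact hep)
        (fun r hr => (hsub ⟨hr.1, hr.2.trans hs1⟩).1)
      have e2 := h'.slowness_eq hc ht.1 hts hsT hep
        (fun r hr => (hsub ⟨hr.1, hr.2.trans hs1⟩).2)
      have m1 := (hsub ⟨hts, hs1⟩).1
      have m2 := (hsub ⟨hts, hs1⟩).2
      refine eq_of_mem_edge m1 m2 ?_
      -- Both slownesses started from the same value and grew at the same rate, so the energies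
      -- agree, and the energy is a coordinate on an edge.
      rw [htA', ← e2, inv_inj] at e1
      have p1 := energy_pos_of_mem_edge m1
      have p2 := energy_pos_of_mem_edge m2
      have := (Real.sqrt_inj (by linarith) (by linarith)).1 e1
      linarith
  ext t
  have := hsub t.2
  simpa [hA, projIcc_val] using this

/-! ### The limiting law -/

/-- The expectation of `φ` at the cell in which the limiting process started in the well `w`
ends. -/
noncomputable def value (c : S.Well → Side → ℝ) (φ : Fin (n + 1) → ℝ) (w : S.Well) : ℝ :=
  open Classical in
  if h : ∃ k, w.IsAbove k then
    (c w .left * value c φ (Well.child h.choose_spec .left) +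
      c w .right * value c φ (Well.child h.choose_spec .right)) / (c w .left + c w .right)
  else φ (w.cellAt .left)
termination_by (w.right : ℕ) - w.left
decreasing_by all_goals exact Well.child_size_lt _ _

theorem value_of_isAbove (c : S.Well → Side → ℝ) (φ : Fin (n + 1) → ℝ) {w : S.Well} {k : Fin n}
    (h : w.IsAbove k) : value c φ w = (c w .left * value c φ (Well.child h .left) +
      c w .right * value c φ (Well.child h .right)) / (c w .left + c w .right) := by
  have hex : ∃ k, w.IsAbove k := ⟨k, h⟩
  rw [value, dif_pos hex]
  obtain rfl : hex.choose = k := hex.choose_spec.eq_wall h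
  rfl

theorem value_of_forall_not (c : S.Well → Side → ℝ) (φ : Fin (n + 1) → ℝ) {w : S.Well}
    (h : ∀ i, ¬ w.HasWall i) : value c φ w = φ (w.cellAt .left) := by
  rw [value, dif_neg]
  rintro ⟨k, hk⟩
  exact h k hk.hasWall

/-- The value depends continuously on the coefficients and on the function. -/
theorem tendsto_value {ι : Type*} {l : Filter ι} {c : S.Well → Side → ℝ} (hc : ∀ w s, 0 < c w s)
    {C : ι → S.Well → Side → ℝ} (hC : ∀ w s, Tendsto (fun i => C i w s) l (𝓝 (c w s)))
    {φ : Fin (n + 1) → ℝ} {Φ : ι → Fin (n + 1) → ℝ}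
    (hΦ : ∀ j, Tendsto (fun i => Φ i j) l (𝓝 (φ j))) (w : S.Well) :
    Tendsto (fun i => value (C i) (Φ i) w) l (𝓝 (value c φ w)) := by
  induction w using Well.induction_on with
  | leaf w h =>
    simp only [value_of_forall_not _ _ h]
    exact hΦ _
  | node w k h ih =>
    simp only [value_of_isAbove _ _ h]
    exact (((hC w .left).mul (ih .left)).add ((hC w .right).mul (ih .right))).div
      ((hC w .left).add (hC w .right)) (add_pos (hc w .left) (hc w .right)).ne'

/-- This makes the final cell below a part of a well a function of the turns at the walls inside
that part, hence independent of the turn at the highest wall. -/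
theorem terminal_congr {turn turn' : Fin n → Side} (w : S.Well)
    (h : ∀ i, w.HasWall i → turn i = turn' i) : terminal turn w = terminal turn' w := by
  induction w using Well.induction_on with
  | leaf w hw => rw [terminal_of_forall_not _ hw, terminal_of_forall_not _ hw]
  | node w k hk ih =>
    rw [terminal_of_isAbove _ hk, terminal_of_isAbove _ hk, ← h k hk.hasWall]
    exact ih _ fun i hi => h i (Well.hasWall_of_child hk hi).1

end WallSystem

namespace WallSystem

variable {n : ℕ} {S : WallSystem n}

/-- The expectation at the final cell, when the turns are independent with the right
probabilities. -/
theorem integral_terminal {c : S.Well → Side → ℝ} (hc : ∀ w s, 0 < c w s) {Ω : Type*}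
    [MeasurableSpace Ω] {P : Measure Ω} [IsProbabilityMeasure P] {turn : Fin n → Ω → Side}
    (hm : ∀ k, Measurable (turn k)) (hi : iIndepFun turn P)
    (hp : ∀ (k : Fin n) (w : S.Well), w.IsAbove k → ∀ s : Side,
      P {ω | turn k ω = s} = ENNReal.ofReal (c w s / (c w .left + c w .right)))
    (φ : Fin (n + 1) → ℝ) (w : S.Well) :
    ∫ ω, φ (terminal (fun k => turn k ω) w) ∂P = value c φ w := by
  classical
  have hmeas : Measurable fun ω => fun k => turn k ω := measurable_pi_iff.2 hm
  have hmt : ∀ w : S.Well, Measurable fun ω => φ (terminal (fun k => turn k ω) w) := fun w =>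
    (measurable_of_finite (fun t : Fin n → Side => φ (terminal t w))).comp hmeas
  have hint : ∀ w : S.Well, Integrable (fun ω => φ (terminal (fun k => turn k ω) w)) P :=
    fun w => by
      obtain ⟨C, hC⟩ := (Set.finite_range fun j => ‖φ j‖).bddAbove
      exact Integrable.of_bound (hmt w).aestronglyMeasurable C
        (Eventually.of_forall fun ω => hC ⟨_, rfl⟩)
  induction w using Well.induction_on with
  | leaf w h =>
    simp only [terminal_of_forall_not _ h, value_of_forall_not _ _ h, integral_const,
      probReal_univ, smul_eq_mul, one_mul]
  | node w k h ih =>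
    have hsum : 0 < c w .left + c w .right := add_pos (hc w .left) (hc w .right)
    have hset : ∀ s, MeasurableSet {ω | turn k ω = s} := fun s => hm k (measurableSet_singleton s)
    -- the two parts
    have key : ∀ s, ∫ ω, {ω | turn k ω = s}.indicator (fun _ => (1 : ℝ)) ω *
        φ (terminal (fun k => turn k ω) (Well.child h s)) ∂P =
        c w s / (c w .left + c w .right) * value c φ (Well.child h s) := by
      intro s
      set V : Finset (Fin n) := Finset.univ.filter fun i => (Well.child h s).HasWall i with hV
      have hdisj : Disjoint {k} V := by
        rw [Finset.disjoint_singleton_left, hV, Finset.mem_filter]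
        exact fun hk => (Well.hasWall_of_child h hk.2).2 rfl
      have hind := hi.indepFun_finset {k} V hdisj hm
      let f : ((i : ({k} : Finset (Fin n))) → Side) → ℝ := fun t =>
        if t ⟨k, Finset.mem_singleton_self k⟩ = s then 1 else 0
      -- The turns outside `V` get an arbitrary value, which by `terminal_congr` does not matter.
      let g : ((i : V) → Side) → ℝ := fun t =>
        φ (terminal (fun i => if hi : i ∈ V then t ⟨i, hi⟩ else .left) (Well.child h s))
      have hfg := hind.comp (measurable_of_finite f) (measurable_of_finite g)
      have e1 : (f ∘ fun ω (i : ({k} : Finset (Fin n))) => turn i ω) =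
          {ω | turn k ω = s}.indicator fun _ => (1 : ℝ) := by
        ext ω
        simp [f, Set.indicator_apply]
      have e2 : (g ∘ fun ω (i : V) => turn i ω) =
          fun ω => φ (terminal (fun k => turn k ω) (Well.child h s)) := by
        ext ω
        simp only [g, Function.comp_apply]
        congr 1
        refine terminal_congr _ fun i hi => ?_
        rw [dif_pos (by rw [hV]; simpa using hi)]
      rw [e1, e2] at hfg
      have hmul := hfg.integral_fun_mul_eq_mul_integral
        ((measurable_const.indicator (hset s)).aestronglyMeasurable)
        (hmt _).aestronglyMeasurable
      rw [hmul, ih s, integral_indicator_const _ (hset s), smul_eq_mul, mul_one, Measure.real,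
        hp k w h s, ENNReal.toReal_ofReal (div_nonneg (hc w s).le hsum.le)]
    have hsplit : ∀ ω, φ (terminal (fun k => turn k ω) w) =
        {ω | turn k ω = .left}.indicator (fun _ => (1 : ℝ)) ω *
          φ (terminal (fun k => turn k ω) (Well.child h .left)) +
        {ω | turn k ω = .right}.indicator (fun _ => (1 : ℝ)) ω *
          φ (terminal (fun k => turn k ω) (Well.child h .right)) := by
      intro ω
      rw [terminal_of_isAbove _ h]
      cases hs : turn k ω <;> simp [hs]
    have hintm : ∀ s, Integrable (fun ω => {ω | turn k ω = s}.indicator (fun _ => (1 : ℝ)) ω *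
        φ (terminal (fun k => turn k ω) (Well.child h s))) P := by
      intro s
      have : (fun ω => {ω | turn k ω = s}.indicator (fun _ => (1 : ℝ)) ω *
          φ (terminal (fun k => turn k ω) (Well.child h s))) = {ω | turn k ω = s}.indicator
            fun ω => φ (terminal (fun k => turn k ω) (Well.child h s)) := by
        ext ω
        by_cases hω : turn k ω = s <;> simp [hω]
      rw [this]
      exact (hint _).indicator (hset s)
    rw [integral_congr_ae (Eventually.of_forall hsplit), integral_add (hintm _) (hintm _),
      key, key, value_of_isAbove _ _ h]
    ring

/-- The path is almost surely a function of finitely many turns, so the integral is a finite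
computation in the tree. This yields uniqueness of the law and a concrete target for weak
convergence. -/
theorem IsLimitLaw.integral_eq {c : S.Well → Side → ℝ} (hc : ∀ w s, 0 < c w s) {T : ℝ}
    {hT : 0 < T} {j₀ : Fin (n + 1)} {v₀ : ℝ} (hv₀ : 0 < v₀) {w₀ : S.Well}
    (h₀ : S.proj j₀ v₀ ∈ w₀.edge) {μ : ProbabilityMeasure C(Icc (0 : ℝ) T, S.Graph)}
    (h : IsLimitLaw hT c (S.proj j₀ v₀) μ)
    (F : BoundedContinuousFunction C(Icc (0 : ℝ) T, S.Graph) ℝ) :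
    ∫ y, F y ∂(μ : Measure C(Icc (0 : ℝ) T, S.Graph)) =
      value c (fun j => F (limitPath hc j hv₀ T)) w₀ := by
  obtain ⟨Ω, _, P, _, Y, turn, hY, hm, hi, hp, hae, hμ⟩ := h
  rw [← hμ, integral_map hY.aemeasurable F.continuous.measurable.aestronglyMeasurable,
    ← integral_terminal hc hm hi hp]
  refine integral_congr_ae ?_
  filter_upwards [hae] with ω hω
  rw [hω.eq_limitPath hc hv₀ h₀]

open Classical in
/-- The law of the turn at the vertex of the wall `k`. -/
noncomputable def turnLaw (c : S.Well → Side → ℝ) (k : Fin n) : Measure Side :=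
  if h : ∃ w : S.Well, w.IsAbove k then
    ENNReal.ofReal (c h.choose .left / (c h.choose .left + c h.choose .right)) •
        Measure.dirac .left +
      ENNReal.ofReal (c h.choose .right / (c h.choose .left + c h.choose .right)) •
        Measure.dirac .right
  else Measure.dirac .left

theorem isProbabilityMeasure_turnLaw {c : S.Well → Side → ℝ} (hc : ∀ w s, 0 < c w s)
    (k : Fin n) : IsProbabilityMeasure (turnLaw c k) := by
  rw [turnLaw]
  split_ifs with h
  · have h1 := hc h.choose .left
    have h2 := hc h.choose .right
    constructor
    simp only [Measure.add_apply, Measure.smul_apply, measure_univ, smul_eq_mul, mul_one]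
    rw [← ENNReal.ofReal_add (by positivity) (by positivity), ← add_div, div_self (by positivity),
      ENNReal.ofReal_one]
  · infer_instance

theorem turnLaw_singleton (c : S.Well → Side → ℝ) {k : Fin n} {w : S.Well} (h : w.IsAbove k)
    (s : Side) :
    turnLaw c k {s} = ENNReal.ofReal (c w s / (c w .left + c w .right)) := by
  have hex : ∃ w : S.Well, w.IsAbove k := ⟨w, h⟩
  rw [turnLaw, dif_pos hex, hex.choose_spec.eq_well h]
  cases s <;> simp

/-- The limiting law exists. -/
theorem exists_isLimitLaw {c : S.Well → Side → ℝ} (hc : ∀ w s, 0 < c w s) {T : ℝ}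
    (hT : 0 < T) {j₀ : Fin (n + 1)} {v₀ : ℝ} (hv₀ : 0 < v₀) {w₀ : S.Well}
    (h₀ : S.proj j₀ v₀ ∈ w₀.edge) :
    ∃ μ : ProbabilityMeasure C(Icc (0 : ℝ) T, S.Graph), IsLimitLaw hT c (S.proj j₀ v₀) μ := by
  have := isProbabilityMeasure_turnLaw hc
  have hY : Measurable fun t : Fin n → Side => limitPath hc (terminal t w₀) hv₀ T :=
    measurable_of_finite _
  refine ⟨⟨(Measure.pi (turnLaw c)).map fun t => limitPath hc (terminal t w₀) hv₀ T,
    Measure.isProbabilityMeasure_map hY.aemeasurable⟩, Fin n → Side, inferInstance,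
    Measure.pi (turnLaw c), inferInstance, _, fun k t => t k, hY, measurable_pi_apply,
    iIndepFun_pi (X := fun _ s => s) fun _ => aemeasurable_id, ?_, ?_, rfl⟩
  · intro k w hw s
    rw [← turnLaw_singleton c hw s]
    exact (measurePreserving_eval (turnLaw c) k).measure_preimage
      (measurableSet_singleton s).nullMeasurableSet
  · exact Eventually.of_forall fun t => isLimitPath_limitPath hc hT hv₀ h₀ t

theorem existsUnique_isLimitLaw {c : S.Well → Side → ℝ} (hc : ∀ w s, 0 < c w s) {T : ℝ}
    (hT : 0 < T) {j₀ : Fin (n + 1)} {v₀ : ℝ} (hv₀ : 0 < v₀) {w₀ : S.Well}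
    (h₀ : S.proj j₀ v₀ ∈ w₀.edge) :
    ∃! μ : ProbabilityMeasure C(Icc (0 : ℝ) T, S.Graph), IsLimitLaw hT c (S.proj j₀ v₀) μ := by
  obtain ⟨μ, hμ⟩ := exists_isLimitLaw hc hT hv₀ h₀
  refine ⟨μ, hμ, fun μ' hμ' => ?_⟩
  have := μ.2
  have := μ'.2
  refine Subtype.ext (ext_of_forall_integral_eq_of_IsFiniteMeasure fun F => ?_)
  exact (IsLimitLaw.integral_eq hc hv₀ h₀ hμ' F).trans (hμ.integral_eq hc hv₀ h₀ F).symm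

theorem abs_sq_inv_sub_le {m a b : ℝ} (hm : 0 < m) (ha : m ≤ a) (hb : m ≤ b) :
    |a⁻¹ ^ 2 / 2 - b⁻¹ ^ 2 / 2| ≤ |a - b| / m ^ 3 := by
  have ha0 : 0 < a := hm.trans_le ha
  have hb0 : 0 < b := hm.trans_le hb
  have e : a⁻¹ ^ 2 / 2 - b⁻¹ ^ 2 / 2 =
      (b - a) * ((a⁻¹ * b⁻¹ * b⁻¹ + a⁻¹ * a⁻¹ * b⁻¹) / 2) := by
    field_simp
    ring
  have h1 : a⁻¹ ≤ m⁻¹ := inv_anti₀ hm ha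
  have h2 : b⁻¹ ≤ m⁻¹ := inv_anti₀ hm hb
  have p1 : 0 < a⁻¹ := inv_pos.2 ha0
  have p2 : 0 < b⁻¹ := inv_pos.2 hb0
  have h3 : a⁻¹ * b⁻¹ * b⁻¹ ≤ m⁻¹ * m⁻¹ * m⁻¹ := by gcongr
  have h4 : a⁻¹ * a⁻¹ * b⁻¹ ≤ m⁻¹ * m⁻¹ * m⁻¹ := by gcongr
  rw [e, abs_mul, abs_sub_comm, div_eq_mul_inv]
  refine mul_le_mul_of_nonneg_left ?_ (abs_nonneg _)
  rw [abs_of_nonneg (by positivity), ← inv_pow]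
  calc _ ≤ (m⁻¹ * m⁻¹ * m⁻¹ + m⁻¹ * m⁻¹ * m⁻¹) / 2 := by linarith
    _ = m⁻¹ ^ 3 := by ring

/-- If the clock nearly shows `t` at the slowness `u`, then the energies are close. -/
theorem abs_sq_inv_slowness_sub_le {c : S.Well → Side → ℝ} (hc : ∀ w s, 0 < c w s)
    (j : Fin (n + 1)) {u₀ A : ℝ} (hu₀ : 0 < u₀) (hA0 : 0 < A) (hA : ∀ w, A ≤ pace c w) {t u : ℝ}
    (ht : 0 ≤ t) (hu : u₀ ≤ u) :
    |(slowness c j u₀ t)⁻¹ ^ 2 / 2 - u⁻¹ ^ 2 / 2| ≤ |t - clock c j u₀ u| / A / u₀ ^ 3 :=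
  (abs_sq_inv_sub_le hu₀ (le_slowness hc j u₀ ht) hu).trans
    (div_le_div_of_nonneg_right (abs_slowness_sub_le hc j u₀ hA0 hA t u) (by positivity))

theorem abs_clock_sub_clock_le {c c' : S.Well → Side → ℝ} (hc : ∀ w s, 0 < c w s)
    (hc' : ∀ w s, 0 < c' w s) (j : Fin (n + 1)) {u₀ u η : ℝ}
    (h : ∀ w, |pace c w - pace c' w| ≤ η) :
    |clock c j u₀ u - clock c' j u₀ u| ≤ η * |u - u₀| := by
  rw [clock, clock, ← intervalIntegral.integral_sub (intervalIntegrable_pace hc j _ _)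
    (intervalIntegrable_pace hc' j _ _)]
  exact intervalIntegral.norm_integral_le_of_norm_le_const
    (f := fun s => pace c (S.wellAt j s⁻¹) - pace c' (S.wellAt j s⁻¹)) fun s _ => h _

/-- Paths with nearby coefficients that descend to the same cell are close. -/
theorem tendsto_limitPath {ι : Type*} {l : Filter ι} {c : S.Well → Side → ℝ}
    (hc : ∀ w s, 0 < c w s) {C : ι → S.Well → Side → ℝ} (hC0 : ∀ i w s, 0 < C i w s)
    (hC : ∀ w s, Tendsto (fun i => C i w s) l (𝓝 (c w s))) (j : Fin (n + 1)) {v₀ : ℝ}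
    (hv₀ : 0 < v₀) (T : ℝ) :
    Tendsto (fun i => limitPath (hC0 i) j hv₀ T) l (𝓝 (limitPath hc j hv₀ T)) := by
  rw [Metric.tendsto_nhds]
  intro ε hε
  obtain ⟨A, _, hA0, _, hA⟩ := exists_pace_bounds hc
  have hu₀ : 0 < v₀⁻¹ := inv_pos.2 hv₀
  have hpace : ∀ w, Tendsto (fun i => pace (C i) w) l (𝓝 (pace c w)) := fun w =>
    tendsto_const_nhds.div ((hC w .left).add (hC w .right))
      (add_pos (hc w .left) (hc w .right)).ne'
  -- If the paces differ by at most `η ≤ A / 2`, those of `C i` are at least `A / 2`, so up to time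
  -- `T` the slowness grows by at most `T / (A / 2)`. On that range the clocks differ by at most `η
  -- * (T / (A / 2))`; dividing by `A` bounds the difference of slownesses, and by `v₀⁻¹ ^ 3` that
  -- of energies.
  obtain ⟨η, hη0, hηA, hη⟩ : ∃ η > 0, η ≤ A / 2 ∧
      η * (T / (A / 2)) / A / v₀⁻¹ ^ 3 < ε := by
    have hcont : Tendsto (fun η : ℝ => η * (T / (A / 2)) / A / v₀⁻¹ ^ 3) (𝓝[>] 0) (𝓝 0) := by
      have : Continuous fun η : ℝ => η * (T / (A / 2)) / A / v₀⁻¹ ^ 3 := by fun_prop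
      have := this.tendsto 0
      simp only [zero_mul, zero_div] at this
      exact this.mono_left nhdsWithin_le_nhds
    obtain ⟨η, h1, h2, h3⟩ := ((hcont.eventually (eventually_lt_nhds hε)).and
      (Ioo_mem_nhdsGT (half_pos hA0))).exists
    exact ⟨η, h2, h3.le, h1⟩
  have hev : ∀ᶠ i in l, ∀ w, |pace (C i) w - pace c w| ≤ η := by
    refine eventually_all.2 fun w => ?_
    filter_upwards [(Metric.tendsto_nhds.1 (hpace w)) η hη0] with i hi
    exact hi.le
  filter_upwards [hev] with i hi
  rw [ContinuousMap.dist_lt_iff hε]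
  intro t
  rw [limitPath_apply, limitPath_apply, dist_proj_same, abs_sub_comm]
  have hlow : ∀ w, A / 2 ≤ pace (C i) w := fun w => by
    have := abs_le.1 (hi w)
    linarith [(hA w).1]
  set u := slowness (C i) j v₀⁻¹ t with hu
  have hu0 : v₀⁻¹ ≤ u := le_slowness (hC0 i) j _ t.2.1
  have h1 : |u - v₀⁻¹| ≤ T / (A / 2) := by
    refine (abs_slowness_sub_le (hC0 i) j v₀⁻¹ (half_pos hA0) hlow t v₀⁻¹).trans ?_
    rw [clock_self, sub_zero, abs_of_nonneg t.2.1]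
    exact div_le_div_of_nonneg_right t.2.2 (half_pos hA0).le
  have h2 : |(t : ℝ) - clock c j v₀⁻¹ u| ≤ η * (T / (A / 2)) := by
    have := abs_clock_sub_clock_le (hC0 i) hc j (u₀ := v₀⁻¹) (u := u) hi
    rw [hu, clock_slowness (hC0 i), ← hu] at this
    exact this.trans (mul_le_mul_of_nonneg_left h1 hη0.le)
  refine lt_of_le_of_lt ((abs_sq_inv_slowness_sub_le hc j hu₀ hA0 (fun w => (hA w).1) t.2.1
    hu0).trans ?_) hη
  gcongr

end WallSystem

/-! ### Piecewise linear interpolation -/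

/-- The piecewise linear function through the points `(τ m, e m)`. -/
noncomputable def linearInterpolation (τ e : ℕ → ℝ) (t : ℝ) : ℝ :=
  e (sInf {m | t < τ (m + 1)}) + (t - τ (sInf {m | t < τ (m + 1)})) /
    (τ (sInf {m | t < τ (m + 1)} + 1) - τ (sInf {m | t < τ (m + 1)})) *
      (e (sInf {m | t < τ (m + 1)} + 1) - e (sInf {m | t < τ (m + 1)}))

section Interpolation

variable {τ e : ℕ → ℝ} (hτ : StrictMono τ)

include hτ

theorem sInf_eq_of_mem_Ico {m : ℕ} {t : ℝ} (ht : t ∈ Ico (τ m) (τ (m + 1))) :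
    sInf {m | t < τ (m + 1)} = m := by
  refine le_antisymm (Nat.sInf_le ht.2) ?_
  refine le_csInf ⟨m, ht.2⟩ fun k hk => ?_
  have := hτ.lt_iff_lt.1 (ht.1.trans_lt hk)
  omega

omit hτ in
theorem exists_mem_Ico {t T : ℝ} (ht : t ∈ Icc (τ 0) T) (hT : ∃ m, T < τ m) :
    ∃ m, t ∈ Ico (τ m) (τ (m + 1)) := by
  obtain ⟨M, hM⟩ := hT
  have hex : ∃ m, t < τ m := ⟨M, ht.2.trans_lt hM⟩
  classical
  have h1 := Nat.find_spec hex
  have h2 : Nat.find hex ≠ 0 := fun h => by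
    rw [h] at h1
    exact absurd ht.1 (not_le.2 h1)
  obtain ⟨m, hm⟩ := Nat.exists_eq_succ_of_ne_zero h2
  refine ⟨m, not_lt.1 (Nat.find_min hex (m := m) (by omega)), ?_⟩
  rw [hm] at h1
  exact h1

theorem linearInterpolation_of_mem_Icc {m : ℕ} {t : ℝ} (ht : t ∈ Icc (τ m) (τ (m + 1))) :
    linearInterpolation τ e t =
      e m + (t - τ m) / (τ (m + 1) - τ m) * (e (m + 1) - e m) := by
  have hne : τ (m + 1) - τ m ≠ 0 := (sub_pos.2 (hτ m.lt_succ_self)).ne'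
  -- At the right endpoint the infimum already selects the next interval; both formulas give `e (m +
  -- 1)`.
  rcases ht.2.eq_or_lt with rfl | h
  · rw [linearInterpolation, sInf_eq_of_mem_Ico hτ (m := m + 1) ⟨le_rfl, hτ (Nat.lt_succ_self _)⟩,
      sub_self, zero_div, zero_mul, add_zero, div_self hne]
    ring
  · rw [linearInterpolation, sInf_eq_of_mem_Ico hτ ⟨ht.1, h⟩]

theorem continuousOn_linearInterpolation (m : ℕ) :
    ContinuousOn (linearInterpolation τ e) (Icc (τ 0) (τ m)) := by
  induction m with
  | zero => simp [Icc_self, continuousOn_singleton]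
  | succ m ih =>
    rw [← Icc_union_Icc_eq_Icc (hτ.monotone m.zero_le) (hτ.monotone m.le_succ)]
    refine ih.union_of_isClosed ?_ isClosed_Icc isClosed_Icc
    refine ContinuousOn.congr ?_ fun t ht => linearInterpolation_of_mem_Icc hτ ht
    fun_prop

theorem linearInterpolation_mem_Icc (he : Antitone e) {m : ℕ} {t : ℝ}
    (ht : t ∈ Icc (τ m) (τ (m + 1))) :
    linearInterpolation τ e t ∈ Icc (e (m + 1)) (e m) := by
  have hpos : 0 < τ (m + 1) - τ m := sub_pos.2 (hτ m.lt_succ_self)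
  rw [linearInterpolation_of_mem_Icc hτ ht]
  have h0 : 0 ≤ (t - τ m) / (τ (m + 1) - τ m) := div_nonneg (sub_nonneg.2 ht.1) hpos.le
  have h1 : (t - τ m) / (τ (m + 1) - τ m) ≤ 1 := by
    rw [div_le_one hpos]; linarith [ht.2]
  have h2 : e (m + 1) ≤ e m := he m.le_succ
  constructor <;> nlinarith

end Interpolation

namespace WallSystem

variable {n : ℕ} {S : WallSystem n}

/-! ### The nearly-elastic motion -/

/-- The well in which the particle moves. -/
noncomputable def State.well (x : S.State) : S.Well := S.wellAt x.cell x.speed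

theorem orbit_zero (r : S.Well → Side → ℕ → ℝ) (x : S.State) : orbit r x 0 = x := rfl

theorem orbit_succ (r : S.Well → Side → ℕ → ℝ) (x : S.State) (m : ℕ) :
    orbit r x (m + 1) = (orbit r x m).next r := Function.iterate_succ_apply' _ _ _

section Next

variable (r : S.Well → Side → ℕ → ℝ) (x : S.State)

theorem State.next_cell : (x.next r).cell = x.well.cellAt x.heading := rfl

theorem State.next_pos : (x.next r).pos = S.pos (x.well.wall x.heading) := rfl

theorem State.next_speed : (x.next r).speed =
    x.speed * r x.well x.heading (x.hits (x.well, x.heading)) := rfl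

theorem State.next_heading : (x.next r).heading = x.heading.flip := rfl

theorem State.next_time : (x.next r).time =
    x.time + |S.pos (x.well.wall x.heading) - x.pos| / x.speed := rfl

theorem State.next_hits : (x.next r).hits = Function.update x.hits (x.well, x.heading)
    (x.hits (x.well, x.heading) + 1) := rfl

theorem State.hasCell_well : x.well.HasCell x.cell := S.hasCell_wellAt _ _

end Next

theorem State.next_well_wall {x : S.State} {r : S.Well → Side → ℕ → ℝ}
    (h : (x.next r).speed ≤ x.speed) :
    (x.next r).well.wall x.heading = x.well.wall x.heading :=
  wall_wellAt_cellAt x.cell h x.heading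

/-- The reflected particle is in a cell of the old well, so at the old speed its well would be
unchanged; lowering the speed can only shrink it. -/
theorem State.next_well_le {x : S.State} {r : S.Well → Side → ℕ → ℝ}
    (h : (x.next r).speed ≤ x.speed) :
    x.well.left ≤ (x.next r).well.left ∧ (x.next r).well.right ≤ x.well.right := by
  have h1 := S.wellAt_mono (x.next r).cell h
  have h2 : S.wellAt (x.next r).cell x.speed = x.well :=
    wellAt_eq_of_hasCell (x.well.hasCell_cellAt x.heading)
  rwa [h2] at h1

theorem Side.flip_flip (s : Side) : s.flip.flip = s := by cases s <;> rfl

theorem Well.abs_pos_sub (w : S.Well) (s : Side) :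
    |S.pos (w.wall s.flip) - S.pos (w.wall s)| = w.width := by
  have h := w.width_pos
  rw [Well.width] at *
  cases s
  · exact abs_of_pos h
  · rw [abs_sub_comm]; exact abs_of_pos h

/-- A state in which the motion can start. -/
structure State.IsStart (x : S.State) : Prop where
  speed_pos : 0 < x.speed
  pos_ne : S.pos (x.well.wall x.heading) ≠ x.pos
  time_eq : x.time = 0
  hits_eq : ∀ p, x.hits p = 0

/-- The cell belongs to all wells through which the particle moves. -/
def IsFinalCell (r : S.Well → Side → ℕ → ℝ) (x : S.State) (J : Fin (n + 1)) : Prop :=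
  ∀ m, (orbit r x m).well.HasCell J

section Orbit

variable {r : S.Well → Side → ℕ → ℝ} (hr0 : ∀ w s k, 0 < r w s k) (hr1 : ∀ w s k, r w s k < 1)
  {x : S.State} (hx : x.IsStart)

include hr0 hx

theorem orbit_speed_pos (m : ℕ) : 0 < (orbit r x m).speed := by
  induction m with
  | zero => exact hx.speed_pos
  | succ m ih =>
    rw [orbit_succ, State.next_speed]
    exact mul_pos ih (hr0 _ _ _)

include hr1

theorem orbit_speed_strictAnti : StrictAnti fun m => (orbit r x m).speed := by
  refine strictAnti_nat_of_succ_lt fun m => ?_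
  rw [orbit_succ, State.next_speed]
  exact mul_lt_of_lt_one_right (orbit_speed_pos hr0 hx m) (hr1 _ _ _)

theorem next_speed_le (m : ℕ) : ((orbit r x m).next r).speed ≤ (orbit r x m).speed := by
  rw [← orbit_succ]
  exact (orbit_speed_strictAnti hr0 hr1 hx).antitone m.le_succ

theorem hasCell_of_hasCell_succ {m : ℕ} {j : Fin (n + 1)}
    (h : (orbit r x (m + 1)).well.HasCell j) : (orbit r x m).well.HasCell j := by
  rw [orbit_succ] at h
  have h1 := State.next_well_le (next_speed_le hr0 hr1 hx m)
  exact ⟨h1.1.trans h.1, h.2.trans h1.2⟩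

theorem hasCell_of_hasCell_le {m m' : ℕ} (hm : m ≤ m') {j : Fin (n + 1)}
    (h : (orbit r x m').well.HasCell j) : (orbit r x m).well.HasCell j := by
  induction m', hm using Nat.le_induction with
  | base => exact h
  | succ k _ ih => exact ih (hasCell_of_hasCell_succ hr0 hr1 hx h)

/-- The cell of a particle that does not pass any wall is its final cell. -/
theorem isFinalCell_of_speed_le {M : ℕ} (hM : ∀ i, (orbit r x M).speed ≤ S.height i) :
    IsFinalCell r x (orbit r x M).cell := by
  intro m
  rcases le_total m M with h | h
  · exact hasCell_of_hasCell_le hr0 hr1 hx h (State.hasCell_well _)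
  -- From time `M` on, the well is a single cell and can shrink no further.
  · have hleaf : ∀ i, ¬ (orbit r x M).well.HasWall i := fun i hi =>
      absurd (lt_of_hasWall_wellAt hi) (not_lt.2 (hM i))
    have h1 := hasCell_of_hasCell_le hr0 hr1 hx h (State.hasCell_well (orbit r x m))
    have h2 := State.hasCell_well (orbit r x M)
    rw [← Well.cellAt_eq_of_forall_not_hasWall hleaf h2 .left,
      Well.cellAt_eq_of_forall_not_hasWall hleaf h1 .left]
    exact State.hasCell_well _

/-- The wall hit last is still a boundary of the present well, even if that well has just shrunk, so
every flight after the first crosses a whole well. The first flight is different, as the motion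
starts at an arbitrary position. -/
theorem orbit_time_succ_succ (m : ℕ) : (orbit r x (m + 2)).time = (orbit r x (m + 1)).time +
    (orbit r x (m + 1)).well.width / (orbit r x (m + 1)).speed := by
  rw [orbit_succ r x (m + 1), State.next_time]
  congr 2
  have h := State.next_well_wall (next_speed_le hr0 hr1 hx m)
  rw [orbit_succ r x m, State.next_pos, State.next_heading, ← h]
  exact Well.abs_pos_sub _ _

theorem orbit_time_strictMono : StrictMono fun m => (orbit r x m).time := by
  refine strictMono_nat_of_lt_succ fun m => ?_
  cases m with
  | zero =>
    rw [orbit_succ, State.next_time]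
    exact lt_add_of_pos_right _ (div_pos (abs_pos.2 (sub_ne_zero.2 hx.pos_ne)) hx.speed_pos)
  | succ m =>
    show _ < (orbit r x (m + 2)).time
    rw [orbit_time_succ_succ hr0 hr1 hx]
    exact lt_add_of_pos_right _ (div_pos (Well.width_pos _) (orbit_speed_pos hr0 hx _))

/-- The first flight may be arbitrarily short, hence the shift by one. Each later flight crosses at
least the width `ℓ` at no more than the initial speed, so collisions do not accumulate. -/
theorem le_orbit_time {ℓ : ℝ} (hℓ : ∀ w : S.Well, ℓ ≤ w.width) (m : ℕ) :
    m * (ℓ / x.speed) ≤ (orbit r x (m + 1)).time := by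
  induction m with
  | zero =>
    have := orbit_time_strictMono hr0 hr1 hx (Nat.zero_lt_one)
    simp only [orbit_zero, hx.time_eq] at this
    simpa using this.le
  | succ m ih =>
    rw [orbit_time_succ_succ hr0 hr1 hx]
    have h1 : ℓ / x.speed ≤ (orbit r x (m + 1)).well.width / (orbit r x (m + 1)).speed :=
      div_le_div₀ (Well.width_pos _).le (hℓ _) (orbit_speed_pos hr0 hx _)
        ((orbit_speed_strictAnti hr0 hr1 hx).antitone (Nat.zero_le _))
    push_cast
    linarith

end Orbit

theorem exists_width_bound (S : WallSystem n) : ∃ ℓ > 0, ∀ w : S.Well, ℓ ≤ w.width := by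
  have : Nonempty S.Well := ⟨S.wellAt 0 0⟩
  obtain ⟨w, hw⟩ := Finite.exists_min (fun w : S.Well => w.width)
  exact ⟨_, w.width_pos, hw⟩

section SlowPath

variable {r : S.Well → Side → ℕ → ℝ} (hr0 : ∀ w s k, 0 < r w s k) (hr1 : ∀ w s k, r w s k < 1)
  {x : S.State} (hx : x.IsStart) {ε : ℝ} (hε : 0 < ε)

include hr0 hr1 hx hε

theorem strictMono_mul_time : StrictMono fun m => ε * (orbit r x m).time :=
  (orbit_time_strictMono hr0 hr1 hx).const_mul hε

theorem exists_lt_mul_time (T : ℝ) : ∃ m, T < ε * (orbit r x m).time := by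
  obtain ⟨ℓ, hℓ0, hℓ⟩ := S.exists_width_bound
  have hp : 0 < ε * (ℓ / x.speed) := mul_pos hε (div_pos hℓ0 hx.speed_pos)
  obtain ⟨m, hm⟩ := exists_nat_gt (T / (ε * (ℓ / x.speed)))
  refine ⟨m + 1, ?_⟩
  rw [div_lt_iff₀ hp] at hm
  have := mul_le_mul_of_nonneg_left (le_orbit_time hr0 hr1 hx hℓ m) hε.le
  linarith [show (m : ℝ) * (ε * (ℓ / x.speed)) = ε * (m * (ℓ / x.speed)) by ring]

omit hε in
theorem antitone_energy : Antitone fun m => (orbit r x m).speed ^ 2 / 2 := fun m m' h => by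
  have h1 := (orbit_speed_strictAnti hr0 hr1 hx).antitone h
  exact (sq_half_le_iff (orbit_speed_pos hr0 hx _).le (orbit_speed_pos hr0 hx _).le).2 h1

/-- The slow motion is a path over the final cell. -/
theorem slowPath_eq {J : Fin (n + 1)} (hJ : IsFinalCell r x J) {t : ℝ} (ht : 0 ≤ t) :
    slowPath ε r x t = S.point J (linearInterpolation (fun m => ε * (orbit r x m).time)
      (fun m => (orbit r x m).speed ^ 2 / 2) t).toNNReal := by
  have hτ := strictMono_mul_time hr0 hr1 hx hε
  obtain ⟨m, hm⟩ := exists_mem_Ico (τ := fun m => ε * (orbit r x m).time) (t := t) (T := t)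
    ⟨by simpa [orbit_zero, hx.time_eq] using ht, le_rfl⟩ (exists_lt_mul_time hr0 hr1 hx hε t)
  have hs := sInf_eq_of_mem_Ico hτ hm
  have hE := linearInterpolation_mem_Icc hτ (antitone_energy hr0 hr1 hx) ⟨hm.1, hm.2.le⟩
  have hdef : slowPath ε r x t = S.point (orbit r x (m + 1)).cell
      (linearInterpolation (fun m => ε * (orbit r x m).time)
      (fun m => (orbit r x m).speed ^ 2 / 2) t).toNNReal := by
    simp only [slowPath, linearInterpolation, hs]
  rw [hdef, point_eq_point_iff]
  refine ⟨rfl, barrier_le_iff.2 fun i hi => ?_⟩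
  -- The cell used by `slowPath` and the final cell both lie in the well after collision `m + 1`.
  -- The walls between them are thus lower than the speed there, and the interpolated energy is at
  -- least the energy after that collision.
  have hw := (State.hasCell_well (orbit r x (m + 1))).hasWall_of_between (hJ (m + 1)) hi
  have hlt : S.height i < (orbit r x (m + 1)).speed := lt_of_hasWall_wellAt hw
  have h1 : S.height i ^ 2 / 2 ≤ (orbit r x (m + 1)).speed ^ 2 / 2 :=
    (sq_half_le_iff (S.height_pos i).le (orbit_speed_pos hr0 hx _).le).2 hlt.le
  exact (h1.trans hE.1).trans (Real.le_coe_toNNReal _)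

theorem continuous_linearInterpolation_energy (T : ℝ) :
    Continuous fun t : Icc (0 : ℝ) T => linearInterpolation (fun m => ε * (orbit r x m).time)
      (fun m => (orbit r x m).speed ^ 2 / 2) t := by
  have hτ := strictMono_mul_time hr0 hr1 hx hε
  obtain ⟨m, hm⟩ := exists_lt_mul_time hr0 hr1 hx hε T
  have h := continuousOn_linearInterpolation hτ (e := fun m => (orbit r x m).speed ^ 2 / 2) m
  refine continuousOn_iff_continuous_domRestrict.1 (h.mono ?_)
  simp only [orbit_zero, hx.time_eq, mul_zero]
  exact Icc_subset_Icc_right hm.le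

omit hr0 hr1 hx hε in
theorem continuous_point (j : Fin (n + 1)) : Continuous (S.point j) :=
  Isometry.continuous (Isometry.of_dist_eq fun h h' => by rw [dist_point_same]; rfl)

theorem continuous_slowPath {J : Fin (n + 1)} (hJ : IsFinalCell r x J) (T : ℝ) :
    Continuous fun t : Icc (0 : ℝ) T => slowPath ε r x t := by
  simp only [fun t : Icc (0 : ℝ) T => slowPath_eq hr0 hr1 hx hε hJ t.2.1]
  exact (continuous_point J).comp (continuous_real_toNNReal.comp
    (continuous_linearInterpolation_energy hr0 hr1 hx hε T))

end SlowPath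

/-! ### The numbers of collisions -/

/-- Bookkeeping for the numbers of collisions: the collisions with the two walls of a well
alternate, and the wells inside the present one have not been visited. -/
structure State.Balanced (x : S.State) : Prop where
  flip : ∀ w s, x.hits (w, s) ≤ x.hits (w, s.flip) + 1
  current : x.hits (x.well, x.heading) ≤ x.hits (x.well, x.heading.flip)
  inside : ∀ w : S.Well, x.well.left ≤ w.left → w.right ≤ x.well.right → w ≠ x.well →
    ∀ s, x.hits (w, s) = 0

theorem Side.flip_ne (s : Side) : s.flip ≠ s := by cases s <;> simp [Side.flip]

/-- Only the count of the wall hit increases. By `current` it was not ahead of the opposite one, so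
it gets ahead by at most one, and then the heading is reversed. If a smaller well is entered
instead, all counts there are still zero. -/
theorem State.Balanced.next {x : S.State} (h : x.Balanced) {r : S.Well → Side → ℕ → ℝ}
    (hle : (x.next r).speed ≤ x.speed) : (x.next r).Balanced := by
  have hin := State.next_well_le hle
  have hup : ∀ p, p ≠ (x.well, x.heading) → (x.next r).hits p = x.hits p := fun p hp => by
    rw [State.next_hits, Function.update_of_ne hp]
  have hat : (x.next r).hits (x.well, x.heading) = x.hits (x.well, x.heading) + 1 := by
    rw [State.next_hits, Function.update_self]
  have hfl : (x.next r).hits (x.well, x.heading.flip) = x.hits (x.well, x.heading.flip) :=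
    hup _ fun e => Side.flip_ne _ (congrArg Prod.snd e)
  have hcur := h.current
  have hcur' := h.flip x.well x.heading.flip
  rw [Side.flip_flip] at hcur'
  have two : ∀ s : Side, s = x.heading ∨ s = x.heading.flip := fun s => by
    cases s <;> cases x.heading <;> simp [Side.flip]
  refine ⟨fun w s => ?_, ?_, fun w hl hr hne s => ?_⟩
  · by_cases hw : w = x.well
    · subst hw
      rcases two s with rfl | rfl
      · rw [hat, hfl]; omega
      · rw [Side.flip_flip, hat, hfl]; omega
    · rw [hup _ fun e => hw (congrArg Prod.fst e), hup _ fun e => hw (congrArg Prod.fst e)]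
      exact h.flip w s
  · rw [State.next_heading, Side.flip_flip]
    by_cases hw : (x.next r).well = x.well
    · rw [hw, hat, hfl]; exact hcur'
    · rw [hup _ fun e => hw (congrArg Prod.fst e), hup _ fun e => hw (congrArg Prod.fst e),
        h.inside _ hin.1 hin.2 hw, h.inside _ hin.1 hin.2 hw]
  · have hne' : w ≠ x.well := by
      rintro rfl
      exact hne (Well.ext_walls (le_antisymm hin.1 hl) (le_antisymm hr hin.2))
    rw [hup _ fun e => hne' (congrArg Prod.fst e)]
    exact h.inside w (hin.1.trans hl) (hr.trans hin.2) hne' s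

theorem orbit_balanced {r : S.Well → Side → ℕ → ℝ} (hr0 : ∀ w s k, 0 < r w s k)
    (hr1 : ∀ w s k, r w s k < 1) {x : S.State} (hx : x.IsStart) (m : ℕ) :
    (orbit r x m).Balanced := by
  induction m with
  | zero => constructor <;> simp [orbit_zero, hx.hits_eq]
  | succ m ih =>
    rw [orbit_succ]
    exact ih.next (next_speed_le hr0 hr1 hx m)

theorem orbit_hits_le (r : S.Well → Side → ℕ → ℝ) {x : S.State} (hx : x.IsStart) (m : ℕ)
    (p : S.Well × Side) : (orbit r x m).hits p ≤ m := by
  induction m with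
  | zero => simp [orbit_zero, hx.hits_eq]
  | succ m ih =>
    rw [orbit_succ, State.next_hits, Function.update_apply]
    split_ifs with h
    · rw [← h]; omega
    · omega

/-- A sum along the orbit, of terms that depend on the wall and on the number of the collision,
sorted by the walls. -/
theorem sum_orbit_eq (r : S.Well → Side → ℕ → ℝ) {x : S.State} (hx : x.IsStart)
    (f : S.Well → Side → ℕ → ℝ) (m : ℕ) :
    ∑ i ∈ Finset.range m, f (orbit r x i).well (orbit r x i).heading
      ((orbit r x i).hits ((orbit r x i).well, (orbit r x i).heading)) =
    ∑ w, ∑ s, ∑ k ∈ Finset.range ((orbit r x m).hits (w, s)), f w s k := by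
  classical
  induction m with
  | zero => simp [orbit_zero, hx.hits_eq]
  | succ m ih =>
    rw [Finset.sum_range_succ, ih, orbit_succ, State.next_hits]
    set y := orbit r x m
    rw [← Fintype.sum_prod_type' fun w s => ∑ k ∈ Finset.range (y.hits (w, s)), f w s k,
      ← Fintype.sum_prod_type' fun w s => ∑ k ∈ Finset.range (Function.update y.hits
        (y.well, y.heading) (y.hits (y.well, y.heading) + 1) (w, s)), f w s k]
    rw [eq_comm, ← sub_eq_iff_eq_add', ← Finset.sum_sub_distrib,
      Finset.sum_eq_single (y.well, y.heading)]
    · simp [Finset.sum_range_succ]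
    · intro p _ hp
      rw [Function.update_of_ne hp, sub_self]
    · simp

end WallSystem

/-! ### Sums with monotone weights and Cesàro limits -/

/-- Summation by parts with monotone weights. -/
theorem abs_sum_mul_le {u f : ℕ → ℝ} (hu : Monotone u) (hu0 : 0 ≤ u 0) {m : ℕ} {D : ℝ}
    (hD : ∀ k ≤ m, |∑ i ∈ Finset.range k, f i| ≤ D) :
    |∑ i ∈ Finset.range m, u i * f i| ≤ 2 * u m * D := by
  have key : ∀ k, ∑ i ∈ Finset.range k, u i * f i = u k * ∑ i ∈ Finset.range k, f i -
      ∑ i ∈ Finset.range k, (u (i + 1) - u i) * ∑ i ∈ Finset.range (i + 1), f i := by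
    intro k
    induction k with
    | zero => simp
    | succ k ih =>
      rw [Finset.sum_range_succ, ih, Finset.sum_range_succ (fun i => (u (i + 1) - u i) * _),
        Finset.sum_range_succ f k]
      ring
  have hD0 : 0 ≤ D := (abs_nonneg _).trans (hD 0 m.zero_le)
  have hum : 0 ≤ u m := hu0.trans (hu m.zero_le)
  have h1 : |∑ i ∈ Finset.range m, (u (i + 1) - u i) * ∑ i ∈ Finset.range (i + 1), f i| ≤
      ∑ i ∈ Finset.range m, (u (i + 1) - u i) * D := by
    refine (Finset.abs_sum_le_sum_abs _ _).trans (Finset.sum_le_sum fun i hi => ?_)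
    rw [abs_mul, abs_of_nonneg (sub_nonneg.2 (hu i.le_succ))]
    exact mul_le_mul_of_nonneg_left (hD _ (Finset.mem_range.1 hi))
      (sub_nonneg.2 (hu i.le_succ))
  -- The nonnegative increments of `u` telescope to `u m - u 0 ≤ u m`, so this sum costs no more
  -- than the boundary term; hence the factor `2`.
  rw [← Finset.sum_mul, Finset.sum_range_sub] at h1
  have h2 : |u m * ∑ i ∈ Finset.range m, f i| ≤ u m * D := by
    rw [abs_mul, abs_of_nonneg hum]
    exact mul_le_mul_of_nonneg_left (hD m le_rfl) hum
  rw [key]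
  refine (abs_sub _ _).trans ?_
  nlinarith

/-- Partial sums of a sequence with Cesàro limit zero, on the scale `1 / ε`. -/
theorem eventually_mul_abs_sum_le {f : ℕ → ℝ}
    (hf : Tendsto (fun k : ℕ => (∑ i ∈ Finset.range k, f i) / k) atTop (𝓝 0)) {K η : ℝ}
    (hK : 0 < K) (hη : 0 < η) :
    ∀ᶠ ε : ℝ in 𝓝[>] 0, ∀ k : ℕ, ε * k ≤ K → ε * |∑ i ∈ Finset.range k, f i| ≤ η := by
  obtain ⟨N, hN⟩ := (Metric.tendsto_atTop.1 hf) (η / K) (div_pos hη hK)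
  obtain ⟨C, hC⟩ := ((Set.finite_lt_nat N).image fun k => |∑ i ∈ Finset.range k, f i|).bddAbove
  have hsmall : ∀ᶠ ε : ℝ in 𝓝[>] 0, ε < η / (|C| + 1) :=
    (eventually_lt_nhds (by positivity)).filter_mono nhdsWithin_le_nhds
  filter_upwards [hsmall, self_mem_nhdsWithin] with ε h1 h2 k hk
  have h2' : 0 < ε := h2
  -- Below `N` only finitely many sums occur and a small `ε` suffices. From `N` on the sum is at
  -- most `η / K * k`, and `ε * k ≤ K`.
  rcases lt_or_ge k N with h | h
  · have : |∑ i ∈ Finset.range k, f i| ≤ |C| + 1 :=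
      (hC ⟨k, h, rfl⟩).trans ((le_abs_self C).trans (by linarith))
    calc _ ≤ η / (|C| + 1) * (|C| + 1) := by gcongr
      _ = η := div_mul_cancel₀ _ (by positivity)
  · have h3 := hN k h
    rw [dist_zero_right, Real.norm_eq_abs, abs_div, Nat.abs_cast] at h3
    rcases Nat.eq_zero_or_pos k with rfl | hk0
    · simpa using hη.le
    have hk0' : (0 : ℝ) < k := Nat.cast_pos.2 hk0
    rw [div_lt_iff₀ hk0'] at h3
    calc ε * |∑ i ∈ Finset.range k, f i| ≤ ε * (η / K * k) := by gcongr
      _ = η / K * (ε * k) := by ring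
      _ ≤ η / K * K := by gcongr
      _ = η := div_mul_cancel₀ _ hK.ne'

namespace WallSystem

variable {n : ℕ} {S : WallSystem n}

/-! ### Averaging -/

/-- The number of interior walls that a particle of speed `v` passes. -/
noncomputable def passable (S : WallSystem n) (v : ℝ) : ℕ :=
  open Classical in (Finset.univ.filter fun i => S.height i < v).card

theorem passable_mono {v v' : ℝ} (h : v ≤ v') : S.passable v ≤ S.passable v' := by
  classical
  exact Finset.card_le_card fun i hi => by
    simp only [Finset.mem_filter, Finset.mem_univ, true_and] at hi ⊢
    exact hi.trans_le h

theorem lt_of_passable_eq {v v' : ℝ} (h : v ≤ v') (he : S.passable v = S.passable v') {i : Fin n}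
    (hi : S.height i < v') : S.height i < v := by
  classical
  have hsub : (Finset.univ.filter fun i => S.height i < v) ⊆
      Finset.univ.filter fun i => S.height i < v' := fun i hi => by
    simp only [Finset.mem_filter, Finset.mem_univ, true_and] at hi ⊢
    exact hi.trans_le h
  have := Finset.eq_of_subset_of_card_le hsub he.ge
  have hmem : i ∈ Finset.univ.filter fun i => S.height i < v' := by simpa using hi
  rw [← this] at hmem
  simpa using hmem

theorem passable_lt {v v' : ℝ} {i : Fin n} (h : v ≤ S.height i) (h' : S.height i < v') :
    S.passable v + 1 ≤ S.passable v' := by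
  refine Nat.succ_le_of_lt ((passable_mono (h.trans h'.le)).lt_of_ne fun e => ?_)
  exact absurd (lt_of_passable_eq (h.trans h'.le) e h') (not_lt.2 h)

/-- Over an interval of speeds between which no wall becomes impassable, the clock is linear. -/
theorem clock_sub_of_passable_eq {c : S.Well → Side → ℝ} (hc : ∀ w s, 0 < c w s)
    (J : Fin (n + 1)) (u₀ : ℝ) {u u' : ℝ} (hu : 0 < u) (huu : u ≤ u')
    (he : S.passable u'⁻¹ = S.passable u⁻¹) :
    clock c J u₀ u' - clock c J u₀ u = pace c (S.wellAt J u⁻¹) * (u' - u) := by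
  rw [clock_sub hc]
  have : ∀ s ∈ uIcc u u', pace c (S.wellAt J s⁻¹) = pace c (S.wellAt J u⁻¹) := by
    intro s hs
    rw [uIcc_of_le huu] at hs
    have h1 : s⁻¹ ≤ u⁻¹ := inv_anti₀ hu hs.1
    have h2 : u'⁻¹ ≤ s⁻¹ := inv_anti₀ (hu.trans_le hs.1) hs.2
    rw [wellAt_congr fun i => ⟨fun h => h.trans_le h1, fun h =>
      (lt_of_passable_eq (inv_anti₀ hu huu) he h).trans_le h2⟩]
  rw [intervalIntegral.integral_congr this, intervalIntegral.integral_const, smul_eq_mul, mul_comm]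

/-- The restitution coefficients `1 - ε a`. -/
def coefficients (a : S.Well → Side → ℕ → ℝ) (ε : ℝ) : S.Well → Side → ℕ → ℝ :=
  fun w s k => 1 - ε * a w s k

/-- The relative energy loss at the wall at which the particle is reflected next. -/
noncomputable def State.loss (a : S.Well → Side → ℕ → ℝ) (x : S.State) : ℝ :=
  a x.well x.heading (x.hits (x.well, x.heading))

/-- The compensated loss at the next collision. -/
noncomputable def State.excess (a : S.Well → Side → ℕ → ℝ) (b : S.Well → Side → ℝ)
    (x : S.State) : ℝ :=
  pace b x.well * x.loss a - x.well.width

/-- The compensated losses in one well, if the numbers of collisions with its two walls are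
nearly equal. -/
theorem abs_sum_excess_well_le {a : S.Well → Side → ℕ → ℝ} {b : S.Well → Side → ℝ}
    (hb : ∀ w s, 0 < b w s) (w : S.Well) (k : Side → ℕ) (hk : ∀ s, k s ≤ k s.flip + 1) {D : ℝ}
    (hD : ∀ s, |∑ i ∈ Finset.range (k s), (a w s i - b w s)| ≤ D) :
    |∑ s, ∑ i ∈ Finset.range (k s), (pace b w * a w s i - w.width)| ≤
      pace b w * (2 * D) + w.width := by
  have hp := pace_pos hb w
  have hw := w.width_pos
  -- This is why `pace` has its form: the mean excesses at the two walls of a well cancel. What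
  -- remains are the fluctuations, bounded by `D`, and at most one unpaired collision, whose mean
  -- excess is at most the width.
  have hpair : pace b w * b w .left + pace b w * b w .right = 2 * w.width := by
    have := (add_pos (hb w .left) (hb w .right)).ne'
    rw [pace]; field_simp
  have h1 : 0 < pace b w * b w .left := mul_pos hp (hb w .left)
  have h2 : 0 < pace b w * b w .right := mul_pos hp (hb w .right)
  have e : ∀ s, ∑ i ∈ Finset.range (k s), (pace b w * a w s i - w.width) =
      pace b w * ∑ i ∈ Finset.range (k s), (a w s i - b w s) +
        k s * (pace b w * b w s - w.width) := by
    intro s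
    rw [Finset.mul_sum, ← nsmul_eq_mul, ← Finset.card_range (k s), ← Finset.sum_const,
      Finset.card_range, ← Finset.sum_add_distrib]
    exact Finset.sum_congr rfl fun i _ => by ring
  have hsum : ∀ f : Side → ℝ, ∑ s, f s = f .left + f .right := fun f => by
    rw [show (Finset.univ : Finset Side) = {.left, .right} from rfl, Finset.sum_pair (by simp)]
  rw [hsum, e, e]
  have k1 := hk .left
  have k2 := hk .right
  simp only [Side.flip] at k1 k2
  have k1' : (k .left : ℝ) ≤ k .right + 1 := by exact_mod_cast k1
  have k2' : (k .right : ℝ) ≤ k .left + 1 := by exact_mod_cast k2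
  have d1 := abs_le.1 (hD .left)
  have d2 := abs_le.1 (hD .right)
  have hz : |pace b w * b w .left - w.width| ≤ w.width := abs_le.2 ⟨by linarith, by linarith⟩
  have hk' : |(k .left : ℝ) - k .right| ≤ 1 := abs_le.2 ⟨by linarith, by linarith⟩
  have hmul : |((k .left : ℝ) - k .right) * (pace b w * b w .left - w.width)| ≤ 1 * w.width := by
    rw [abs_mul]
    exact mul_le_mul hk' hz (abs_nonneg _) zero_le_one
  have hmul' := abs_le.1 hmul
  have heq : (k .left : ℝ) * (pace b w * b w .left - w.width) +
      k .right * (pace b w * b w .right - w.width) =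
      ((k .left : ℝ) - k .right) * (pace b w * b w .left - w.width) := by
    linear_combination (k .right : ℝ) * hpair
  rw [abs_le]
  constructor <;> nlinarith

section Averaging

variable {a : S.Well → Side → ℕ → ℝ} {b : S.Well → Side → ℝ} (ha0 : ∀ w s k, 0 < a w s k)
  {A : ℝ} (haA : ∀ w s k, a w s k ≤ A) (hb : ∀ w s, 0 < b w s) {x : S.State} (hx : x.IsStart)
  {ε : ℝ} (hε : 0 < ε) (hεA : ε * A ≤ 1 / 2)

include ha0 haA hε hεA

omit ha0 in
theorem coefficients_pos (w : S.Well) (s : Side) (k : ℕ) : 0 < coefficients a ε w s k := by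
  have := mul_le_mul_of_nonneg_left (haA w s k) hε.le
  simp only [coefficients]
  linarith

omit haA hεA in
theorem coefficients_lt_one (w : S.Well) (s : Side) (k : ℕ) : coefficients a ε w s k < 1 := by
  have := mul_pos hε (ha0 w s k)
  simp only [coefficients]
  linarith

include hx

/-- With `q = ε * loss ≤ 1 / 2` the slowness is multiplied by `(1 - q)⁻¹ = 1 + q + q ^ 2 / (1 - q)`,
and `(1 - q)⁻¹ ≤ 2`. -/
theorem slowness_succ (m : ℕ) :
    (orbit (coefficients a ε) x (m + 1)).speed⁻¹ - (orbit (coefficients a ε) x m).speed⁻¹ ≤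
        2 * ε * A * (orbit (coefficients a ε) x m).speed⁻¹ ∧
      |(orbit (coefficients a ε) x (m + 1)).speed⁻¹ - (orbit (coefficients a ε) x m).speed⁻¹ -
        ε * (orbit (coefficients a ε) x m).loss a * (orbit (coefficients a ε) x m).speed⁻¹| ≤
        2 * ε ^ 2 * A ^ 2 * (orbit (coefficients a ε) x m).speed⁻¹ := by
  have hpos := orbit_speed_pos (coefficients_pos haA hε hεA) hx m
  rw [orbit_succ, State.next_speed]
  set y := orbit (coefficients a ε) x m
  have hu : 0 < y.speed⁻¹ := inv_pos.2 hpos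
  have hl0 : 0 < y.loss a := ha0 _ _ _
  have hl : y.loss a ≤ A := haA _ _ _
  have hA : 0 < A := hl0.trans_le hl
  have hr : coefficients a ε y.well y.heading (y.hits (y.well, y.heading)) = 1 - ε * y.loss a := rfl
  rw [hr, mul_inv]
  set q := ε * y.loss a with hq
  have hq0 : 0 < q := mul_pos hε hl0
  have hqA : q ≤ ε * A := mul_le_mul_of_nonneg_left hl hε.le
  have hq1 : q ≤ 1 / 2 := hqA.trans hεA
  have h1 : 0 < 1 - q := by linarith
  have e1 : (1 - q)⁻¹ - 1 = q / (1 - q) := by field_simp; ring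
  have e2 : (1 - q)⁻¹ - 1 - q = q ^ 2 / (1 - q) := by field_simp; ring
  have b1 : (1 - q)⁻¹ - 1 ≤ 2 * (ε * A) := by
    rw [e1, div_le_iff₀ h1]; nlinarith
  have b2 : (1 - q)⁻¹ - 1 - q ≤ 2 * (ε * A) ^ 2 := by
    rw [e2, div_le_iff₀ h1]
    have : q ^ 2 ≤ (ε * A) ^ 2 := pow_le_pow_left₀ hq0.le hqA 2
    nlinarith [sq_nonneg (ε * A)]
  have b3 : 0 ≤ (1 - q)⁻¹ - 1 - q := by rw [e2]; positivity
  constructor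
  · nlinarith
  · rw [show y.speed⁻¹ * (1 - q)⁻¹ - y.speed⁻¹ - q * y.speed⁻¹ =
      ((1 - q)⁻¹ - 1 - q) * y.speed⁻¹ by ring, abs_of_nonneg (by positivity)]
    calc _ ≤ 2 * (ε * A) ^ 2 * y.speed⁻¹ := by gcongr
      _ = _ := by ring

theorem monotone_slowness : Monotone fun m => (orbit (coefficients a ε) x m).speed⁻¹ :=
  fun _ m' h => inv_anti₀ (orbit_speed_pos (coefficients_pos haA hε hεA) hx m')
    ((orbit_speed_strictAnti (coefficients_pos haA hε hεA)
      (coefficients_lt_one ha0 hε) hx).antitone h)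

theorem slowness_le_exp (m : ℕ) : (orbit (coefficients a ε) x m).speed⁻¹ ≤
    x.speed⁻¹ * Real.exp (2 * A * (ε * m)) := by
  induction m with
  | zero => simp [orbit_zero]
  | succ m ih =>
    have h1 := (slowness_succ ha0 haA hx hε hεA m).1
    have hpos := inv_pos.2 (orbit_speed_pos (coefficients_pos haA hε hεA) hx m)
    have h2 : 1 + 2 * ε * A ≤ Real.exp (2 * A * ε) := by
      have := Real.add_one_le_exp (2 * A * ε)
      linarith
    have hA : 0 < A := (ha0 (S.wellAt 0 0) .left 0).trans_le (haA _ _ _)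
    calc (orbit (coefficients a ε) x (m + 1)).speed⁻¹
        ≤ (1 + 2 * ε * A) * (orbit (coefficients a ε) x m).speed⁻¹ := by linarith
      _ ≤ Real.exp (2 * A * ε) * (x.speed⁻¹ * Real.exp (2 * A * (ε * m))) := by gcongr
      _ = x.speed⁻¹ * (Real.exp (2 * A * ε) * Real.exp (2 * A * (ε * m))) := by ring
      _ = _ := by
        rw [← Real.exp_add]
        push_cast
        ring_nf

include hb

/-- Along the orbit, the clock of the averaged motion differs from the time by the accumulated
excess, up to small errors. -/
theorem abs_clock_sub_time_le {J : Fin (n + 1)} (hJ : IsFinalCell (coefficients a ε) x J)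
    {B : ℝ} (hB : ∀ w, pace b w ≤ B) {U : ℝ} {m : ℕ}
    (hU : ∀ i ≤ m, (orbit (coefficients a ε) x i).speed⁻¹ ≤ U) :
    |clock b J x.speed⁻¹ (orbit (coefficients a ε) x m).speed⁻¹ -
        ε * (orbit (coefficients a ε) x m).time -
        ε * ∑ i ∈ Finset.range m, (orbit (coefficients a ε) x i).speed⁻¹ *
          (orbit (coefficients a ε) x i).excess a b| ≤
      U * (2 * B * A ^ 2 * ε * (ε * m) + 2 * B * A * ε * (S.passable x.speed -
        S.passable (orbit (coefficients a ε) x m).speed)) + (if m = 0 then 0 else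
        ε * (|S.pos (x.well.wall x.heading) - x.pos| + x.well.width) * x.speed⁻¹) := by
  -- There are three sources of error: the second-order term in the increment of the slowness at
  -- each collision; the collisions at which the number of passable walls drops, where the clock is
  -- not linear (these drops telescope); and the first flight, which does not cross a whole well and
  -- is absent for `m = 0`.
  have hr0 := coefficients_pos haA hε hεA
  have hr1 := coefficients_lt_one (a := a) ha0 hε
  have hA : 0 < A := (ha0 (S.wellAt 0 0) .left 0).trans_le (haA _ _ _)
  have hB0 : 0 < B := (pace_pos hb (S.wellAt 0 0)).trans_le (hB _)
  induction m with
  | zero => simp [orbit_zero, clock_self, hx.time_eq]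
  | succ m ih =>
    have ih' := ih fun i hi => hU i (hi.trans m.le_succ)
    have hUm := hU m m.le_succ
    have hpos := orbit_speed_pos hr0 hx m
    have hpos' := orbit_speed_pos hr0 hx (m + 1)
    have hmono := monotone_slowness ha0 haA hx hε hεA m.le_succ
    have hs := slowness_succ ha0 haA hx hε hεA m
    have hanti := (orbit_speed_strictAnti hr0 hr1 hx).antitone m.le_succ
    have hwell : S.wellAt J (orbit (coefficients a ε) x m).speed =
        (orbit (coefficients a ε) x m).well := wellAt_eq_of_hasCell (hJ m)
    simp only at hmono hanti
    have hinv : 0 < (orbit (coefficients a ε) x m).speed⁻¹ := inv_pos.2 hpos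
    -- the time between the collisions
    have htime : |ε * (orbit (coefficients a ε) x (m + 1)).time -
        ε * (orbit (coefficients a ε) x m).time - ε * ((orbit (coefficients a ε) x m).well.width *
          (orbit (coefficients a ε) x m).speed⁻¹)| ≤ if m = 0 then
        ε * (|S.pos (x.well.wall x.heading) - x.pos| + x.well.width) * x.speed⁻¹ else 0 := by
      cases m with
      | zero =>
        rw [if_pos rfl, orbit_succ, State.next_time, orbit_zero, div_eq_mul_inv]
        have h1 : 0 ≤ ε * (|S.pos (x.well.wall x.heading) - x.pos| * x.speed⁻¹) :=
          mul_nonneg hε.le (mul_nonneg (abs_nonneg _) hinv.le)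
        have h2 : 0 ≤ ε * (x.well.width * x.speed⁻¹) :=
          mul_nonneg hε.le (mul_nonneg x.well.width_pos.le hinv.le)
        rw [abs_le]
        constructor <;> linarith
      | succ m =>
        rw [if_neg (Nat.succ_ne_zero m), orbit_time_succ_succ hr0 hr1 hx, div_eq_mul_inv]
        refine le_of_eq (abs_eq_zero.2 ?_)
        ring
    -- the increment of the clock
    have hclock : |clock b J x.speed⁻¹ (orbit (coefficients a ε) x (m + 1)).speed⁻¹ -
        clock b J x.speed⁻¹ (orbit (coefficients a ε) x m).speed⁻¹ -
        pace b (orbit (coefficients a ε) x m).well *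
          ((orbit (coefficients a ε) x (m + 1)).speed⁻¹ -
            (orbit (coefficients a ε) x m).speed⁻¹)| ≤
        2 * B * A * ε * U * (S.passable (orbit (coefficients a ε) x m).speed -
          S.passable (orbit (coefficients a ε) x (m + 1)).speed) := by
      -- If no wall becomes impassable, the clock is linear with the pace of the present well.
      -- Otherwise both increments are between `0` and `B` times that of the slowness, and the drop
      -- of `passable`, at least `1`, pays for the difference.
      by_cases he : S.passable (orbit (coefficients a ε) x (m + 1)).speed =
          S.passable (orbit (coefficients a ε) x m).speed
      · rw [clock_sub_of_passable_eq hb J _ hinv hmono (by simpa using he), inv_inv, hwell, he]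
        simp
      · have hlt : S.passable (orbit (coefficients a ε) x (m + 1)).speed + 1 ≤
            S.passable (orbit (coefficients a ε) x m).speed :=
          Nat.succ_le_of_lt ((passable_mono hanti).lt_of_ne he)
        have hlt' : (S.passable (orbit (coefficients a ε) x (m + 1)).speed : ℝ) + 1 ≤
            S.passable (orbit (coefficients a ε) x m).speed := by exact_mod_cast hlt
        have g1 := clock_sub_le hb J x.speed⁻¹ hB hmono
        have g2 := (strictMono_clock hb J x.speed⁻¹).monotone hmono
        have g3 : pace b (orbit (coefficients a ε) x m).well *
          ((orbit (coefficients a ε) x (m + 1)).speed⁻¹ -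
            (orbit (coefficients a ε) x m).speed⁻¹) ≤ B *
          ((orbit (coefficients a ε) x (m + 1)).speed⁻¹ -
            (orbit (coefficients a ε) x m).speed⁻¹) :=
          mul_le_mul_of_nonneg_right (hB _) (sub_nonneg.2 hmono)
        have g4 := mul_nonneg (pace_pos hb (orbit (coefficients a ε) x m).well).le
          (sub_nonneg.2 hmono)
        have g5 : B * ((orbit (coefficients a ε) x (m + 1)).speed⁻¹ -
            (orbit (coefficients a ε) x m).speed⁻¹) ≤ B * (2 * ε * A * U) := by
          refine mul_le_mul_of_nonneg_left (hs.1.trans ?_) hB0.le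
          exact mul_le_mul_of_nonneg_left hUm (by positivity)
        have hU0 : 0 < U := hinv.trans_le hUm
        have g6 : B * (2 * ε * A * U) ≤ 2 * B * A * ε * U *
            (S.passable (orbit (coefficients a ε) x m).speed -
          S.passable (orbit (coefficients a ε) x (m + 1)).speed) := by
          have : 0 < 2 * B * A * ε * U := by positivity
          nlinarith
        refine le_trans (abs_le.2 ⟨?_, ?_⟩) (g5.trans g6) <;> linarith
    have hsecond : |pace b (orbit (coefficients a ε) x m).well *
          ((orbit (coefficients a ε) x (m + 1)).speed⁻¹ -
            (orbit (coefficients a ε) x m).speed⁻¹) -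
          pace b (orbit (coefficients a ε) x m).well * (ε *
            (orbit (coefficients a ε) x m).loss a * (orbit (coefficients a ε) x m).speed⁻¹)| ≤
        B * (2 * ε ^ 2 * A ^ 2 * U) := by
      rw [← mul_sub, abs_mul, abs_of_pos (pace_pos hb _)]
      refine mul_le_mul (hB _) (hs.2.trans ?_) (abs_nonneg _) hB0.le
      exact mul_le_mul_of_nonneg_left hUm (by positivity)
    rw [Finset.sum_range_succ, if_neg (Nat.succ_ne_zero m)]
    have hif : (if m = 0 then (0 : ℝ) else
        ε * (|S.pos (x.well.wall x.heading) - x.pos| + x.well.width) * x.speed⁻¹) +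
        (if m = 0 then
        ε * (|S.pos (x.well.wall x.heading) - x.pos| + x.well.width) * x.speed⁻¹ else 0) =
        ε * (|S.pos (x.well.wall x.heading) - x.pos| + x.well.width) * x.speed⁻¹ := by
      split_ifs <;> ring
    rw [← hif]
    have hexc : ε * ((orbit (coefficients a ε) x m).speed⁻¹ *
        (orbit (coefficients a ε) x m).excess a b) =
        pace b (orbit (coefficients a ε) x m).well * (ε *
            (orbit (coefficients a ε) x m).loss a * (orbit (coefficients a ε) x m).speed⁻¹) -
        ε * ((orbit (coefficients a ε) x m).well.width *
          (orbit (coefficients a ε) x m).speed⁻¹) := by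
      rw [State.excess]; ring
    rw [mul_add ε, hexc]
    rw [abs_le] at ih' htime hclock hsecond ⊢
    push_cast
    constructor <;> linarith

end Averaging

end WallSystem

namespace WallSystem

variable {n : ℕ} {S : WallSystem n}

/-- The energy along the orbit is close to that of the averaged motion, quantitatively. -/
theorem exists_energy_bound {a : S.Well → Side → ℕ → ℝ} {b : S.Well → Side → ℝ}
    (ha0 : ∀ w s k, 0 < a w s k) {A : ℝ} (haA : ∀ w s k, a w s k ≤ A) (hb : ∀ w s, 0 < b w s)
    {x : S.State} (hx : x.IsStart) {T : ℝ} (hT : 0 < T) :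
    ∃ K > 0, ∃ Q > 0, ∀ ε : ℝ, 0 < ε → ε ≤ 1 → ε * A ≤ 1 / 2 → ∀ η : ℝ, 0 ≤ η →
      (∀ w s, ∀ k : ℕ, ε * k ≤ K → ε * |∑ i ∈ Finset.range k, (a w s i - b w s)| ≤ η) →
      ∀ J, IsFinalCell (coefficients a ε) x J → ∀ t ∈ Icc 0 T,
        |linearInterpolation (fun m => ε * (orbit (coefficients a ε) x m).time)
          (fun m => (orbit (coefficients a ε) x m).speed ^ 2 / 2) t -
          (slowness b J x.speed⁻¹ t)⁻¹ ^ 2 / 2| ≤ Q * (η + ε) := by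
  obtain ⟨ℓ, hℓ0, hℓ⟩ := S.exists_width_bound
  obtain ⟨p, B, hp0, hB0, hpB⟩ := exists_pace_bounds hb
  have hA : 0 < A := (ha0 (S.wellAt 0 0) .left 0).trans_le (haA _ _ _)
  have hv := hx.speed_pos
  have hu₀ : 0 < x.speed⁻¹ := inv_pos.2 hv
  set u₀ := x.speed⁻¹ with hu₀def
  -- `K` bounds `ε` times the number of collisions up to the first one after `T`: a full flight
  -- takes at least `ℓ / x.speed`, and with `ε ≤ 1` the summand `2` covers the first flight and the
  -- one under way. `U` bounds the slowness so far, `G` the length of a flight.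
  set K : ℝ := T * (x.speed / ℓ) + 2 with hK
  set U : ℝ := u₀ * Real.exp (2 * A * K) with hU
  set Ws : ℝ := ∑ w : S.Well, w.width with hWs
  set Ps : ℝ := ∑ w : S.Well, pace b w with hPs
  set G : ℝ := |S.pos (x.well.wall x.heading) - x.pos| + Ws with hG
  have hK0 : 0 < K := by positivity
  have hU0 : 0 < U := by positivity
  have hWs0 : 0 ≤ Ws := Finset.sum_nonneg fun w _ => w.width_pos.le
  have hPs0 : 0 ≤ Ps := Finset.sum_nonneg fun w _ => (pace_pos hb w).le
  have hG0 : 0 ≤ G := add_nonneg (abs_nonneg _) hWs0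
  have hwW : ∀ w : S.Well, w.width ≤ Ws := fun w =>
    Finset.single_le_sum (f := fun w : S.Well => w.width) (fun w _ => w.width_pos.le)
      (Finset.mem_univ w)
  set R : ℝ := 2 * U * Ws + U * (2 * B * A ^ 2 * K + 2 * B * A * S.passable x.speed) + G * u₀ +
    G * U with hR
  have hR0 : 0 ≤ R := by positivity
  -- The first term bounds the loss of energy in one collision, between whose endpoints the
  -- interpolation lies. The second converts the error `4 * U * Ps * η + R * ε` of the clock into
  -- one of the slowness (`/ p`) and then of the energy (`/ u₀ ^ 3`).
  set Q : ℝ := 2 * A * U / u₀ ^ 3 + (4 * U * Ps + R) / p / u₀ ^ 3 with hQ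
  have hQ0 : 0 < Q := by positivity
  refine ⟨K, hK0, Q, hQ0, ?_⟩
  intro ε hε hε1 hεA η hη hsum J hJ t ht
  have hr0 := coefficients_pos haA hε hεA
  have hr1 := coefficients_lt_one (a := a) ha0 hε
  have hτ := strictMono_mul_time hr0 hr1 hx hε
  obtain ⟨m, hm⟩ := exists_mem_Ico (τ := fun m => ε * (orbit (coefficients a ε) x m).time)
    (t := t) (T := T) ⟨by simpa [orbit_zero, hx.time_eq] using ht.1, ht.2⟩
    (exists_lt_mul_time hr0 hr1 hx hε T)
  have hmem := linearInterpolation_mem_Icc hτ (antitone_energy hr0 hr1 hx) ⟨hm.1, hm.2.le⟩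
  have hm1 : ε * (orbit (coefficients a ε) x m).time ≤ t := hm.1
  have hm2 : t < ε * (orbit (coefficients a ε) x (m + 1)).time := hm.2
  -- the number of collisions
  have hmK : ε * (m + 1 : ℕ) ≤ K := by
    rcases m with _ | m
    · simp only [zero_add, Nat.cast_one, mul_one, hK]
      have : 0 ≤ T * (x.speed / ℓ) := by positivity
      linarith
    · have h1 := mul_le_mul_of_nonneg_left (le_orbit_time hr0 hr1 hx hℓ m) hε.le
      have h2 : ε * m * (ℓ / x.speed) ≤ T := by
        calc ε * m * (ℓ / x.speed) = ε * (m * (ℓ / x.speed)) := by ring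
          _ ≤ _ := h1
          _ ≤ t := hm1
          _ ≤ T := ht.2
      have h3 : ε * m ≤ T * (x.speed / ℓ) := by
        have h4 := (le_div_iff₀ (div_pos hℓ0 hv)).2 h2
        rwa [div_div_eq_mul_div, mul_div_assoc] at h4
      push_cast
      rw [hK]
      nlinarith
  have hle : ∀ i ≤ m + 1, ε * i ≤ K := fun i hi =>
    (mul_le_mul_of_nonneg_left (Nat.cast_le.2 hi) hε.le).trans hmK
  have hUi : ∀ i ≤ m + 1, (orbit (coefficients a ε) x i).speed⁻¹ ≤ U := fun i hi => by
    refine (slowness_le_exp ha0 haA hx hε hεA i).trans ?_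
    rw [hU]
    have := hle i hi
    gcongr
  have hUm := hUi m m.le_succ
  -- the accumulated excess
  have hexc : ∀ k ≤ m, |∑ i ∈ Finset.range k, (orbit (coefficients a ε) x i).excess a b| ≤
      (2 * η * Ps + ε * Ws) / ε := by
    intro k hk
    have h1 := sum_orbit_eq (coefficients a ε) hx
      (fun w s k => pace b w * a w s k - w.width) k
    have h2 : ∑ i ∈ Finset.range k, (orbit (coefficients a ε) x i).excess a b =
        ∑ w, ∑ s, ∑ k ∈ Finset.range ((orbit (coefficients a ε) x k).hits (w, s)),
          (pace b w * a w s k - w.width) := h1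
    rw [h2, le_div_iff₀ hε]
    have h3 : ∀ w : S.Well, |∑ s, ∑ k ∈ Finset.range ((orbit (coefficients a ε) x k).hits (w, s)),
        (pace b w * a w s k - w.width)| ≤ pace b w * (2 * (η / ε)) + w.width := by
      intro w
      refine abs_sum_excess_well_le hb w (fun s => (orbit (coefficients a ε) x k).hits (w, s))
        (fun s => (orbit_balanced hr0 hr1 hx k).flip w s) fun s => ?_
      rw [le_div_iff₀ hε, mul_comm]
      exact hsum w s _ (hle _ ((orbit_hits_le _ hx k _).trans (hk.trans m.le_succ)))
    calc _ ≤ (∑ w, (pace b w * (2 * (η / ε)) + w.width)) * ε :=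
          mul_le_mul_of_nonneg_right ((Finset.abs_sum_le_sum_abs _ _).trans
            (Finset.sum_le_sum fun w _ => h3 w)) hε.le
      _ = 2 * η * Ps + ε * Ws := by
        rw [Finset.sum_add_distrib, ← Finset.sum_mul]
        field_simp
        ring
  have habel := abs_sum_mul_le (f := fun i => (orbit (coefficients a ε) x i).excess a b)
    (monotone_slowness ha0 haA hx hε hεA) hu₀.le hexc
  have habel' : |ε * ∑ i ∈ Finset.range m, (orbit (coefficients a ε) x i).speed⁻¹ *
      (orbit (coefficients a ε) x i).excess a b| ≤ 2 * U * (2 * η * Ps + ε * Ws) := by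
    rw [abs_mul, abs_of_pos hε]
    calc _ ≤ ε * (2 * U * ((2 * η * Ps + ε * Ws) / ε)) := by
          refine mul_le_mul_of_nonneg_left (habel.trans ?_) hε.le
          have : 0 ≤ (2 * η * Ps + ε * Ws) / ε := by positivity
          gcongr
      _ = _ := by field_simp
  have hclock := abs_clock_sub_time_le ha0 haA hb hx hε hεA hJ (fun w => (hpB w).2)
    (fun i hi => hUi i (hi.trans m.le_succ)) (m := m)
  have hif : (if m = 0 then (0 : ℝ) else
      ε * (|S.pos (x.well.wall x.heading) - x.pos| + x.well.width) * x.speed⁻¹) ≤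
      ε * G * u₀ := by
    split_ifs
    · positivity
    · have := hwW x.well
      rw [hG]
      gcongr
  have hrem : U * (2 * B * A ^ 2 * ε * (ε * m) + 2 * B * A * ε * (S.passable x.speed -
        S.passable (orbit (coefficients a ε) x m).speed)) ≤
      ε * (U * (2 * B * A ^ 2 * K + 2 * B * A * S.passable x.speed)) := by
    have h1 := hle m m.le_succ
    have h2 : (0 : ℝ) ≤ S.passable (orbit (coefficients a ε) x m).speed := Nat.cast_nonneg _
    calc _ ≤ U * (2 * B * A ^ 2 * ε * K + 2 * B * A * ε * S.passable x.speed) := by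
          gcongr
          linarith
      _ = _ := by ring
  have hgap : ε * (orbit (coefficients a ε) x (m + 1)).time -
      ε * (orbit (coefficients a ε) x m).time ≤ ε * (G * U) := by
    have hpos := orbit_speed_pos hr0 hx m
    have hinv := inv_pos.2 hpos
    have key : (orbit (coefficients a ε) x (m + 1)).time - (orbit (coefficients a ε) x m).time ≤
        G * (orbit (coefficients a ε) x m).speed⁻¹ := by
      rcases m with _ | m
      · rw [orbit_succ, State.next_time, orbit_zero, add_sub_cancel_left, div_eq_mul_inv, hG]
        refine mul_le_mul_of_nonneg_right ?_ hu₀.le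
        linarith
      · rw [orbit_time_succ_succ hr0 hr1 hx, add_sub_cancel_left, div_eq_mul_inv]
        refine mul_le_mul_of_nonneg_right ((hwW _).trans ?_) hinv.le
        rw [hG]
        linarith [abs_nonneg (S.pos (x.well.wall x.heading) - x.pos)]
    rw [← mul_sub]
    exact mul_le_mul_of_nonneg_left (key.trans (mul_le_mul_of_nonneg_left hUm hG0)) hε.le
  have hfin : |t - clock b J u₀ (orbit (coefficients a ε) x m).speed⁻¹| ≤
      4 * U * Ps * η + R * ε := by
    have e : 4 * U * Ps * η + R * ε = 2 * U * (2 * η * Ps + ε * Ws) +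
        ε * (U * (2 * B * A ^ 2 * K + 2 * B * A * S.passable x.speed)) + ε * G * u₀ +
        ε * (G * U) := by rw [hR]; ring
    rw [e]
    rw [abs_le] at hclock habel' ⊢
    constructor <;> linarith
  have hum : u₀ ≤ (orbit (coefficients a ε) x m).speed⁻¹ :=
    monotone_slowness ha0 haA hx hε hεA m.zero_le
  have hH := abs_sq_inv_slowness_sub_le hb J hu₀ hp0 (fun w => (hpB w).1) ht.1 hum
  rw [inv_inv] at hH
  have hstep : (orbit (coefficients a ε) x m).speed ^ 2 / 2 -
      (orbit (coefficients a ε) x (m + 1)).speed ^ 2 / 2 ≤ 2 * ε * A * U / u₀ ^ 3 := by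
    have h1 := (slowness_succ ha0 haA hx hε hεA m).1
    have h2 := monotone_slowness ha0 haA hx hε hεA m.le_succ
    simp only at h2
    have h3 := abs_sq_inv_sub_le hu₀ hum (hum.trans h2)
    rw [inv_inv, inv_inv] at h3
    refine ((le_abs_self _).trans h3).trans ?_
    rw [abs_sub_comm, abs_of_nonneg (sub_nonneg.2 h2)]
    refine div_le_div_of_nonneg_right (h1.trans ?_) (by positivity)
    gcongr
  have hbound : |t - clock b J u₀ (orbit (coefficients a ε) x m).speed⁻¹| / p / u₀ ^ 3 ≤
      (4 * U * Ps * η + R * ε) / p / u₀ ^ 3 := by gcongr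
  have hQle : 2 * ε * A * U / u₀ ^ 3 + (4 * U * Ps * η + R * ε) / p / u₀ ^ 3 ≤ Q * (η + ε) := by
    have e : Q * (η + ε) - (2 * ε * A * U / u₀ ^ 3 + (4 * U * Ps * η + R * ε) / p / u₀ ^ 3) =
        2 * A * U / u₀ ^ 3 * η + (4 * U * Ps * ε + R * η) / p / u₀ ^ 3 := by
      rw [hQ]; ring
    have : 0 ≤ 2 * A * U / u₀ ^ 3 * η + (4 * U * Ps * ε + R * η) / p / u₀ ^ 3 := by positivity
    linarith
  have hmem1 := hmem.1
  have hmem2 := hmem.2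
  refine le_trans ?_ hQle
  rw [abs_le] at hH ⊢
  constructor <;> linarith

/-- The energy along the orbit converges to that of the averaged motion over the same final cell,
if the Cesàro means of the losses converge. -/
theorem eventually_energy_close {a : S.Well → Side → ℕ → ℝ} {b : S.Well → Side → ℝ}
    (ha0 : ∀ w s k, 0 < a w s k) {A : ℝ} (haA : ∀ w s k, a w s k ≤ A) (hb : ∀ w s, 0 < b w s)
    (hlim : ∀ w s, Tendsto (fun k : ℕ => (∑ i ∈ Finset.range k, a w s i) / k) atTop (𝓝 (b w s)))
    {x : S.State} (hx : x.IsStart) {T : ℝ} (hT : 0 < T) {η : ℝ} (hη : 0 < η) :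
    ∀ᶠ ε : ℝ in 𝓝[>] 0, ∀ J, IsFinalCell (coefficients a ε) x J → ∀ t ∈ Icc 0 T,
        |linearInterpolation (fun m => ε * (orbit (coefficients a ε) x m).time)
          (fun m => (orbit (coefficients a ε) x m).speed ^ 2 / 2) t -
          (slowness b J x.speed⁻¹ t)⁻¹ ^ 2 / 2| ≤ η := by
  obtain ⟨K, hK, Q, hQ, h⟩ := exists_energy_bound ha0 haA hb hx hT
  have hlim' : ∀ w s, Tendsto (fun k : ℕ => (∑ i ∈ Finset.range k, (a w s i - b w s)) / k) atTop
      (𝓝 0) := by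
    intro w s
    have h1 := (hlim w s).sub_const (b w s)
    rw [sub_self] at h1
    refine h1.congr' ?_
    filter_upwards [eventually_gt_atTop 0] with k hk
    have : (k : ℝ) ≠ 0 := by positivity
    rw [Finset.sum_sub_distrib, Finset.sum_const, Finset.card_range, nsmul_eq_mul]
    field_simp
  have hη' : 0 < η / (2 * Q) := by positivity
  have hev : ∀ᶠ ε : ℝ in 𝓝[>] 0, ∀ w s, ∀ k : ℕ, ε * k ≤ K →
      ε * |∑ i ∈ Finset.range k, (a w s i - b w s)| ≤ η / (2 * Q) :=
    eventually_all.2 fun w => eventually_all.2 fun s =>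
      eventually_mul_abs_sum_le (hlim' w s) hK hη'
  have hA : 0 < A := (ha0 (S.wellAt 0 0) .left 0).trans_le (haA _ _ _)
  have small : ∀ {c : ℝ}, 0 < c → ∀ᶠ r in 𝓝[>] (0 : ℝ), r < c := fun hc =>
    (eventually_lt_nhds hc).filter_mono nhdsWithin_le_nhds
  filter_upwards [hev, self_mem_nhdsWithin, small zero_lt_one, small (c := 1 / 2 / A) (by positivity),
    small hη'] with ε h1 h2 h3 h4 h5 J hJ t ht
  refine (h ε h2 h3.le ?_ _ hη'.le h1 J hJ t ht).trans ?_
  · rw [lt_div_iff₀ hA] at h4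
    exact h4.le
  · calc Q * (η / (2 * Q) + ε) ≤ Q * (η / (2 * Q) + η / (2 * Q)) := by gcongr
      _ = η := by field_simp; ring

end WallSystem

/-! ### A renewal theorem for alternating steps -/

namespace AlternatingRenewal

/-- The measure `F` dominates a multiple of the Lebesgue measure on an interval. -/
def Minorized (κ p q : ℝ) (F : Measure ℝ) : Prop :=
  ∀ φ : ℝ → ℝ≥0∞, Measurable φ → ENNReal.ofReal κ * ∫⁻ y in Icc p q, φ y ≤ ∫⁻ y, φ y ∂F

/-- The convolution of the Lebesgue measures on two intervals dominates a multiple of the Lebesgue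
measure on an interval. -/
theorem lintegral_Icc_Icc_ge {ψ : ℝ → ℝ≥0∞} (hψ : Measurable ψ) {p q P Q η : ℝ}
    (h1 : η ≤ q - p) (h2 : η ≤ Q - P) :
    ENNReal.ofReal η * ∫⁻ r in Icc (p + P + η) (q + Q - η), ψ r ≤
      ∫⁻ y in Icc p q, ∫⁻ s in Icc P Q, ψ (y + s) := by
  have hmeas : Measurable fun z : ℝ × ℝ => (Icc P Q).indicator (1 : ℝ → ℝ≥0∞) (z.2 - z.1) * ψ z.2 :=
    ((measurable_one.indicator measurableSet_Icc).comp
      (measurable_snd.sub measurable_fst)).mul (hψ.comp measurable_snd)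
  have e1 : ∀ y, ∫⁻ s in Icc P Q, ψ (y + s) =
      ∫⁻ r, (Icc P Q).indicator (1 : ℝ → ℝ≥0∞) (r - y) * ψ r := by
    intro y
    rw [← lintegral_add_left_eq_self (fun r => (Icc P Q).indicator (1 : ℝ → ℝ≥0∞) (r - y) * ψ r) y,
      ← lintegral_indicator measurableSet_Icc]
    refine lintegral_congr fun s => ?_
    by_cases hs : s ∈ Icc P Q <;> simp [hs, add_sub_cancel_left]
  simp only [e1]
  rw [lintegral_lintegral_swap hmeas.aemeasurable, ← lintegral_const_mul _ hψ,
    ← lintegral_indicator measurableSet_Icc]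
  refine lintegral_mono fun r => ?_
  have hmr : Measurable fun y => (Icc P Q).indicator (1 : ℝ → ℝ≥0∞) (r - y) :=
    (measurable_one.indicator measurableSet_Icc).comp (measurable_const.sub measurable_id)
  rw [lintegral_mul_const _ hmr]
  by_cases hr : r ∈ Icc (p + P + η) (q + Q - η)
  · rw [indicator_of_mem hr]
    refine mul_le_mul_left ?_ _
    -- The density of the convolution at `r` is the length of the set of `y` in `Icc p q` with `r -
    -- y` in `Icc P Q`. After trimming `η` at both ends, this set contains an interval of length
    -- `η`.
    have hsub : Icc (max p (r - Q)) (max p (r - Q) + η) ⊆ Icc p q ∩ Icc (r - Q) (r - P) := by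
      intro y hy
      have a1 := le_max_left p (r - Q)
      have a2 := le_max_right p (r - Q)
      have a3 : max p (r - Q) + η ≤ q := by
        have : max p (r - Q) ≤ q - η := max_le (by linarith) (by linarith [hr.2])
        linarith
      have a4 : max p (r - Q) + η ≤ r - P := by
        have : max p (r - Q) ≤ r - P - η := max_le (by linarith [hr.1]) (by linarith)
        linarith
      exact ⟨⟨a1.trans hy.1, hy.2.trans a3⟩, ⟨a2.trans hy.1, hy.2.trans a4⟩⟩
    calc ENNReal.ofReal η = volume (Icc (max p (r - Q)) (max p (r - Q) + η)) := by
          rw [Real.volume_Icc, add_sub_cancel_left]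
      _ ≤ volume (Icc p q ∩ Icc (r - Q) (r - P)) := measure_mono hsub
      _ = ∫⁻ y in Icc p q, (Icc (r - Q) (r - P)).indicator 1 y := by
          rw [lintegral_indicator_one measurableSet_Icc, Measure.restrict_apply measurableSet_Icc,
            inter_comm]
      _ ≤ _ := by
          refine lintegral_mono fun y => ?_
          by_cases hy : y ∈ Icc (r - Q) (r - P)
          · have : r - y ∈ Icc P Q := ⟨by linarith [hy.2], by linarith [hy.1]⟩
            simp [hy, this]
          · simp [hy]
  · rw [indicator_of_notMem hr]
    exact zero_le

/-- A step on one side followed by one on the other has the convolution as its law; grouping steps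
in pairs turns the alternating walk into one with a single step law. -/
theorem Minorized.conv {κ₁ κ₂ p₁ q₁ p₂ q₂ : ℝ} {F₁ F₂ : Measure ℝ} [SFinite F₁] [SFinite F₂]
    (h₁ : Minorized κ₁ p₁ q₁ F₁) (h₂ : Minorized κ₂ p₂ q₂ F₂) (hκ₁ : 0 ≤ κ₁) (hκ₂ : 0 ≤ κ₂) {η : ℝ}
    (hη₁ : η ≤ q₁ - p₁) (hη₂ : η ≤ q₂ - p₂) :
    Minorized (κ₁ * κ₂ * η) (p₁ + p₂ + η) (q₁ + q₂ - η) (F₁ ∗ F₂) := by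
  intro φ hφ
  rw [Measure.lintegral_conv hφ]
  have hm : Measurable fun x => ∫⁻ y in Icc p₂ q₂, φ (x + y) :=
    Measurable.lintegral_prod_right' (f := fun z : ℝ × ℝ => φ (z.1 + z.2))
      (hφ.comp (measurable_fst.add measurable_snd))
  calc _ = ENNReal.ofReal κ₁ * (ENNReal.ofReal κ₂ *
        (ENNReal.ofReal η * ∫⁻ r in Icc (p₁ + p₂ + η) (q₁ + q₂ - η), φ r)) := by
        rw [ENNReal.ofReal_mul (mul_nonneg hκ₁ hκ₂), ENNReal.ofReal_mul hκ₁]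
        ring
    _ ≤ ENNReal.ofReal κ₁ * (ENNReal.ofReal κ₂ *
        ∫⁻ x in Icc p₁ q₁, ∫⁻ y in Icc p₂ q₂, φ (x + y)) := by
        gcongr
        exact lintegral_Icc_Icc_ge hφ hη₁ hη₂
    _ = ENNReal.ofReal κ₁ *
        ∫⁻ x in Icc p₁ q₁, ENNReal.ofReal κ₂ * ∫⁻ y in Icc p₂ q₂, φ (x + y) := by
        rw [lintegral_const_mul _ hm]
    _ ≤ ∫⁻ x, (ENNReal.ofReal κ₂ * ∫⁻ y in Icc p₂ q₂, φ (x + y)) ∂F₁ :=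
        h₁ (fun x => ENNReal.ofReal κ₂ * ∫⁻ y in Icc p₂ q₂, φ (x + y)) (hm.const_mul _)
    _ ≤ ∫⁻ x, ∫⁻ y, φ (x + y) ∂F₂ ∂F₁ :=
        lintegral_mono fun x => h₂ (fun y => φ (x + y)) (hφ.comp (measurable_const.add measurable_id))

/-- A superharmonic function dominates its means over long intervals. -/
theorem exists_superharmonic_ge {b κ p q : ℝ} (hb0 : 0 ≤ b) (hκ : 0 < κ) (hpq : p < q) (N : ℕ) :
    ∃ κ' P Q : ℝ, 0 < κ' ∧ (N + 1) * ((q - p) / 3) ≤ Q - P ∧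
      ∀ F : Measure ℝ, (∀ᵐ y ∂F, y ≤ b) → Minorized κ p q F →
        ∀ φ : ℝ → ℝ≥0∞, Measurable φ → ∀ t : ℝ, (∀ x, t ≤ x → ∫⁻ y, φ (x - y) ∂F ≤ φ x) →
          ∀ x, t + N * b ≤ x → ENNReal.ofReal κ' * ∫⁻ s in Icc P Q, φ (x - s) ≤ φ x := by
  induction N with
  | zero =>
    refine ⟨κ, p, q, hκ, by norm_num; linarith, fun F _ hF φ hφ t ht x hx => ?_⟩
    refine (hF (fun s => φ (x - s)) (hφ.comp (measurable_const.sub measurable_id))).trans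
      (ht x (by simpa using hx))
  | succ N ih =>
    obtain ⟨κ', P, Q, hκ', hlen, hih⟩ := ih
    -- Each further step lengthens the interval by `q - p - 2 * η = η`, so its length grows linearly
    -- in `N`. A step descends by at most `b`, which accounts for the margin `N * b` above `t`.
    set η := (q - p) / 3 with hη
    have hη0 : 0 < η := by rw [hη]; linarith
    have hN : η ≤ (N + 1) * η := le_mul_of_one_le_left hη0.le (by
      have : (0 : ℝ) ≤ N := Nat.cast_nonneg N
      linarith)
    refine ⟨κ * κ' * η, p + P + η, q + Q - η, by positivity, ?_, fun F hb hF φ hφ t ht x hx => ?_⟩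
    · push_cast
      linarith
    · push_cast at hx
      have hxt : t ≤ x := by nlinarith [(Nat.cast_nonneg N : (0 : ℝ) ≤ N)]
      have hmψ : Measurable fun z => φ (x - z) := hφ.comp (measurable_const.sub measurable_id)
      have hm : Measurable fun y => ∫⁻ s in Icc P Q, φ (x - (y + s)) :=
        Measurable.lintegral_prod_right' (f := fun z : ℝ × ℝ => φ (x - (z.1 + z.2)))
          (hφ.comp (measurable_const.sub (measurable_fst.add measurable_snd)))
      calc _ = ENNReal.ofReal κ * (ENNReal.ofReal κ' *
            (ENNReal.ofReal η * ∫⁻ r in Icc (p + P + η) (q + Q - η), φ (x - r))) := by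
            rw [ENNReal.ofReal_mul (by positivity), ENNReal.ofReal_mul hκ.le]
            ring
        _ ≤ ENNReal.ofReal κ * (ENNReal.ofReal κ' *
            ∫⁻ y in Icc p q, ∫⁻ s in Icc P Q, φ (x - (y + s))) := by
            gcongr
            exact lintegral_Icc_Icc_ge hmψ (by linarith) (hN.trans hlen)
        _ = ENNReal.ofReal κ *
            ∫⁻ y in Icc p q, ENNReal.ofReal κ' * ∫⁻ s in Icc P Q, φ (x - (y + s)) := by
            rw [lintegral_const_mul _ hm]
        _ ≤ ∫⁻ y, (ENNReal.ofReal κ' * ∫⁻ s in Icc P Q, φ (x - (y + s))) ∂F := hF (fun y => ENNReal.ofReal κ' * ∫⁻ s in Icc P Q, φ (x - (y + s)))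
              (hm.const_mul _)
        _ ≤ ∫⁻ y, φ (x - y) ∂F := by
            refine lintegral_mono_ae ?_
            filter_upwards [hb] with y hy
            have := hih F hb hF φ hφ t ht (x - y) (by linarith)
            simpa only [sub_sub] using this
        _ ≤ φ x := ht x hxt

/-- A bounded harmonic function that is bounded on a window longer than the steps satisfies the same
bounds later on. -/
theorem mem_Icc_of_window {a b : ℝ} (ha : 0 < a) {F : Measure ℝ} [IsProbabilityMeasure F]
    (hF : ∀ᵐ y ∂F, y ∈ Icc a b) {h : ℝ → ℝ} (hm : Measurable h) {C : ℝ} (hC : ∀ x, |h x| ≤ C)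
    {t m M : ℝ} (heq : ∀ x, t ≤ x → h x = ∫ y, h (x - y) ∂F)
    (hw : ∀ x ∈ Icc t (t + b), h x ∈ Icc m M) {x : ℝ} (hx : t ≤ x) : h x ∈ Icc m M := by
  -- Induction on the height: from a point above `t + b` a step lands at least `a` lower but not
  -- below `t`, where the bounds are known; an average of such values satisfies them too.
  have key : ∀ k : ℕ, ∀ x ∈ Icc t (t + b + k * a), h x ∈ Icc m M := by
    intro k
    induction k with
    | zero => simpa using hw
    | succ k ih =>
      intro x hx
      by_cases hxb : x ≤ t + b
      · exact hw x ⟨hx.1, hxb⟩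
      have hint : Integrable (fun y => h (x - y)) F :=
        Integrable.of_bound (hm.comp (measurable_const.sub measurable_id)).aestronglyMeasurable C
          (Eventually.of_forall fun y => hC _)
      have hmem : ∀ᵐ y ∂F, h (x - y) ∈ Icc m M := by
        filter_upwards [hF] with y hy
        have hx2 := hx.2
        push_cast at hx2
        exact ih _ ⟨by linarith [hy.2, not_le.1 hxb], by linarith [hy.1]⟩
      rw [heq x hx.1]
      constructor
      · have := integral_mono_ae (integrable_const m) hint (hmem.mono fun y hy => hy.1)
        simpa using this
      · have := integral_mono_ae hint (integrable_const M) (hmem.mono fun y hy => hy.2)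
        simpa using this
  obtain ⟨k, hk⟩ := exists_nat_gt ((x - t - b) / a)
  rw [div_lt_iff₀ ha] at hk
  exact key k x ⟨hx, by linarith⟩

/-- The oscillation of a bounded harmonic function contracts. -/
theorem exists_contraction {a b κ p q : ℝ} (ha : 0 < a) (hab : a ≤ b) (hκ : 0 < κ) (hpq : p < q) :
    ∃ θ D : ℝ, 0 < θ ∧ θ ≤ 1 ∧ 0 ≤ D ∧ ∀ F : Measure ℝ, IsProbabilityMeasure F →
      (∀ᵐ y ∂F, y ∈ Icc a b) → Minorized κ p q F → ∀ (h : ℝ → ℝ) (C : ℝ), Measurable h →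
      (∀ x, |h x| ≤ C) → ∀ t, (∀ x, t ≤ x → h x = ∫ y, h (x - y) ∂F) →
      ∀ m M, (∀ x, t ≤ x → h x ∈ Icc m M) →
      ∃ m', ∀ x, t + D ≤ x → h x ∈ Icc m' (m' + (1 - θ) * (M - m)) := by
  have hb : 0 < b := ha.trans_le hab
  -- This makes `Q - P ≥ 2 * b`. For all `x` in a window of length `b`, the intervals from `x - Q`
  -- to `x - P` then share a piece of length at least `b`.
  obtain ⟨N, hN⟩ := exists_nat_gt (2 * b / ((q - p) / 3))
  rw [div_lt_iff₀ (by linarith)] at hN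
  obtain ⟨κ', P, Q, hκ', hlen, hsup⟩ := exists_superharmonic_ge (b := b) hb.le hκ hpq N
  have hPQ : 2 * b ≤ Q - P := by nlinarith
  refine ⟨min (κ' * b) 1, b + N * b, lt_min (by positivity) one_pos, min_le_right _ _,
    by positivity, ?_⟩
  intro F hFp hF hmin h C hm hC t heq m M hmM
  have hint : ∀ x, Integrable (fun y => h (x - y)) F := fun x =>
    Integrable.of_bound (hm.comp (measurable_const.sub measurable_id)).aestronglyMeasurable C
      (Eventually.of_forall fun y => hC _)
  have hmM' : m ≤ M := (hmM t le_rfl).1.trans (hmM t le_rfl).2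
  have hlow : ∀ x, t + (b + N * b) ≤ x → ENNReal.ofReal κ' *
      ∫⁻ s in Icc P Q, ENNReal.ofReal (h (x - s) - m) ≤ ENNReal.ofReal (h x - m) := by
    intro x hx
    refine hsup F (hF.mono fun y hy => hy.2) hmin (fun x => ENNReal.ofReal (h x - m))
      (hm.sub_const m).ennreal_ofReal (t + b) (fun x hx => ?_) x (by linarith)
    rw [← ofReal_integral_eq_lintegral_ofReal (f := fun y => h (x - y) - m)
      ((hint x).sub (integrable_const m)) ?_]
    · rw [integral_sub (hint x) (integrable_const m), ← heq x (by linarith)]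
      simp
    · filter_upwards [hF] with y hy
      simpa using (hmM (x - y) (by linarith [hy.2])).1
  have hup : ∀ x, t + (b + N * b) ≤ x → ENNReal.ofReal κ' *
      ∫⁻ s in Icc P Q, ENNReal.ofReal (M - h (x - s)) ≤ ENNReal.ofReal (M - h x) := by
    intro x hx
    refine hsup F (hF.mono fun y hy => hy.2) hmin (fun x => ENNReal.ofReal (M - h x))
      (hm.const_sub M).ennreal_ofReal (t + b) (fun x hx => ?_) x (by linarith)
    rw [← ofReal_integral_eq_lintegral_ofReal (f := fun y => M - h (x - y))
      ((integrable_const M).sub (hint x)) ?_]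
    · rw [integral_sub (integrable_const M) (hint x), ← heq x (by linarith)]
      simp
    · filter_upwards [hF] with y hy
      simpa using (hmM (x - y) (by linarith [hy.2])).2
  set t' := t + (b + N * b) with ht'
  have htt' : t ≤ t' := by rw [ht']; have : 0 ≤ b + N * b := by positivity
                           linarith
  -- the part common to both windows
  have hshift : ∀ (x : ℝ) (f : ℝ → ℝ≥0∞), x ∈ Icc t' (t' + b) →
      ∫⁻ r in Icc (t' + b - Q) (t' - P), f r ≤ ∫⁻ s in Icc P Q, f (x - s) := by
    intro x f hx
    rw [← lintegral_indicator measurableSet_Icc, ← lintegral_indicator measurableSet_Icc,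
      ← lintegral_sub_left_eq_self _ x]
    refine lintegral_mono fun s => ?_
    by_cases hs : x - s ∈ Icc (t' + b - Q) (t' - P)
    · have : s ∈ Icc P Q := ⟨by linarith [hs.2, hx.1], by linarith [hs.1, hx.2]⟩
      simp [hs, this]
    · simp [hs]
  -- The functions `h - m` and `M - h` are nonnegative and harmonic, so `h x - m` and `M - h x'`
  -- dominate multiples of their integrals over the common piece. There the two integrands add up to
  -- `M - m`, so the values at `x` and `x'` cannot be at opposite extremes.
  have hosc : ∀ x ∈ Icc t' (t' + b), ∀ x' ∈ Icc t' (t' + b),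
      κ' * b * (M - m) ≤ (h x - m) + (M - h x') := by
    intro x hx x' hx'
    have hx0 := hmM x (htt'.trans hx.1)
    have hx0' := hmM x' (htt'.trans hx'.1)
    have hmes : Measurable fun r => ENNReal.ofReal (h r - m) := (hm.sub_const m).ennreal_ofReal
    have h1 : ENNReal.ofReal (κ' * b * (M - m)) ≤ ENNReal.ofReal ((h x - m) + (M - h x')) := by
      calc ENNReal.ofReal (κ' * b * (M - m)) = ENNReal.ofReal κ' *
            (ENNReal.ofReal (M - m) * ENNReal.ofReal b) := by
            rw [ENNReal.ofReal_mul (by positivity), ENNReal.ofReal_mul hκ'.le]; ring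
        _ ≤ ENNReal.ofReal κ' *
            ∫⁻ r in Icc (t' + b - Q) (t' - P), ENNReal.ofReal (M - m) := by
            rw [lintegral_const, Measure.restrict_apply_univ, Real.volume_Icc]
            gcongr
            linarith
        _ ≤ ENNReal.ofReal κ' * ∫⁻ r in Icc (t' + b - Q) (t' - P),
            (ENNReal.ofReal (h r - m) + ENNReal.ofReal (M - h r)) := by
            gcongr with r
            refine le_trans (ENNReal.ofReal_le_ofReal ?_) ENNReal.ofReal_add_le
            linarith
        _ = (ENNReal.ofReal κ' * ∫⁻ r in Icc (t' + b - Q) (t' - P), ENNReal.ofReal (h r - m)) +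
            ENNReal.ofReal κ' * ∫⁻ r in Icc (t' + b - Q) (t' - P), ENNReal.ofReal (M - h r) := by
            rw [lintegral_add_left hmes, mul_add]
        _ ≤ ENNReal.ofReal (h x - m) + ENNReal.ofReal (M - h x') := by
            refine add_le_add ?_ ?_
            · exact (mul_le_mul_right (hshift x (fun r => ENNReal.ofReal (h r - m)) hx) _).trans
                (hlow x hx.1)
            · exact (mul_le_mul_right (hshift x' (fun r => ENNReal.ofReal (M - h r)) hx') _).trans
                (hup x' hx'.1)
        _ = _ := (ENNReal.ofReal_add (sub_nonneg.2 hx0.1) (sub_nonneg.2 hx0'.2)).symm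
    exact (ENNReal.ofReal_le_ofReal_iff
      (add_nonneg (sub_nonneg.2 hx0.1) (sub_nonneg.2 hx0'.2))).1 h1
  have hne : (h '' Icc t' (t' + b)).Nonempty := ⟨h t', t', ⟨le_rfl, by linarith⟩, rfl⟩
  have hbdd : BddBelow (h '' Icc t' (t' + b)) := by
    refine ⟨m, ?_⟩
    rintro _ ⟨x, hx, rfl⟩
    exact (hmM x (htt'.trans hx.1)).1
  refine ⟨sInf (h '' Icc t' (t' + b)), fun x hx => ?_⟩
  refine mem_Icc_of_window ha hF hm hC (fun x hx => heq x (htt'.trans hx)) (fun x hx => ?_) hx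
  refine ⟨csInf_le hbdd ⟨x, hx, rfl⟩, ?_⟩
  rw [← sub_le_iff_le_add]
  refine le_csInf hne ?_
  rintro _ ⟨x', hx', rfl⟩
  have h1 := hosc x' hx' x hx
  have h2 : min (κ' * b) 1 * (M - m) ≤ κ' * b * (M - m) :=
    mul_le_mul_of_nonneg_right (min_le_left _ _) (sub_nonneg.2 hmM')
  linarith

/-- Bounded harmonic functions are nearly constant far away, uniformly. -/
theorem exists_nearly_constant {a b κ p q C η : ℝ} (ha : 0 < a) (hab : a ≤ b) (hκ : 0 < κ)
    (hpq : p < q) (hη : 0 < η) :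
    ∃ D : ℝ, 0 ≤ D ∧ ∀ F : Measure ℝ, IsProbabilityMeasure F →
      (∀ᵐ y ∂F, y ∈ Icc a b) → Minorized κ p q F → ∀ h : ℝ → ℝ, Measurable h →
      (∀ x, |h x| ≤ C) → ∀ t, (∀ x, t ≤ x → h x = ∫ y, h (x - y) ∂F) →
      ∀ x x', t + D ≤ x → t + D ≤ x' → |h x - h x'| ≤ η := by
  obtain ⟨θ, D, hθ0, hθ1, hD, hcon⟩ := exists_contraction ha hab hκ hpq
  have hlim : Tendsto (fun k : ℕ => (1 - θ) ^ k * (C - -C)) atTop (𝓝 0) := by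
    have := (tendsto_pow_atTop_nhds_zero_of_lt_one (r := 1 - θ) (by linarith)
      (by linarith)).mul_const (C - -C)
    rwa [zero_mul] at this
  -- The initial oscillation is at most `2 * C`. The number of contractions, and with it `D`,
  -- depends only on the constants and not on `F`.
  obtain ⟨k, hk⟩ := (hlim.eventually (eventually_lt_nhds hη)).exists
  refine ⟨k * D, by positivity, fun F hFp hF hmin h hm hC t heq => ?_⟩
  have key : ∀ k : ℕ, ∃ m, ∀ x, t + k * D ≤ x →
      h x ∈ Icc m (m + (1 - θ) ^ k * (C - -C)) := by
    intro k
    induction k with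
    | zero =>
      refine ⟨-C, fun x _ => ?_⟩
      have := abs_le.1 (hC x)
      exact ⟨this.1, by linarith [this.2]⟩
    | succ k ih =>
      obtain ⟨m, hm'⟩ := ih
      have hkD : 0 ≤ k * D := by positivity
      obtain ⟨m', h'⟩ := hcon F hFp hF hmin h C hm hC (t + k * D)
        (fun x hx => heq x (by linarith)) m _ hm'
      refine ⟨m', fun x hx => ?_⟩
      push_cast at hx
      have := h' x (by linarith)
      rwa [add_sub_cancel_left, ← mul_assoc, ← pow_succ'] at this
  obtain ⟨m, hm'⟩ := key k
  intro x x' hx hx'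
  have h1 := hm' x hx
  have h2 := hm' x' hx'
  rw [abs_le]
  constructor <;> linarith [h1.1, h1.2, h2.1, h2.2]

end AlternatingRenewal

namespace AlternatingRenewal

/-- The expected terminal value after at most `N` steps. -/
noncomputable def crossing (lam : Side → Measure ℝ) (val : Side → ℝ) : ℕ → Side → ℝ → ℝ
  | 0, s, _ => val s
  | N + 1, s, x => ∫ y, (if x ≤ y then val s else crossing lam val N s.flip (x - y)) ∂lam s

variable {lam : Side → Measure ℝ} {val : Side → ℝ}

theorem measurable_step {f : ℝ → ℝ} (hf : Measurable f) (v : ℝ) :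
    Measurable fun z : ℝ × ℝ => if z.1 ≤ z.2 then v else f (z.1 - z.2) :=
  Measurable.ite (measurableSet_le measurable_fst measurable_snd) measurable_const
    (hf.comp (measurable_fst.sub measurable_snd))

theorem measurable_step_right {f : ℝ → ℝ} (hf : Measurable f) (v x : ℝ) :
    Measurable fun y : ℝ => if x ≤ y then v else f (x - y) :=
  (measurable_step hf v).comp measurable_prodMk_left

theorem abs_step_le {f : ℝ → ℝ} {C v : ℝ} (hv : |v| ≤ C) (hf : ∀ x, |f x| ≤ C) (x y : ℝ) :
    |if x ≤ y then v else f (x - y)| ≤ C := by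
  split_ifs
  exacts [hv, hf _]

variable [∀ s, IsProbabilityMeasure (lam s)]

theorem measurable_crossing (N : ℕ) (s : Side) : Measurable (crossing lam val N s) := by
  induction N generalizing s with
  | zero => exact measurable_const
  | succ N ih =>
    exact ((measurable_step (ih s.flip) (val s)).stronglyMeasurable.integral_prod_right'
      (ν := lam s)).measurable

theorem abs_crossing_le {C : ℝ} (hC : ∀ s, |val s| ≤ C) (N : ℕ) (s : Side) (x : ℝ) :
    |crossing lam val N s x| ≤ C := by
  induction N generalizing s x with
  | zero => exact hC s
  | succ N ih =>
    have := norm_integral_le_of_norm_le_const (μ := lam s) (C := C)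
      (f := fun y => if x ≤ y then val s else crossing lam val N s.flip (x - y))
      (Eventually.of_forall fun y => abs_step_le (hC s) (ih s.flip) x y)
    simpa [crossing] using this

/-- Steps are at least `a`, so from a level at most `N * a` the walk has jumped over `0` after `N`
steps. At `x ≤ 0` the next step stops it at once with `val s`, which is the value assigned to `0`
steps. -/
theorem crossing_succ_eq {a : ℝ} (ha : ∀ s, ∀ᵐ y ∂lam s, a ≤ y) (N : ℕ) (s : Side) {x : ℝ}
    (hx : x ≤ N * a) (ha0 : 0 < a) : crossing lam val (N + 1) s x = crossing lam val N s x := by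
  induction N generalizing s x with
  | zero =>
    have h : ∀ᵐ y ∂lam s, (if x ≤ y then val s else crossing lam val 0 s.flip (x - y)) = val s := by
      filter_upwards [ha s] with y hy
      rw [Nat.cast_zero, zero_mul] at hx
      exact if_pos (by linarith)
    calc crossing lam val (0 + 1) s x = ∫ _, val s ∂lam s := integral_congr_ae h
      _ = val s := by simp
  | succ N ih =>
    rw [crossing, crossing]
    refine integral_congr_ae ?_
    filter_upwards [ha s] with y hy
    push_cast at hx
    rw [ih s.flip (by linarith)]

theorem crossing_eq_of_le {a : ℝ} (ha0 : 0 < a) (ha : ∀ s, ∀ᵐ y ∂lam s, a ≤ y) {N M : ℕ}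
    (hNM : N ≤ M) (s : Side) {x : ℝ} (hx : x ≤ N * a) :
    crossing lam val M s x = crossing lam val N s x := by
  induction M, hNM using Nat.le_induction with
  | base => rfl
  | succ M hM ih =>
    rw [crossing_succ_eq ha M s (hx.trans ?_) ha0, ih]
    have : (N : ℝ) ≤ M := by exact_mod_cast hM
    exact mul_le_mul_of_nonneg_right this ha0.le

/-- The probability-weighted terminal value of the alternating walk that goes down by steps with the
laws `lam` and stops when it jumps over `0`. -/
theorem exists_crossing {a C : ℝ} (ha0 : 0 < a) (ha : ∀ s, ∀ᵐ y ∂lam s, a ≤ y)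
    (hC : ∀ s, |val s| ≤ C) :
    ∃ u : Side → ℝ → ℝ, (∀ s, Measurable (u s)) ∧ (∀ s x, |u s x| ≤ C) ∧
      ∀ s x, u s x = ∫ y, (if x ≤ y then val s else u s.flip (x - y)) ∂lam s := by
  have hceil : ∀ x : ℝ, x ≤ ⌈x / a⌉₊ * a := fun x => by
    rw [← div_le_iff₀ ha0]
    exact Nat.le_ceil _
  have hu : ∀ (N : ℕ) s (x : ℝ), x ≤ N * a →
      crossing lam val ⌈x / a⌉₊ s x = crossing lam val N s x := by
    intro N s x hx
    rw [← div_le_iff₀ ha0] at hx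
    exact (crossing_eq_of_le ha0 ha (Nat.ceil_le.2 hx) s (hceil x)).symm
  refine ⟨fun s x => crossing lam val ⌈x / a⌉₊ s x, fun s => ?_, fun s x => abs_crossing_le hC _ s x,
    fun s x => ?_⟩
  -- The number of steps used depends on `x`, but for each `x` the sequence of approximations is
  -- eventually constant.
  · refine measurable_of_tendsto_metrizable (fun N => measurable_crossing (lam := lam) (val := val) N s)
      (tendsto_pi_nhds.2 fun x => tendsto_const_nhds.congr' ?_)
    filter_upwards [eventually_ge_atTop ⌈x / a⌉₊] with N hN
    exact (crossing_eq_of_le ha0 ha hN s (hceil x)).symm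
  · simp only
    rw [hu (⌈x / a⌉₊ + 1) s x ((hceil x).trans (by push_cast; nlinarith)), crossing]
    refine integral_congr_ae ?_
    filter_upwards [ha s] with y hy
    rw [hu ⌈x / a⌉₊ s.flip (x - y) (by linarith [hceil x])]

/-- A conservation law for the renewal equation. -/
theorem sum_integral_eq {a b C : ℝ} (ha0 : 0 < a) (hlam : ∀ s, ∀ᵐ y ∂lam s, y ∈ Icc a b)
    (hC : ∀ s, |val s| ≤ C) {u : Side → ℝ → ℝ} (hm : ∀ s, Measurable (u s))
    (hu : ∀ s x, |u s x| ≤ C)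
    (heq : ∀ s x, u s x = ∫ y, (if x ≤ y then val s else u s.flip (x - y)) ∂lam s)
    {X : ℝ} (hX0 : 0 ≤ X) (hX : b ≤ X) :
    ∑ s, ∫ y, (∫ r in (X - y)..X, u s.flip r) ∂lam s = ∑ s, val s * ∫ y, y ∂lam s := by
  have hint : ∀ s c d, IntervalIntegrable (u s) volume c d := fun s c d =>
    (intervalIntegrable_const (c := C)).mono_fun (hm s).aestronglyMeasurable
      (Eventually.of_forall fun x => by simpa using (hu s x).trans (le_abs_self C))
  have hprim : ∀ s, Continuous fun x => ∫ r in (0 : ℝ)..x, u s r := fun s =>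
    intervalIntegral.continuous_primitive (hint s) 0
  have hb : ∀ s (f : ℝ → ℝ), Continuous f → Integrable f (lam s) := by
    intro s f hf
    obtain ⟨K, hK⟩ := isCompact_Icc.exists_bound_of_continuousOn (s := Icc a b) hf.continuousOn
    exact Integrable.of_bound hf.measurable.aestronglyMeasurable K
      ((hlam s).mono fun y hy => hK y hy)
  have hprim' : ∀ s, Integrable (fun y => ∫ r in (0 : ℝ)..(X - y), u s.flip r) (lam s) := fun s =>
    hb s _ ((hprim s.flip).comp (continuous_const.sub continuous_id))
  -- The renewal equation is integrated over `x` from `0` to `X`. For a step `y`, the part `x ≤ y`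
  -- contributes `val s * y` and the rest is a shifted integral of the other function. After
  -- summation over both sides, only the integrals over the last stretch `X - y..X` survive.
  have h1 : ∀ s, ∫ x in (0 : ℝ)..X, u s x =
      val s * (∫ y, y ∂lam s) + ∫ y, (∫ r in (0 : ℝ)..(X - y), u s.flip r) ∂lam s := by
    intro s
    have hsw : ∫ x in (0 : ℝ)..X, u s x =
        ∫ y, (∫ x in (0 : ℝ)..X, if x ≤ y then val s else u s.flip (x - y)) ∂lam s := by
      rw [← intervalIntegral_integral_swap]
      · exact intervalIntegral.integral_congr fun x _ => heq s x
      · rw [uIoc_of_le hX0]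
        have hfin : IsFiniteMeasure (volume.restrict (Ioc 0 X)) := by infer_instance
        exact Integrable.of_bound (measurable_step (hm s.flip) (val s)).aestronglyMeasurable C
          (Eventually.of_forall fun z => abs_step_le (hC s) (hu s.flip) z.1 z.2)
    have hid : Integrable (fun y => y) (lam s) := hb s _ continuous_id
    rw [hsw, ← integral_const_mul, ← integral_add (hid.const_mul _) (hprim' s)]
    refine integral_congr_ae ?_
    filter_upwards [hlam s] with y hy
    have hy0 : 0 ≤ y := ha0.le.trans hy.1
    have hyX : y ≤ X := hy.2.trans hX
    have i1 : IntervalIntegrable (fun x => if x ≤ y then val s else u s.flip (x - y)) volume 0 y :=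
      (intervalIntegrable_const (c := C)).mono_fun
        ((measurable_step (hm s.flip) (val s)).comp measurable_prodMk_right).aestronglyMeasurable
        (Eventually.of_forall fun x => by
          simpa using (abs_step_le (hC s) (hu s.flip) x y).trans (le_abs_self C))
    have i2 : IntervalIntegrable (fun x => if x ≤ y then val s else u s.flip (x - y)) volume y X :=
      (intervalIntegrable_const (c := C)).mono_fun
        ((measurable_step (hm s.flip) (val s)).comp measurable_prodMk_right).aestronglyMeasurable
        (Eventually.of_forall fun x => by
          simpa using (abs_step_le (hC s) (hu s.flip) x y).trans (le_abs_self C))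
    rw [← intervalIntegral.integral_add_adjacent_intervals i1 i2]
    congr 1
    · rw [intervalIntegral.integral_congr (g := fun _ => val s)]
      · simp [mul_comm]
      · intro x hx
        rw [uIcc_of_le hy0] at hx
        exact if_pos hx.2
    · rw [intervalIntegral.integral_congr_ae' (g := fun x => u s.flip (x - y)),
        intervalIntegral.integral_comp_sub_right (u s.flip), sub_self]
      · exact Eventually.of_forall fun x hx => if_neg (not_le.2 hx.1)
      · exact Eventually.of_forall fun x hx => absurd (hx.1.trans_le hx.2) (not_lt.2 hyX)
  have h2 : ∀ s, ∫ y, (∫ r in (X - y)..X, u s.flip r) ∂lam s =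
      (∫ r in (0 : ℝ)..X, u s.flip r) - ∫ y, (∫ r in (0 : ℝ)..(X - y), u s.flip r) ∂lam s := by
    intro s
    have : ∀ y, ∫ r in (X - y)..X, u s.flip r =
        (∫ r in (0 : ℝ)..X, u s.flip r) - ∫ r in (0 : ℝ)..(X - y), u s.flip r := fun y =>
      (intervalIntegral.integral_interval_sub_left (hint _ _ _) (hint _ _ _)).symm
    simp only [this]
    rw [integral_sub (integrable_const _) (hprim' s)]
    simp
  have hsum : ∀ f : Side → ℝ, ∑ s, f s = f .left + f .right := fun f => by
    rw [show (Finset.univ : Finset Side) = {.left, .right} from rfl]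
    simp
  have hl := h1 .left
  have hr := h1 .right
  rw [hsum, hsum, h2, h2]
  simp only [Side.flip] at hl hr ⊢
  linarith

/-- The renewal theorem: far away, the expected terminal value is nearly the average of the terminal
values with weights the mean step lengths; this is uniform in the laws of the steps. -/
theorem exists_renewal {a b κ C η : ℝ} {p q : Side → ℝ} (ha : 0 < a) (hab : a ≤ b) (hκ : 0 < κ)
    (hpq : ∀ s, p s < q s) (hη : 0 < η) :
    ∃ D : ℝ, ∀ lam : Side → Measure ℝ, (∀ s, IsProbabilityMeasure (lam s)) →
      (∀ s, ∀ᵐ y ∂lam s, y ∈ Icc a b) → (∀ s, Minorized κ (p s) (q s) (lam s)) →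
      ∀ val : Side → ℝ, (∀ s, |val s| ≤ C) →
      ∃ u : Side → ℝ → ℝ, (∀ s, Measurable (u s)) ∧ (∀ s x, |u s x| ≤ C) ∧
        (∀ s x, u s x = ∫ y, (if x ≤ y then val s else u s.flip (x - y)) ∂lam s) ∧
        ∀ s x, D ≤ x → |u s x - (val .left * (∫ y, y ∂lam .left) +
          val .right * (∫ y, y ∂lam .right)) /
          ((∫ y, y ∂lam .left) + (∫ y, y ∂lam .right))| ≤ η := by
  -- A third of the shorter interval: no longer than either of them, and the trimmed sum interval
  -- still has positive length.
  set ρ := min (q .left - p .left) (q .right - p .right) / 3 with hρ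
  have hρ0 : 0 < ρ := div_pos (lt_min (sub_pos.2 (hpq _)) (sub_pos.2 (hpq _))) (by norm_num)
  have hρl : 3 * ρ ≤ q .left - p .left := by
    rw [hρ]; linarith [min_le_left (q .left - p .left) (q .right - p .right)]
  have hρr : 3 * ρ ≤ q .right - p .right := by
    rw [hρ]; linarith [min_le_right (q .left - p .left) (q .right - p .right)]
  have hb : 0 < b := ha.trans_le hab
  obtain ⟨D, hD0, hD⟩ := exists_nearly_constant (a := 2 * a) (b := 2 * b) (κ := κ * κ * ρ)
    (p := p .left + p .right + ρ) (q := q .left + q .right - ρ) (C := C) (η := η / 2)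
    (by positivity) (by linarith) (by positivity) (by linarith) (by positivity)
  refine ⟨3 * b + D + b, fun lam hprob hlam hmin val hval => ?_⟩
  obtain ⟨u, hm, hu, heq⟩ := exists_crossing ha (fun s => (hlam s).mono fun y hy => hy.1) hval
  refine ⟨u, hm, hu, heq, ?_⟩
  have hstep : ∀ s x, b < x → u s x = ∫ y, u s.flip (x - y) ∂lam s := by
    intro s x hx
    rw [heq s x]
    refine integral_congr_ae ?_
    filter_upwards [hlam s] with y hy
    exact if_neg (not_le.2 (hy.2.trans_lt hx))
  have hsupp : ∀ᵐ y ∂(lam .left ∗ lam .right), y ∈ Icc (2 * a) (2 * b) := by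
    refine (ae_map_iff (p := fun y => y ∈ Icc (2 * a) (2 * b))
      (measurable_fst.add measurable_snd).aemeasurable measurableSet_Icc).2 ?_
    have h1 : ∀ᵐ z ∂(lam .left).prod (lam .right), z.1 ∈ Icc a b :=
      Measure.quasiMeasurePreserving_fst.ae (hlam .left)
    have h2 : ∀ᵐ z ∂(lam .left).prod (lam .right), z.2 ∈ Icc a b :=
      Measure.quasiMeasurePreserving_snd.ae (hlam .right)
    filter_upwards [h1, h2] with z hz1 hz2
    show z.1 + z.2 ∈ Icc (2 * a) (2 * b)
    exact ⟨by linarith [hz1.1, hz2.1], by linarith [hz1.2, hz2.2]⟩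
  -- From a level of at least `3 * b` two steps cannot reach `0`, so no terminal value enters, and
  -- `u .left` is harmonic for the law of a pair of steps.
  have hharm : ∀ x, 3 * b ≤ x → u .left x = ∫ y, u .left (x - y) ∂(lam .left ∗ lam .right) := by
    intro x hx
    have hint : Integrable (fun y => u .left (x - y)) (lam .left ∗ lam .right) :=
      Integrable.of_bound
        ((hm .left).comp (measurable_const.sub measurable_id)).aestronglyMeasurable C
        (Eventually.of_forall fun y => hu _ _)
    rw [integral_conv hint, hstep .left x (by linarith)]
    refine integral_congr_ae ?_
    filter_upwards [hlam .left] with y hy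
    rw [hstep _ _ (by linarith [hy.2])]
    simp only [Side.flip, sub_sub]
  have hnear := hD (lam .left ∗ lam .right) inferInstance hsupp
    ((hmin .left).conv (hmin .right) hκ.le hκ.le (by linarith) (by linarith)) (u .left) (hm .left)
    (hu .left) (3 * b) hharm
  set K := u .left (3 * b + D) with hK
  have hclose : ∀ s x, 3 * b + D + b ≤ x → |u s x - K| ≤ η / 2 := by
    intro s x hx
    cases s
    · exact hnear x _ (by linarith) le_rfl
    · have hint : Integrable (fun y => u .left (x - y)) (lam .right) := Integrable.of_bound
        ((hm .left).comp (measurable_const.sub measurable_id)).aestronglyMeasurable C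
        (Eventually.of_forall fun y => hu _ _)
      have h1 : u .right x - K = ∫ y, (u .left (x - y) - K) ∂lam .right := by
        rw [integral_sub hint (integrable_const K), hstep .right x (by linarith)]
        simp [Side.flip]
      rw [h1]
      have := norm_integral_le_of_norm_le_const (μ := lam .right) (C := η / 2)
        (f := fun y => u .left (x - y) - K) (by
          filter_upwards [hlam .right] with y hy
          exact hnear (x - y) _ (by linarith [hy.2]) le_rfl)
      simpa using this
  have hint : ∀ s, Integrable (fun y => y) (lam s) := fun s =>
    Integrable.of_bound measurable_id.aestronglyMeasurable b ((hlam s).mono fun y hy => by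
      rw [Real.norm_eq_abs, abs_of_nonneg (ha.le.trans hy.1)]
      exact hy.2)
  have hE : ∀ s, 0 < ∫ y, y ∂lam s := fun s => by
    have := integral_mono_ae (integrable_const a) (hint s) ((hlam s).mono fun y hy => hy.1)
    simp only [integral_const, probReal_univ, smul_eq_mul, one_mul] at this
    linarith
  -- The constant `K` is still unknown. The conservation law is applied at a level so high that the
  -- whole stretch `X - y..X` lies where both functions are within `η / 2` of `K`; this makes `K`
  -- nearly the weighted mean of the terminal values.
  have hcons := sum_integral_eq ha hlam hval hm hu heq (X := 3 * b + D + b + b) (by linarith)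
    (by linarith)
  have hdiff : ∀ s, |(∫ y, (∫ r in (3 * b + D + b + b - y)..(3 * b + D + b + b), u s.flip r) ∂lam s) -
      K * ∫ y, y ∂lam s| ≤ η / 2 * ∫ y, y ∂lam s := by
    intro s
    have hii : ∀ c d, IntervalIntegrable (u s.flip) volume c d := fun c d =>
      (intervalIntegrable_const (c := C)).mono_fun (hm _).aestronglyMeasurable
        (Eventually.of_forall fun x => by simpa using (hu s.flip x).trans (le_abs_self C))
    have hcont : Continuous fun y => ∫ r in (3 * b + D + b + b - y)..(3 * b + D + b + b),
        u s.flip r := by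
      have := (intervalIntegral.continuous_primitive hii (3 * b + D + b + b)).comp
        (continuous_const.sub continuous_id : Continuous fun y => 3 * b + D + b + b - y)
      refine this.neg.congr fun y => ?_
      exact (intervalIntegral.integral_symm _ _).symm
    have hin : Integrable (fun y => ∫ r in (3 * b + D + b + b - y)..(3 * b + D + b + b),
        u s.flip r) (lam s) := by
      obtain ⟨K', hK'⟩ := isCompact_Icc.exists_bound_of_continuousOn (s := Icc a b) hcont.continuousOn
      exact Integrable.of_bound hcont.measurable.aestronglyMeasurable K'
        ((hlam s).mono fun y hy => hK' y hy)
    rw [← integral_const_mul, ← integral_sub hin ((hint s).const_mul K), ← integral_const_mul]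
    rw [← Real.norm_eq_abs]
    refine norm_integral_le_of_norm_le ((hint s).const_mul _) ?_
    filter_upwards [hlam s] with y hy
    have hy0 : 0 ≤ y := ha.le.trans hy.1
    have e : (∫ r in (3 * b + D + b + b - y)..(3 * b + D + b + b), u s.flip r) - K * y =
        ∫ r in (3 * b + D + b + b - y)..(3 * b + D + b + b), (u s.flip r - K) := by
      rw [intervalIntegral.integral_sub (hii _ _) intervalIntegrable_const]
      simp [mul_comm]
    rw [e]
    have := intervalIntegral.norm_integral_le_of_norm_le_const (C := η / 2)
      (f := fun r => u s.flip r - K) (a := 3 * b + D + b + b - y) (b := 3 * b + D + b + b)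
      (fun r hr => by
        rw [uIoc_of_le (by linarith)] at hr
        exact hclose _ _ (by linarith [hr.1, hy.2]))
    simpa [abs_of_nonneg hy0] using this
  intro s x hx
  have hEl := hE .left
  have hEr := hE .right
  have hl := hdiff .left
  have hr := hdiff .right
  rw [show (Finset.univ : Finset Side) = {.left, .right} from rfl,
    Finset.sum_pair (by simp), Finset.sum_pair (by simp)] at hcons
  have hratio : |K - (val .left * (∫ y, y ∂lam .left) + val .right * (∫ y, y ∂lam .right)) /
      ((∫ y, y ∂lam .left) + (∫ y, y ∂lam .right))| ≤ η / 2 := by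
    rw [← hcons]
    have hpos : 0 < (∫ y, y ∂lam .left) + ∫ y, y ∂lam .right := by linarith
    rw [abs_le] at hl hr ⊢
    constructor
    · rw [neg_le_sub_iff_le_add, div_le_iff₀ hpos]
      linarith [hl.2, hr.2]
    · rw [sub_le_iff_le_add, ← sub_le_iff_le_add', le_div_iff₀ hpos]
      linarith [hl.1, hr.1]
  have := abs_sub_le (u s x) K ((val .left * (∫ y, y ∂lam .left) +
    val .right * (∫ y, y ∂lam .right)) / ((∫ y, y ∂lam .left) + (∫ y, y ∂lam .right)))
  linarith [hclose s x hx]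

end AlternatingRenewal

/-! ### Measurability of the motion -/

/-- Needed because the well, the heading and the number of the collision, which select the random
variable used next, are themselves random. -/
theorem measurable_of_countable_index {Ω ι β : Type*} [MeasurableSpace Ω] [MeasurableSpace β]
    [Countable ι] [MeasurableSpace ι] [MeasurableSingletonClass ι] {Φ : ι → Ω → β}
    (hΦ : ∀ i, Measurable (Φ i)) {I : Ω → ι} (hI : Measurable I) : Measurable fun ω => Φ (I ω) ω :=
  (measurable_from_prod_countable_right (f := fun p : ι × Ω => Φ p.1 p.2) hΦ).comp
    (hI.prodMk measurable_id)

namespace WallSystem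

variable {n : ℕ} {S : WallSystem n}

instance : MeasurableSpace S.State :=
  MeasurableSpace.comap (fun x => (x.cell, x.pos, x.speed, x.heading, x.time, x.hits)) inferInstance

namespace State

section

variable {Ω : Type*} [MeasurableSpace Ω]

theorem measurable_of {f : Ω → S.State} (h1 : Measurable fun ω => (f ω).cell)
    (h2 : Measurable fun ω => (f ω).pos) (h3 : Measurable fun ω => (f ω).speed)
    (h4 : Measurable fun ω => (f ω).heading) (h5 : Measurable fun ω => (f ω).time)
    (h6 : Measurable fun ω => (f ω).hits) : Measurable f :=
  measurable_comap_iff.2 (h1.prodMk (h2.prodMk (h3.prodMk (h4.prodMk (h5.prodMk h6)))))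

end

theorem measurable_cell : Measurable fun x : S.State => x.cell :=
  measurable_fst.comp (comap_measurable _)

theorem measurable_pos : Measurable fun x : S.State => x.pos :=
  measurable_snd.fst.comp (comap_measurable _)

theorem measurable_speed : Measurable fun x : S.State => x.speed :=
  measurable_snd.snd.fst.comp (comap_measurable _)

theorem measurable_heading : Measurable fun x : S.State => x.heading :=
  measurable_snd.snd.snd.fst.comp (comap_measurable _)

theorem measurable_time : Measurable fun x : S.State => x.time :=
  measurable_snd.snd.snd.snd.fst.comp (comap_measurable _)

theorem measurable_hits : Measurable fun x : S.State => x.hits :=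
  measurable_snd.snd.snd.snd.snd.comp (comap_measurable _)

theorem measurable_well : Measurable fun x : S.State => x.well :=
  measurable_of_countable_index (Φ := fun j (x : S.State) => S.wellAt j x.speed)
    (fun j => (measurable_wellAt S j).comp measurable_speed) measurable_cell

theorem measurable_next :
    Measurable fun z : (S.Well → Side → ℕ → ℝ) × S.State => State.next z.1 z.2 := by
  have hI : Measurable fun z : (S.Well → Side → ℕ → ℝ) × S.State => (z.2.well, z.2.heading) :=
    (measurable_well.comp measurable_snd).prodMk (measurable_heading.comp measurable_snd)
  have hhits : ∀ i, Measurable fun z : (S.Well → Side → ℕ → ℝ) × S.State => z.2.hits i := fun i =>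
    (measurable_pi_apply i).comp (measurable_hits.comp measurable_snd)
  have hK : Measurable fun z : (S.Well → Side → ℕ → ℝ) × S.State =>
      z.2.hits (z.2.well, z.2.heading) :=
    measurable_of_countable_index (Φ := fun i (z : (S.Well → Side → ℕ → ℝ) × S.State) => z.2.hits i)
      hhits hI
  have hwall : Measurable fun z : (S.Well → Side → ℕ → ℝ) × S.State =>
      S.pos (z.2.well.wall z.2.heading) :=
    (measurable_of_countable fun p : S.Well × Side => S.pos (p.1.wall p.2)).comp hI
  refine measurable_of ?_ ?_ ?_ ?_ ?_ ?_
  · exact (measurable_of_countable fun p : S.Well × Side => p.1.cellAt p.2).comp hI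
  · exact hwall
  · refine (measurable_speed.comp measurable_snd).mul (measurable_of_countable_index
      (Φ := fun (p : (S.Well × Side) × ℕ) (z : (S.Well → Side → ℕ → ℝ) × S.State) =>
        z.1 p.1.1 p.1.2 p.2) (fun p => ?_) (hI.prodMk hK))
    exact (measurable_pi_apply p.2).comp ((measurable_pi_apply p.1.2).comp
      ((measurable_pi_apply p.1.1).comp measurable_fst))
  · exact (measurable_of_countable Side.flip).comp (measurable_heading.comp measurable_snd)
  · exact (measurable_time.comp measurable_snd).add
      ((hwall.sub (measurable_pos.comp measurable_snd)).abs.div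
        (measurable_speed.comp measurable_snd))
  · refine measurable_pi_iff.2 fun p => ?_
    refine measurable_of_countable_index (Φ := fun i (z : (S.Well → Side → ℕ → ℝ) × S.State) =>
      Function.update z.2.hits i (z.2.hits i + 1) p) (fun i => ?_) hI
    by_cases h : p = i
    · subst h
      simp only [Function.update_self]
      exact (measurable_of_countable fun k : ℕ => k + 1).comp (hhits p)
    · simp only [Function.update_of_ne h]
      exact hhits p

end State

theorem measurable_orbit (M : ℕ) :
    Measurable fun z : (S.Well → Side → ℕ → ℝ) × S.State => orbit z.1 z.2 M := by
  induction M with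
  | zero => exact measurable_snd
  | succ M ih =>
    have h := State.measurable_next.comp (measurable_fst.prodMk ih)
    have e : (fun z : (S.Well → Side → ℕ → ℝ) × S.State => orbit z.1 z.2 (M + 1)) =
        (fun z => State.next z.1 z.2) ∘ fun z => (z.1, orbit z.1 z.2 M) := by
      funext z
      exact orbit_succ z.1 z.2 M
    rw [e]
    exact h

section

variable {Ω : Type*} [MeasurableSpace Ω] {R : Ω → S.Well → Side → ℕ → ℝ} {X : Ω → S.State}

theorem measurable_orbit_comp (hR : Measurable R) (hX : Measurable X) (M : ℕ) :
    Measurable fun ω => orbit (R ω) (X ω) M := by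
  have h := (measurable_orbit (S := S) M).comp (hR.prodMk hX)
  exact h

theorem measurable_next_const {f : Ω → ℝ} (hf : Measurable f) (x : S.State) :
    Measurable fun ω => State.next (fun _ _ _ => f ω) x := by
  have hR : Measurable fun ω => (fun (_ : S.Well) (_ : Side) (_ : ℕ) => f ω) :=
    measurable_pi_iff.2 fun _ => measurable_pi_iff.2 fun _ => measurable_pi_iff.2 fun _ => hf
  have h := State.measurable_next.comp (hR.prodMk (measurable_const (a := x)))
  exact h

end

/-- The motion does not depend on the restitution coefficients of earlier collisions. -/
theorem orbit_congr {r r' : S.Well → Side → ℕ → ℝ} (M : ℕ) {x : S.State}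
    (h : ∀ w s k, x.hits (w, s) ≤ k → r w s k = r' w s k) : orbit r x M = orbit r' x M := by
  induction M generalizing x with
  | zero => rfl
  | succ M ih =>
    have hn : State.next r x = State.next r' x := by
      simp only [State.next, h _ _ _ le_rfl]
    show orbit r (State.next r x) M = orbit r' (State.next r' x) M
    rw [← hn]
    refine ih fun w s k hk => h w s k (le_trans ?_ hk)
    rw [State.next_hits]
    by_cases e : (w, s) = (x.well, x.heading)
    · rw [e, Function.update_self]
      exact Nat.le_succ _
    · rw [Function.update_of_ne e]

section

variable {Ω : Type*} [MeasurableSpace Ω] {P : Measure Ω} [IsProbabilityMeasure P]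
  {r : S.Well → Side → ℕ → Ω → ℝ}

/-- The Markov property at the first collision. -/
theorem integral_orbit_succ (hr : ∀ w s k, Measurable (r w s k))
    (hind : iIndepFun (fun i : S.Well × Side × ℕ => r i.1 i.2.1 i.2.2) P) {G : S.State → ℝ}
    (hG : Measurable G) {C : ℝ} (hC : ∀ x, |G x| ≤ C) (x : S.State) (M : ℕ) :
    ∫ ω, G (orbit (fun w s k => r w s k ω) x (M + 1)) ∂P =
      ∫ ρ, (∫ ω, G (orbit (fun w s k => r w s k ω) (State.next (fun _ _ _ => ρ) x) M) ∂P)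
        ∂(P.map (r x.well x.heading (x.hits (x.well, x.heading)))) := by
  classical
  set i₀ : S.Well × Side × ℕ := (x.well, x.heading, x.hits (x.well, x.heading)) with hi₀
  -- All coefficients except the one used at the first collision, which is replaced by `0`. The
  -- count of that wall then increases, so this coefficient is never used again; the later motion is
  -- a function of `R`, which is independent of it.
  set R : Ω → S.Well → Side → ℕ → ℝ := fun ω w s k => if (w, s, k) = i₀ then 0 else r w s k ω with hR
  have hRm : Measurable R := by
    refine measurable_pi_iff.2 fun w => measurable_pi_iff.2 fun s => measurable_pi_iff.2 fun k => ?_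
    by_cases h : (w, s, k) = i₀
    · simpa only [hR, if_pos h] using measurable_const
    · simpa only [hR, if_neg h] using hr w s k
  have hX : Measurable (r i₀.1 i₀.2.1 i₀.2.2) := hr _ _ _
  have hindep : IndepFun (r i₀.1 i₀.2.1 i₀.2.2) R P := by
    have h := indep_iSup_of_disjoint (μ := P)
      (m := fun i : S.Well × Side × ℕ => MeasurableSpace.comap (r i.1 i.2.1 i.2.2) inferInstance)
      (fun i => (hr i.1 i.2.1 i.2.2).comap_le) hind
      (disjoint_compl_right (a := ({i₀} : Set (S.Well × Side × ℕ))))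
    refine (IndepFun_iff_Indep _ _ _).2 (indep_of_indep_of_le_left
      (indep_of_indep_of_le_right h ?_) ?_)
    · refine Measurable.comap_le (m₁ := ⨆ i ∈ ({i₀} : Set (S.Well × Side × ℕ))ᶜ,
        MeasurableSpace.comap (r i.1 i.2.1 i.2.2) inferInstance) ?_
      refine @measurable_pi_iff _ _ _ (_) _ _ |>.2 fun w => @measurable_pi_iff _ _ _ (_) _ _ |>.2
        fun s => @measurable_pi_iff _ _ _ (_) _ _ |>.2 fun k => ?_
      by_cases h : (w, s, k) = i₀
      · simp only [hR, if_pos h]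
        exact measurable_const
      · simp only [hR, if_neg h]
        have hle := le_iSup₂ (f := fun (i : S.Well × Side × ℕ)
          (_ : i ∈ ({i₀} : Set (S.Well × Side × ℕ))ᶜ) =>
            MeasurableSpace.comap (r i.1 i.2.1 i.2.2) inferInstance) (w, s, k) h
        exact (comap_measurable (r w s k)).mono hle le_rfl
    · exact le_iSup₂ (f := fun (i : S.Well × Side × ℕ)
        (_ : i ∈ ({i₀} : Set (S.Well × Side × ℕ))) =>
          MeasurableSpace.comap (r i.1 i.2.1 i.2.2) inferInstance) i₀ rfl
  have horb : ∀ ω ρ, orbit (fun w s k => r w s k ω) (State.next (fun _ _ _ => ρ) x) M =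
      orbit (R ω) (State.next (fun _ _ _ => ρ) x) M := by
    intro ω ρ
    refine orbit_congr M fun w s k hk => (if_neg fun e => ?_).symm
    simp only [hi₀, Prod.mk.injEq] at e
    obtain ⟨rfl, rfl, rfl⟩ := e
    rw [State.next_hits, Function.update_self] at hk
    omega
  have hH : Measurable fun z : ℝ × (S.Well → Side → ℕ → ℝ) =>
      G (orbit z.2 (State.next (fun _ _ _ => z.1) x) M) := by
    have h := measurable_orbit_comp (S := S) measurable_snd (measurable_next_const
      (measurable_fst (α := ℝ) (β := S.Well → Side → ℕ → ℝ)) x) M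
    exact hG.comp h
  have hfirst : ∀ ω, orbit (fun w s k => r w s k ω) x (M + 1) =
      orbit (R ω) (State.next (fun _ _ _ => r i₀.1 i₀.2.1 i₀.2.2 ω) x) M := fun ω => by
    rw [← horb]
    rfl
  simp only [hfirst, horb]
  have hprod := (indepFun_iff_map_prod_eq_prod_map_map hX.aemeasurable hRm.aemeasurable).1 hindep
  have hpX : IsProbabilityMeasure (P.map (r i₀.1 i₀.2.1 i₀.2.2)) :=
    Measure.isProbabilityMeasure_map hX.aemeasurable
  have hpR : IsProbabilityMeasure (P.map R) := Measure.isProbabilityMeasure_map hRm.aemeasurable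
  calc _ = ∫ z, G (orbit z.2 (State.next (fun _ _ _ => z.1) x) M)
        ∂(P.map fun ω => (r i₀.1 i₀.2.1 i₀.2.2 ω, R ω)) :=
        (integral_map (hX.prodMk hRm).aemeasurable hH.aestronglyMeasurable).symm
    _ = ∫ ρ, (∫ R', G (orbit R' (State.next (fun _ _ _ => ρ) x) M) ∂(P.map R))
        ∂(P.map (r i₀.1 i₀.2.1 i₀.2.2)) := by
        rw [hprod, integral_prod]
        exact Integrable.of_bound hH.aestronglyMeasurable C (Eventually.of_forall fun z => hC _)
    _ = _ := by
        refine integral_congr_ae (Eventually.of_forall fun ρ => ?_)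
        exact integral_map hRm.aemeasurable
          (hH.comp measurable_prodMk_left).aestronglyMeasurable

/-- A function that does not increase in the mean at a single collision does not increase in the mean
along the motion. -/
theorem integral_orbit_le (hr : ∀ w s k, Measurable (r w s k))
    (hind : iIndepFun (fun i : S.Well × Side × ℕ => r i.1 i.2.1 i.2.2) P) {G : S.State → ℝ}
    (hG : Measurable G) {C : ℝ} (hC : ∀ x, |G x| ≤ C) {A : S.State → Prop}
    (hA : ∀ x, A x → ∀ k, ∀ᵐ ρ ∂(P.map (r x.well x.heading k)), A (State.next (fun _ _ _ => ρ) x))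
    (hstep : ∀ x, A x → ∀ k, ∫ ρ, G (State.next (fun _ _ _ => ρ) x)
      ∂(P.map (r x.well x.heading k)) ≤ G x) (M : ℕ) {x : S.State} (hx : A x) :
    ∫ ω, G (orbit (fun w s k => r w s k ω) x M) ∂P ≤ G x := by
  induction M generalizing x with
  | zero => simp [orbit_zero]
  | succ M ih =>
    rw [integral_orbit_succ hr hind hG hC]
    refine le_trans (integral_mono_ae ?_ ?_ ?_) (hstep x hx (x.hits (x.well, x.heading)))
    · have : IsProbabilityMeasure (P.map (r x.well x.heading (x.hits (x.well, x.heading)))) :=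
        Measure.isProbabilityMeasure_map (hr _ _ _).aemeasurable
      refine Integrable.of_bound (C := C) ?_ (Eventually.of_forall fun ρ => ?_)
      · refine (StronglyMeasurable.integral_prod_right' (ν := P) (f := fun z : ℝ × Ω =>
          G (orbit (fun w s k => r w s k z.2) (State.next (fun _ _ _ => z.1) x) M))
            (Measurable.stronglyMeasurable ?_)).aestronglyMeasurable
        have hR : Measurable fun (z : ℝ × Ω) w s k => r w s k z.2 :=
          measurable_pi_iff.2 fun _ => measurable_pi_iff.2 fun _ => measurable_pi_iff.2 fun _ =>
            (hr _ _ _).comp measurable_snd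
        have h := measurable_orbit_comp hR (measurable_next_const
          (measurable_fst (α := ℝ) (β := Ω)) x) M
        exact hG.comp h
      · have := norm_integral_le_of_norm_le_const (μ := P) (C := C)
          (f := fun ω => G (orbit (fun w s k => r w s k ω) (State.next (fun _ _ _ => ρ) x) M))
          (Eventually.of_forall fun ω => hC _)
        simpa using this
    · have : IsProbabilityMeasure (P.map (r x.well x.heading (x.hits (x.well, x.heading)))) :=
        Measure.isProbabilityMeasure_map (hr _ _ _).aemeasurable
      refine Integrable.of_bound (C := C) (Measurable.aestronglyMeasurable ?_)
        (Eventually.of_forall fun ρ => hC _)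
      exact hG.comp (measurable_next_const measurable_id x)
    · filter_upwards [hA x hx (x.hits (x.well, x.heading))] with ρ hρ
      exact ih hρ

end

end WallSystem

/-! ### Random paths -/

/-- In a separable space every open set is a countable union of balls of rational radius with
centres in a dense set. -/
theorem measurable_of_measurable_dist {Ω X : Type*} [MeasurableSpace Ω] [PseudoMetricSpace X]
    [TopologicalSpace.SeparableSpace X] [MeasurableSpace X] [BorelSpace X] {f : Ω → X}
    (h : ∀ x, Measurable fun ω => dist (f ω) x) : Measurable f := by
  refine measurable_of_isOpen fun U hU => ?_
  obtain ⟨D, hDc, hD⟩ := TopologicalSpace.exists_countable_dense X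
  have hU' : U = ⋃ x ∈ D, ⋃ q ∈ {q : ℚ | Metric.ball x (q : ℝ) ⊆ U}, Metric.ball x (q : ℝ) := by
    refine Subset.antisymm (fun y hy => ?_) (iUnion₂_subset fun x _ => iUnion₂_subset fun q hq => hq)
    obtain ⟨ρ, hρ, hb⟩ := Metric.isOpen_iff.1 hU y hy
    obtain ⟨x, hxD, hx⟩ := hD.exists_dist_lt y (half_pos hρ)
    obtain ⟨q, hq1, hq2⟩ := exists_rat_btwn hx
    refine mem_iUnion₂.2 ⟨x, hxD, mem_iUnion₂.2 ⟨q, fun z hz => hb ?_, hq1⟩⟩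
    rw [Metric.mem_ball] at hz ⊢
    have := dist_triangle z x y
    rw [dist_comm x y] at this
    linarith
  rw [hU', preimage_iUnion₂]
  refine MeasurableSet.biUnion hDc fun x _ => ?_
  rw [preimage_iUnion₂]
  exact MeasurableSet.biUnion (to_countable _) fun q _ => measurableSet_lt (h x) measurable_const

/-- By continuity, the bound for the uniform distance need only be tested at the times of a
countable dense set. -/
theorem ContinuousMap.measurable_of_measurable_dist_apply {Ω K Y : Type*} [MeasurableSpace Ω]
    [TopologicalSpace K] [CompactSpace K] [TopologicalSpace.SeparableSpace K] [PseudoMetricSpace Y]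
    [TopologicalSpace.SeparableSpace C(K, Y)] [MeasurableSpace C(K, Y)] [BorelSpace C(K, Y)]
    {f : Ω → C(K, Y)} (h : ∀ t y, Measurable fun ω => dist (f ω t) y) : Measurable f := by
  refine measurable_of_measurable_dist fun g => measurable_of_Iic fun c => ?_
  obtain ⟨D, hDc, hD⟩ := TopologicalSpace.exists_countable_dense K
  rcases lt_or_ge c 0 with hc | hc
  · convert MeasurableSet.empty
    ext ω
    simp only [mem_preimage, mem_Iic, mem_empty_iff_false, iff_false, not_le]
    exact hc.trans_le dist_nonneg
  · have : (fun ω => dist (f ω) g) ⁻¹' Iic c = ⋂ t ∈ D, {ω | dist (f ω t) (g t) ≤ c} := by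
      ext ω
      simp only [mem_preimage, mem_Iic, mem_iInter, mem_ofPred_eq, ContinuousMap.dist_le hc]
      refine ⟨fun h t _ => h t, fun h t => ?_⟩
      have hcl : IsClosed {t | dist (f ω t) (g t) ≤ c} :=
        isClosed_le ((f ω).continuous.dist g.continuous) continuous_const
      exact hcl.closure_subset_iff.2 (fun t ht => h t ht) (hD t)
    rw [this]
    exact MeasurableSet.biInter hDc fun t _ => measurableSet_le (h t _) measurable_const

theorem measurable_linearInterpolation {Ω : Type*} [MeasurableSpace Ω] {τ e : Ω → ℕ → ℝ}
    (hτ : ∀ m, Measurable fun ω => τ ω m) (he : ∀ m, Measurable fun ω => e ω m) (t : ℝ) :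
    Measurable fun ω => linearInterpolation (τ ω) (e ω) t := by
  classical
  -- The second alternative makes `Nat.find` return `0` if no time exceeds `t`, in accordance with
  -- `sInf ∅ = 0`.
  have hex : ∀ ω, ∃ m, t < τ ω (m + 1) ∨ ∀ m', ¬ t < τ ω (m' + 1) := fun ω => by
    by_cases h : ∃ m, t < τ ω (m + 1)
    · exact h.imp fun m hm => Or.inl hm
    · exact ⟨0, Or.inr (not_exists.1 h)⟩
  have hlt : ∀ m, MeasurableSet {ω | t < τ ω (m + 1)} := fun m =>
    measurableSet_lt measurable_const (hτ (m + 1))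
  have hI : Measurable fun ω => sInf {m | t < τ ω (m + 1)} := by
    have hfind : ∀ ω, sInf {m | t < τ ω (m + 1)} = Nat.find (hex ω) := by
      intro ω
      by_cases h : ∃ m, t < τ ω (m + 1)
      · refine (Nat.sInf_def (s := {m | t < τ ω (m + 1)}) h).trans (Nat.find_congr' fun {m} => ⟨Or.inl, fun hm => hm.resolve_right fun hn => ?_⟩)
        obtain ⟨m, hm⟩ := h
        exact hn m hm
      · have he : {m | t < τ ω (m + 1)} = ∅ := eq_empty_of_forall_notMem (not_exists.1 h)
        rw [he, Nat.sInf_empty, eq_comm, Nat.find_eq_zero]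
        exact Or.inr (not_exists.1 h)
    simp only [hfind]
    refine measurable_find hex fun m => ?_
    have hu : {ω | t < τ ω (m + 1) ∨ ∀ m', ¬ t < τ ω (m' + 1)} =
        {ω | t < τ ω (m + 1)} ∪ {ω | ∀ m', ¬ t < τ ω (m' + 1)} := rfl
    rw [hu]
    refine (hlt m).union ?_
    have : {ω | ∀ m', ¬ t < τ ω (m' + 1)} = ⋂ m', {ω | t < τ ω (m' + 1)}ᶜ := by
      ext ω; simp
    rw [this]
    exact MeasurableSet.iInter fun m => (hlt m).compl
  exact measurable_of_countable_index (Φ := fun m ω => e ω m + (t - τ ω m) /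
    (τ ω (m + 1) - τ ω m) * (e ω (m + 1) - e ω m)) (fun m => by
      have h1 := hτ m
      have h2 := hτ (m + 1)
      have h3 := he m
      have h4 := he (m + 1)
      fun_prop) hI

namespace WallSystem

variable {n : ℕ} {S : WallSystem n}

instance : TopologicalSpace.SeparableSpace S.Graph := by
  refine Function.Surjective.denseRange (f := fun p : Fin (n + 1) × ℝ≥0 => S.point p.1 p.2)
    (fun y => ?_) |>.separableSpace (continuous_prod_of_discrete_left.2 fun j => continuous_point j)
  obtain ⟨j, h, rfl⟩ := exists_eq_point y
  exact ⟨(j, h), rfl⟩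

instance : SecondCountableTopology S.Graph := UniformSpace.secondCountable_of_separable _

end WallSystem

/-! ### The law of a step of the logarithm of the speed -/

namespace AlternatingRenewal

/-- A change of variables, where `Y` is a section of `g` over the target interval and `ρ` bounds its
derivative from below. -/
theorem Minorized.map {m : Measure ℝ} {κ p₀ q₀ : ℝ} (hm : Minorized κ p₀ q₀ m) (hκ : 0 ≤ κ)
    {g Y Y' : ℝ → ℝ} (hg : Measurable g) {p q ρ : ℝ}
    (hY : ∀ y ∈ Icc p q, HasDerivAt Y (Y' y) y) (hρ : ∀ y ∈ Icc p q, ρ ≤ |Y' y|)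
    (hmaps : MapsTo Y (Icc p q) (Icc p₀ q₀)) (hinv : LeftInvOn g Y (Icc p q)) :
    Minorized (κ * ρ) p q (m.map g) := by
  intro φ hφ
  rw [lintegral_map hφ hg]
  refine le_trans ?_ (hm (fun x => φ (g x)) (hφ.comp hg))
  rw [ENNReal.ofReal_mul hκ, mul_assoc]
  gcongr
  calc ENNReal.ofReal ρ * ∫⁻ y in Icc p q, φ y = ∫⁻ y in Icc p q, ENNReal.ofReal ρ * φ y :=
        (lintegral_const_mul _ hφ).symm
    _ ≤ ∫⁻ y in Icc p q, ENNReal.ofReal |Y' y| * φ (g (Y y)) := by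
        refine setLIntegral_mono' measurableSet_Icc fun y hy => ?_
        rw [hinv hy]
        gcongr
        exact hρ y hy
    _ = ∫⁻ x in Y '' Icc p q, φ (g x) :=
        (lintegral_image_eq_lintegral_abs_deriv_mul measurableSet_Icc
          (fun y hy => (hY y hy).hasDerivWithinAt) hinv.injOn (fun x => φ (g x))).symm
    _ ≤ ∫⁻ x in Icc p₀ q₀, φ (g x) := lintegral_mono_set hmaps.image_subset

/-- A law with a continuous density dominates a multiple of the Lebesgue measure on an interval. -/
theorem exists_minorized_withDensity {f : ℝ → ℝ≥0} (hf : Continuous f)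
    (h : IsProbabilityMeasure (volume.withDensity fun x => (f x : ℝ≥0∞))) :
    ∃ κ p q : ℝ, 0 < κ ∧ p < q ∧ Minorized κ p q (volume.withDensity fun x => (f x : ℝ≥0∞)) := by
  have hmf : Measurable fun x => (f x : ℝ≥0∞) := hf.measurable.coe_nnreal_ennreal
  obtain ⟨x₀, hx₀⟩ : ∃ x, 0 < f x := by
    by_contra! hc
    have h0 : ∀ x, f x = 0 := fun x => le_antisymm (hc x) (zero_le)
    have h1 : (volume.withDensity fun x => (f x : ℝ≥0∞)) univ = 1 := measure_univ
    simp [h0] at h1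
  have hev : ∀ᶠ x in 𝓝 x₀, f x₀ / 2 < f x :=
    hf.continuousAt.eventually (lt_mem_nhds (NNReal.half_lt_self hx₀.ne'))
  obtain ⟨ρ, hρ, hball⟩ := Metric.eventually_nhds_iff_ball.1 hev
  refine ⟨f x₀ / 2, x₀ - ρ / 2, x₀ + ρ / 2, half_pos (by exact_mod_cast hx₀), by linarith,
    fun φ hφ => ?_⟩
  rw [lintegral_withDensity_eq_lintegral_mul _ hmf hφ, ← lintegral_const_mul _ hφ]
  refine (setLIntegral_mono' measurableSet_Icc fun x hx => ?_).trans (setLIntegral_le_lintegral _ _)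
  simp only [Pi.mul_apply]
  gcongr
  have hx' : x ∈ Metric.ball x₀ ρ := by
    rw [Real.ball_eq_Ioo]
    exact ⟨by linarith [hx.1], by linarith [hx.2]⟩
  have := hball x hx'
  rw [← ENNReal.ofReal_coe_nnreal]
  refine ENNReal.ofReal_le_ofReal ?_
  have h2 : ((f x₀ / 2 : ℝ≥0) : ℝ) ≤ f x := by exact_mod_cast this.le
  simpa using h2

/-- The step of the logarithm of the speed, divided by `ε`, if the speed is multiplied by
`1 - ε z`. -/
noncomputable def logStep (ε z : ℝ) : ℝ := -Real.log (1 - ε * z) / ε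

theorem measurable_logStep (ε : ℝ) : Measurable (logStep ε) :=
  (Real.measurable_log.comp (measurable_const.sub (measurable_id.const_mul ε))).neg.div_const ε

theorem le_logStep {ε z : ℝ} (hε : 0 < ε) (hz : ε * z < 1) : z ≤ logStep ε z := by
  rw [logStep, le_div_iff₀ hε]
  have := Real.log_le_sub_one_of_pos (x := 1 - ε * z) (by linarith)
  linarith

theorem logStep_le {ε z : ℝ} (hε : 0 < ε) (hz : ε * z < 1) : logStep ε z ≤ z / (1 - ε * z) := by
  rw [logStep, div_le_iff₀ hε]
  have h1 : 0 < 1 - ε * z := by linarith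
  have := Real.one_sub_inv_le_log_of_pos h1
  have h2 : z / (1 - ε * z) * ε = (1 - ε * z)⁻¹ - 1 := by
    rw [div_mul_eq_mul_div, div_eq_iff h1.ne', sub_mul, inv_mul_cancel₀ h1.ne']; ring
  linarith

theorem logStep_mem_Icc {ε z a A : ℝ} (hε : 0 < ε) (ha : 0 < a) (hεA : ε * A ≤ 1 / 2)
    (hz : z ∈ Icc a A) : logStep ε z ∈ Icc a (2 * A) := by
  have h0 : ε * z ≤ 1 / 2 := (mul_le_mul_of_nonneg_left hz.2 hε.le).trans hεA
  refine ⟨hz.1.trans (le_logStep hε (by linarith)), (logStep_le hε (by linarith)).trans ?_⟩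
  rw [div_le_iff₀ (by linarith)]
  nlinarith [hz.1, hz.2]

theorem abs_logStep_sub_le {ε z a A : ℝ} (hε : 0 < ε) (ha : 0 < a) (hεA : ε * A ≤ 1 / 2)
    (hz : z ∈ Icc a A) : |logStep ε z - z| ≤ ε * (2 * A ^ 2) := by
  have h0 : ε * z ≤ 1 / 2 := (mul_le_mul_of_nonneg_left hz.2 hε.le).trans hεA
  have h1 := le_logStep (ε := ε) (z := z) hε (by linarith)
  have h2 := logStep_le (ε := ε) (z := z) hε (by linarith)
  rw [abs_of_nonneg (by linarith)]
  have h3 : z / (1 - ε * z) - z = ε * z ^ 2 / (1 - ε * z) := by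
    have : 1 - ε * z ≠ 0 := by linarith
    rw [eq_div_iff this, sub_mul, div_mul_cancel₀ _ this]
    ring
  have h4 : ε * z ^ 2 / (1 - ε * z) ≤ ε * (2 * A ^ 2) := by
    rw [div_le_iff₀ (by linarith)]
    have h5 : z ^ 2 ≤ A ^ 2 := pow_le_pow_left₀ (ha.le.trans hz.1) hz.2 2
    have h6 : 0 ≤ ε * A ^ 2 := by positivity
    have h7 : ε * z ^ 2 ≤ ε * A ^ 2 := mul_le_mul_of_nonneg_left h5 hε.le
    nlinarith
  linarith

/-- The inverse of `logStep ε` is `y ↦ (1 - exp (-ε y)) / ε`, which tends to `y` and has derivative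
`exp (-ε y)`. It takes values at most `y`, so only the lower end can leave `Icc p q`; starting from
the midpoint leaves room for that. The constants do not depend on `ε`. -/
theorem eventually_minorized_logStep {m : Measure ℝ} {κ p q : ℝ} (hκ : 0 < κ) (hpq : p < q)
    (hm : Minorized κ p q m) :
    ∀ᶠ ε in 𝓝[>] (0 : ℝ), Minorized (κ * (1 / 2)) ((p + q) / 2) q (m.map (logStep ε)) := by
  have hlim : ∀ y : ℝ, Tendsto (fun ε : ℝ => (1 - Real.exp (-(ε * y))) / ε) (𝓝[>] 0) (𝓝 y) := by
    intro y
    have h : HasDerivAt (fun ε : ℝ => 1 - Real.exp (-(ε * y))) y 0 := by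
      have h1 : HasDerivAt (fun ε : ℝ => -(ε * y)) (-(1 * y)) 0 := ((hasDerivAt_id _).mul_const y).neg
      have := h1.exp.const_sub 1
      simpa using this
    have := (hasDerivAt_iff_tendsto_slope.1 h).mono_left
      (nhdsWithin_mono 0 (fun x (hx : 0 < x) => hx.ne') : 𝓝[>] (0 : ℝ) ≤ 𝓝[≠] 0)
    refine this.congr fun ε => ?_
    simp [slope_def_field]
  have hexp : Tendsto (fun ε : ℝ => Real.exp (-(ε * q))) (𝓝[>] 0) (𝓝 1) := by
    have : Tendsto (fun ε : ℝ => Real.exp (-(ε * q))) (𝓝 0) (𝓝 (Real.exp (-(0 * q)))) :=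
      (Continuous.tendsto (by fun_prop) 0)
    simp only [zero_mul, neg_zero, Real.exp_zero] at this
    exact this.mono_left nhdsWithin_le_nhds
  filter_upwards [self_mem_nhdsWithin, (hlim ((p + q) / 2)).eventually
    (lt_mem_nhds (show p < (p + q) / 2 by linarith)), hexp.eventually
    (lt_mem_nhds (show (1 / 2 : ℝ) < 1 by norm_num))] with ε hε h1 h2
  rw [mem_Ioi] at hε
  have hmono : ∀ y z, y ≤ z → (1 - Real.exp (-(ε * y))) / ε ≤ (1 - Real.exp (-(ε * z))) / ε := by
    intro y z h
    gcongr
  refine hm.map hκ.le (measurable_logStep ε) (Y := fun y => (1 - Real.exp (-(ε * y))) / ε)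
    (Y' := fun y => Real.exp (-(ε * y))) (fun y _ => ?_) (fun y hy => ?_)
    (fun y hy => ⟨h1.le.trans (hmono _ _ hy.1), (hmono _ _ hy.2).trans ?_⟩) (fun y _ => ?_)
  · have h1 : HasDerivAt (fun y : ℝ => -(ε * y)) (-(ε * 1)) y := ((hasDerivAt_id _).const_mul ε).neg
    have h2 := (h1.exp.const_sub 1).div_const ε
    have e : -(Real.exp (-(ε * y)) * -(ε * 1)) / ε = Real.exp (-(ε * y)) := by
      rw [div_eq_iff hε.ne']
      ring
    rw [e] at h2
    exact h2
  · rw [abs_of_pos (Real.exp_pos _)]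
    refine h2.le.trans (Real.exp_le_exp.2 ?_)
    have := mul_le_mul_of_nonneg_left hy.2 hε.le
    linarith
  · rw [div_le_iff₀ hε]
    have := Real.add_one_le_exp (-(ε * q))
    linarith
  · rw [logStep, mul_div_cancel₀ _ hε.ne', sub_sub_cancel, Real.log_exp]
    field_simp

end AlternatingRenewal

theorem eventually_mul_le {A c : ℝ} (hc : 0 < c) : ∀ᶠ ε : ℝ in 𝓝[>] 0, ε * A ≤ c := by
  have : Tendsto (fun ε : ℝ => ε * A) (𝓝 0) (𝓝 (0 * A)) := Continuous.tendsto (by fun_prop) 0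
  rw [zero_mul] at this
  exact (this.mono_left nhdsWithin_le_nhds).eventually (ge_mem_nhds hc)

namespace AlternatingRenewal

theorem Minorized.mono {F : Measure ℝ} {κ κ' p q : ℝ} (h : Minorized κ p q F) (hκ : κ' ≤ κ) :
    Minorized κ' p q F := fun φ hφ =>
  le_trans (by gcongr) (h φ hφ)

theorem tendsto_integral_logStep {m : Measure ℝ} [IsProbabilityMeasure m] {a A : ℝ} (ha : 0 < a)
    (hm : ∀ᵐ z ∂m, z ∈ Icc a A) :
    Tendsto (fun ε => ∫ z, logStep ε z ∂m) (𝓝[>] 0) (𝓝 (∫ z, z ∂m)) := by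
  rw [tendsto_iff_dist_tendsto_zero]
  have hlim : Tendsto (fun ε : ℝ => ε * (2 * A ^ 2)) (𝓝[>] 0) (𝓝 0) := by
    have : Tendsto (fun ε : ℝ => ε * (2 * A ^ 2)) (𝓝 0) (𝓝 (0 * (2 * A ^ 2))) :=
      Continuous.tendsto (by fun_prop) 0
    rw [zero_mul] at this
    exact this.mono_left nhdsWithin_le_nhds
  have hsmall := eventually_mul_le (A := A) (half_pos one_pos)
  refine squeeze_zero' (Eventually.of_forall fun ε => dist_nonneg) ?_ hlim
  filter_upwards [self_mem_nhdsWithin, hsmall] with ε hε hεA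
  rw [mem_Ioi] at hε
  have i1 : Integrable (logStep ε) m :=
    Integrable.of_bound (measurable_logStep ε).aestronglyMeasurable (2 * A) (by
      filter_upwards [hm] with z hz
      have := logStep_mem_Icc hε ha hεA hz
      rw [Real.norm_eq_abs, abs_of_nonneg (ha.le.trans this.1)]
      exact this.2)
  have i2 : Integrable (fun z => z) m :=
    Integrable.of_bound measurable_id.aestronglyMeasurable A (by
      filter_upwards [hm] with z hz
      rw [Real.norm_eq_abs, abs_of_nonneg (ha.le.trans hz.1)]
      exact hz.2)
  rw [Real.dist_eq, ← integral_sub i1 i2]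
  have := norm_integral_le_of_norm_le_const (μ := m) (C := ε * (2 * A ^ 2))
    (f := fun z => logStep ε z - z) (by
      filter_upwards [hm] with z hz
      exact abs_logStep_sub_le hε ha hεA hz)
  simpa using this

/-- The renewal theorem for the steps of the logarithm of the speed, for small `ε`. -/
theorem exists_logStep_renewal {m : Side → Measure ℝ} (hprob : ∀ s, IsProbabilityMeasure (m s))
    {a A : ℝ} (ha : 0 < a) (haA : a ≤ A) (hm : ∀ s, ∀ᵐ z ∂m s, z ∈ Icc a A)
    (hmin : ∀ s, ∃ κ p q, 0 < κ ∧ p < q ∧ Minorized κ p q (m s)) {val : Side → ℝ} {C : ℝ}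
    (hC : ∀ s, |val s| ≤ C) {η : ℝ} (hη : 0 < η) :
    ∃ D, ∀ᶠ ε in 𝓝[>] (0 : ℝ), ∃ u : Side → ℝ → ℝ, (∀ s, Measurable (u s)) ∧
      (∀ s x, |u s x| ≤ C) ∧
      (∀ s x, u s x = ∫ z, (if x ≤ logStep ε z then val s else u s.flip (x - logStep ε z)) ∂m s) ∧
      ∀ s x, D ≤ x → |u s x - ((∫ z, z ∂m .left) * val .left + (∫ z, z ∂m .right) * val .right) /
        ((∫ z, z ∂m .left) + ∫ z, z ∂m .right)| ≤ η := by
  choose κ p q hκ hpq hmin using hmin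
  set κ' := min (κ .left) (κ .right) * (1 / 2) with hκ'
  have hκ'0 : 0 < κ' := mul_pos (lt_min (hκ _) (hκ _)) (by norm_num)
  have hκ'le : ∀ s, κ' ≤ κ s * (1 / 2) := fun s => by
    cases s
    · exact mul_le_mul_of_nonneg_right (min_le_left _ _) (by norm_num)
    · exact mul_le_mul_of_nonneg_right (min_le_right _ _) (by norm_num)
  -- `D` is fixed before `ε`: for all small `ε` the steps lie in `Icc a (2 * A)` and share the
  -- minorization by `κ'`, and the renewal theorem is uniform under these conditions.
  obtain ⟨D, hD⟩ := exists_renewal (a := a) (b := 2 * A) (κ := κ') (C := C) (η := η / 2)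
    (p := fun s => (p s + q s) / 2) (q := q) ha (by linarith) hκ'0
    (fun s => by linarith [hpq s]) (half_pos hη)
  refine ⟨D, ?_⟩
  have hsmall := eventually_mul_le (A := A) (half_pos one_pos)
  have hpos : ∀ s, 0 < ∫ z, z ∂m s := fun s => by
    have hp := hprob s
    have i2 : Integrable (fun z => z) (m s) :=
      Integrable.of_bound measurable_id.aestronglyMeasurable A (by
        filter_upwards [hm s] with z hz
        rw [Real.norm_eq_abs, abs_of_nonneg (ha.le.trans hz.1)]
        exact hz.2)
    have := integral_mono_ae (integrable_const a) i2 ((hm s).mono fun z hz => hz.1)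
    simp only [integral_const, probReal_univ, smul_eq_mul, one_mul] at this
    linarith
  have hlim : Tendsto (fun ε => (val .left * (∫ z, logStep ε z ∂m .left) +
      val .right * (∫ z, logStep ε z ∂m .right)) /
      ((∫ z, logStep ε z ∂m .left) + (∫ z, logStep ε z ∂m .right))) (𝓝[>] 0)
      (𝓝 (((∫ z, z ∂m .left) * val .left + (∫ z, z ∂m .right) * val .right) /
        ((∫ z, z ∂m .left) + ∫ z, z ∂m .right))) := by
    have hl := tendsto_integral_logStep ha (hm .left)
    have hr := tendsto_integral_logStep ha (hm .right)
    have := ((hl.const_mul (val .left)).add (hr.const_mul (val .right))).div (hl.add hr)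
      (add_pos (hpos _) (hpos _)).ne'
    rw [mul_comm (∫ z, z ∂m .left), mul_comm (∫ z, z ∂m .right)]
    exact this
  filter_upwards [self_mem_nhdsWithin, hsmall,
    eventually_minorized_logStep (hκ .left) (hpq .left) (hmin .left),
    eventually_minorized_logStep (hκ .right) (hpq .right) (hmin .right),
    (Metric.tendsto_nhds.1 hlim) (η / 2) (half_pos hη)] with ε hε hεA hml hmr hclose
  rw [mem_Ioi] at hε
  have hgm := measurable_logStep ε
  obtain ⟨u, hu1, hu2, hu3, hu4⟩ := hD (fun s => (m s).map (logStep ε))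
    (fun s => Measure.isProbabilityMeasure_map hgm.aemeasurable)
    (fun s => (ae_map_iff (p := fun y => y ∈ Icc a (2 * A)) hgm.aemeasurable
      measurableSet_Icc).2 ((hm s).mono fun z hz => logStep_mem_Icc hε ha hεA hz))
    (fun s => by
      cases s
      · exact hml.mono (hκ'le .left)
      · exact hmr.mono (hκ'le .right)) val hC
  refine ⟨u, hu1, hu2, fun s x => ?_, fun s x hx => ?_⟩
  · rw [hu3 s x, integral_map hgm.aemeasurable
      (measurable_step_right (hu1 s.flip) _ _).aestronglyMeasurable]
  · have h4 := hu4 s x hx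
    have hid : ∀ s, ∫ y, y ∂(m s).map (logStep ε) = ∫ z, logStep ε z ∂m s := fun s =>
      integral_map hgm.aemeasurable measurable_id.aestronglyMeasurable
    rw [hid, hid] at h4
    rw [Real.dist_eq] at hclose
    have := abs_sub_le (u s x) ((val .left * (∫ z, logStep ε z ∂m .left) +
      val .right * (∫ z, logStep ε z ∂m .right)) /
      ((∫ z, logStep ε z ∂m .left) + (∫ z, logStep ε z ∂m .right)))
      (((∫ z, z ∂m .left) * val .left + (∫ z, z ∂m .right) * val .right) /
        ((∫ z, z ∂m .left) + ∫ z, z ∂m .right))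
    linarith

end AlternatingRenewal

/-! ### The distribution of the final cell -/

namespace WallSystem

open AlternatingRenewal

variable {n : ℕ} {S : WallSystem n}

theorem abs_value_le {c : S.Well → Side → ℝ} (hc : ∀ w s, 0 < c w s) {φ : Fin (n + 1) → ℝ} {C : ℝ}
    (hφ : ∀ j, |φ j| ≤ C) (w : S.Well) : |value c φ w| ≤ C := by
  induction w using Well.induction_on with
  | leaf w h => rw [value_of_forall_not c φ h]; exact hφ _
  | node w k h ih =>
    have hl := abs_le.1 (ih .left)
    have hr := abs_le.1 (ih .right)
    have cl := hc w .left
    have cr := hc w .right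
    rw [value_of_isAbove c φ h, abs_le, le_div_iff₀ (by linarith), div_le_iff₀ (by linarith)]
    constructor <;> nlinarith

open Classical in
/-- The height of the highest wall inside a well (zero if there is none). -/
noncomputable def Well.crest (w : S.Well) : ℝ :=
  if h : ∃ k, w.IsAbove k then S.height h.choose else 0

theorem Well.IsAbove.crest_eq {w : S.Well} {k : Fin n} (h : w.IsAbove k) :
    w.crest = S.height k := by
  have hex : ∃ k, w.IsAbove k := ⟨k, h⟩
  rw [crest, dif_pos hex, hex.choose_spec.eq_wall h]

open Classical in
/-- The value of `U`, which depends on the well, the direction of the motion and the rescaled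
logarithm of the ratio of the speed to the height of the highest wall. -/
noncomputable def potential (U : S.Well → Side → ℝ → ℝ) (φ : Fin (n + 1) → ℝ) (ε : ℝ)
    (x : S.State) : ℝ :=
  if ∃ k, x.well.IsAbove k then U x.well x.heading (Real.log (x.speed / x.well.crest) / ε)
  else φ x.cell

section Potential

variable {U : S.Well → Side → ℝ → ℝ} {φ : Fin (n + 1) → ℝ} {ε : ℝ}

theorem potential_of_isAbove {x : S.State} {k : Fin n} (h : x.well.IsAbove k) :
    potential U φ ε x = U x.well x.heading (Real.log (x.speed / S.height k) / ε) := by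
  rw [potential, if_pos ⟨k, h⟩, h.crest_eq]

theorem potential_of_forall_not {x : S.State} (h : ∀ i, ¬ x.well.HasWall i) :
    potential U φ ε x = φ x.cell := by
  rw [potential, if_neg]
  rintro ⟨k, hk⟩
  exact h k hk.hasWall

theorem measurable_potential (hU : ∀ w s, Measurable (U w s)) :
    Measurable (potential U φ ε) := by
  classical
  refine measurable_of_countable_index (I := fun x : S.State => ((x.well, x.heading), x.cell))
    (Φ := fun (p : (S.Well × Side) × Fin (n + 1)) (x : S.State) =>
      if ∃ k, p.1.1.IsAbove k then U p.1.1 p.1.2 (Real.log (x.speed / p.1.1.crest) / ε)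
      else φ p.2) (fun p => ?_)
    ((State.measurable_well.prodMk State.measurable_heading).prodMk State.measurable_cell)
  by_cases h : ∃ k, p.1.1.IsAbove k
  · simp only [if_pos h]
    exact (hU _ _).comp ((Real.measurable_log.comp
      (State.measurable_speed.div_const _)).div_const ε)
  · simp only [if_neg h]
    exact measurable_const

theorem abs_potential_le {C : ℝ} (hU : ∀ w s x, |U w s x| ≤ C) (hφ : ∀ j, |φ j| ≤ C)
    (x : S.State) : |potential U φ ε x| ≤ C := by
  rw [potential]
  split_ifs
  exacts [hU _ _ _, hφ _]

/-- A particle in a well without interior walls remains there. -/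
theorem potential_next_of_forall_not {x : S.State} {ρ : ℝ} (hx : 0 < x.speed) (hρ : ρ ≤ 1)
    (h : ∀ i, ¬ x.well.HasWall i) :
    potential U φ ε (State.next (fun _ _ _ => ρ) x) = potential U φ ε x := by
  have hv : (State.next (fun _ _ _ => ρ) x).speed ≤ x.speed := mul_le_of_le_one_right hx.le hρ
  have hle := State.next_well_le hv
  rw [potential_of_forall_not h, potential_of_forall_not
    fun i hi => h i ⟨hle.1.trans_lt hi.1, hi.2.trans_le hle.2⟩, State.next_cell,
    Well.cellAt_eq_of_forall_not_hasWall h x.hasCell_well]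

theorem log_next_speed {v z h : ℝ} (hv : 0 < v) (hz : ε * z < 1) (hh : 0 < h) :
    Real.log (v * (1 - ε * z) / h) / ε = Real.log (v / h) / ε - logStep ε z := by
  rw [mul_div_right_comm, Real.log_mul (by positivity) (by linarith), logStep]
  ring

/-- The change of the potential at a collision. -/
theorem potential_next_le {b : S.Well → Side → ℝ} {a A D η : ℝ} (hε : 0 < ε) (ha : 0 < a)
    (hεA : ε * A ≤ 1 / 2) (hη : 0 ≤ η)
    (hlow : ∀ i k, S.height i < S.height k → S.height i < (1 - ε * A) * S.height k)
    (hfar : ∀ i k, S.height i < S.height k →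
      D ≤ Real.log ((1 - ε * A) * S.height k / S.height i) / ε)
    (hnear : ∀ (w : S.Well) (k : Fin n), w.IsAbove k → ∀ s y, D ≤ y → |U w s y - value b φ w| ≤ η)
    {x : S.State} (hx : 0 < x.speed) {k : Fin n} (h : x.well.IsAbove k) {z : ℝ} (hz : z ∈ Icc a A) :
    potential U φ ε (State.next (fun _ _ _ => 1 - ε * z) x) +
        η * S.passable (x.speed * (1 - ε * z)) ≤
      (if Real.log (x.speed / S.height k) / ε ≤ logStep ε z then
        value b φ (Well.child h x.heading)
        else U x.well x.heading.flip (Real.log (x.speed / S.height k) / ε - logStep ε z)) +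
      η * S.passable x.speed := by
  set y := State.next (fun _ _ _ => 1 - ε * z) x with hy
  have hz0 : 0 < z := ha.trans_le hz.1
  have hεz : ε * z ≤ ε * A := mul_le_mul_of_nonneg_left hz.2 hε.le
  have hεz0 : 0 < ε * z := mul_pos hε hz0
  have hhk : 0 < S.height k := S.height_pos k
  have hvk : S.height k < x.speed := lt_of_hasWall_wellAt h.hasWall
  have hys : y.speed = x.speed * (1 - ε * z) := rfl
  have hyh : y.heading = x.heading.flip := rfl
  have hypos : 0 < y.speed := hys ▸ mul_pos hx (by linarith)
  have hyle : y.speed ≤ x.speed := hys ▸ mul_le_of_le_one_right hx.le (by linarith)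
  have hyA : (1 - ε * A) * S.height k < y.speed := by
    rw [hys, mul_comm]
    exact mul_lt_mul hvk (by linarith) (by linarith) hx.le
  have hwell : y.well = S.wellAt (x.well.cellAt x.heading) y.speed := rfl
  have hlog := log_next_speed (ε := ε) (z := z) hx (by linarith) hhk
  -- The walk jumps over `0` exactly at the collision after which the wall `k` reflects the
  -- particle.
  have hiff : Real.log (x.speed / S.height k) / ε ≤ logStep ε z ↔ y.speed ≤ S.height k := by
    rw [← sub_nonpos, ← hlog, div_le_iff₀ hε, zero_mul, Real.log_nonpos_iff
      (by rw [← hys]; positivity), div_le_one hhk, hys]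
  have hblocks : ∀ s, S.Blocks (x.well.wall s) x.speed := fun s => S.blocks_wall_wellAt _ _ s
  rw [← hys]
  by_cases hcross : y.speed ≤ S.height k
  · rw [if_pos (hiff.2 hcross)]
    have hchild : y.well = Well.child h x.heading := by
      rw [hwell]
      exact wellAt_cellAt_eq_child h hblocks hyle hcross fun i hi hne =>
        (hlow i k (h.lt hi hne)).trans hyA
    have hpass : (S.passable y.speed : ℝ) + 1 ≤ S.passable x.speed := by
      exact_mod_cast passable_lt hcross hvk
    -- The particle is now confined to the part of the well next to the wall just hit. By `hfar`, on
    -- the scale of the steps it is still far above the next highest wall, so the potential is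
    -- within `η` of the value of that part. The drop of `passable` compensates this error.
    have hpot : potential U φ ε y ≤ value b φ (Well.child h x.heading) + η := by
      by_cases hex : ∃ k', y.well.IsAbove k'
      · obtain ⟨k', hk'⟩ := hex
        rw [potential_of_isAbove hk', ← hchild]
        have hlt : S.height k' < S.height k := by
          have hw := hk'.hasWall
          rw [hchild] at hw
          have := Well.hasWall_of_child h hw
          exact h.lt this.1 this.2
        have hD : D ≤ Real.log (y.speed / S.height k') / ε := by
          refine (hfar k' k hlt).trans ?_
          have h1 : 0 < (1 - ε * A) * S.height k := mul_pos (by linarith) hhk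
          have h2 := S.height_pos k'
          have h3 : Real.log ((1 - ε * A) * S.height k / S.height k') ≤
              Real.log (y.speed / S.height k') := by gcongr
          gcongr
        have := (abs_le.1 (hnear _ _ hk' y.heading _ hD)).2
        linarith
      · have hno : ∀ i, ¬ y.well.HasWall i := fun i hi => hex (Well.exists_isAbove hi)
        rw [potential_of_forall_not hno, ← hchild, value_of_forall_not b φ hno,
          Well.cellAt_eq_of_forall_not_hasWall hno y.hasCell_well]
        linarith
    nlinarith
  · rw [if_neg fun hc => hcross (hiff.1 hc)]
    have hsame : y.well = x.well := by
      rw [hwell]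
      refine wellAt_eq_iff.2 ⟨x.well.hasCell_cellAt _, (hblocks .left).mono hyle,
        (hblocks .right).mono hyle, fun i hi => (h.le hi).trans_lt (not_le.1 hcross)⟩
    have hk' : y.well.IsAbove k := hsame ▸ h
    rw [potential_of_isAbove hk', hsame, hyh, hys, hlog]
    have hpass : (S.passable (x.speed * (1 - ε * z)) : ℝ) ≤ S.passable x.speed := by
      exact_mod_cast passable_mono (hys ▸ hyle)
    have := mul_le_mul_of_nonneg_left hpass hη
    linarith

end Potential

theorem eventually_le_log_div {D q : ℝ} (hq : 1 < q) :
    ∀ᶠ ε : ℝ in 𝓝[>] 0, D ≤ Real.log q / ε := by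
  have : Tendsto (fun ε : ℝ => Real.log q / ε) (𝓝[>] 0) atTop := by
    simp only [div_eq_mul_inv]
    exact tendsto_inv_nhdsGT_zero.const_mul_atTop (Real.log_pos hq)
  exact this.eventually_ge_atTop D

/-- The highest walls of the wells are far away, on the scale of the steps, from each other. -/
theorem eventually_far {A D h h' : ℝ} (hh : 0 < h) (hlt : h < h') :
    ∀ᶠ ε : ℝ in 𝓝[>] 0, h < (1 - ε * A) * h' ∧ D ≤ Real.log ((1 - ε * A) * h' / h) / ε := by
  have hh' : 0 < h' := hh.trans hlt
  obtain ⟨g, hg1, hg2⟩ := exists_between hlt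
  have hg : 0 < g := hh.trans hg1
  have hc : 0 < 1 - g / h' := by
    rw [sub_pos, div_lt_one hh']
    exact hg2
  filter_upwards [self_mem_nhdsWithin, eventually_mul_le (A := A) hc,
    eventually_le_log_div (D := D) ((one_lt_div hh).2 hg1)] with ε hε h1 h2
  rw [mem_Ioi] at hε
  have h3 : g ≤ (1 - ε * A) * h' := by
    have : g / h' ≤ 1 - ε * A := by linarith
    rwa [div_le_iff₀ hh'] at this
  refine ⟨hg1.trans_le h3, h2.trans ?_⟩
  have h4 : Real.log (g / h) ≤ Real.log ((1 - ε * A) * h' / h) := by gcongr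
  gcongr

section Terminal

variable {Ω : Type*} [MeasurableSpace Ω] {P : Measure Ω} [IsProbabilityMeasure P]
  {a : S.Well → Side → ℕ → Ω → ℝ} {m : S.Well → Side → Measure ℝ} {a₀ A : ℝ}

/-- The expectation of a function of the cell after many collisions is asymptotically at most the
value of that function. -/
theorem eventually_integral_cell_le (ha : ∀ w s k, Measurable (a w s k))
    (hind : iIndepFun (fun i : S.Well × Side × ℕ => a i.1 i.2.1 i.2.2) P)
    (hlaw : ∀ w s k, P.map (a w s k) = m w s) (ha₀ : 0 < a₀) (haA : a₀ ≤ A)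
    (hm : ∀ w s, ∀ᵐ z ∂m w s, z ∈ Icc a₀ A)
    (hmin : ∀ w s, ∃ κ p q, 0 < κ ∧ p < q ∧ Minorized κ p q (m w s))
    {x₀ : S.State} (hx₀ : 0 < x₀.speed) (φ : Fin (n + 1) → ℝ) {η : ℝ} (hη : 0 < η) :
    ∀ᶠ ε in 𝓝[>] (0 : ℝ), ∀ M, (∀ᵐ ω ∂P, ∀ i,
        (orbit (coefficients (fun w s k => a w s k ω) ε) x₀ M).speed ≤ S.height i) →
      ∫ ω, φ (orbit (coefficients (fun w s k => a w s k ω) ε) x₀ M).cell ∂P ≤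
        value (fun w s => ∫ z, z ∂m w s) φ x₀.well + η := by
  classical
  have hprob : ∀ w s, IsProbabilityMeasure (m w s) := fun w s =>
    hlaw w s 0 ▸ Measure.isProbabilityMeasure_map (ha w s 0).aemeasurable
  set b : S.Well → Side → ℝ := fun w s => ∫ z, z ∂m w s with hb
  have hbpos : ∀ w s, 0 < b w s := fun w s => by
    have i2 : Integrable (fun z => z) (m w s) :=
      Integrable.of_bound measurable_id.aestronglyMeasurable A (by
        filter_upwards [hm w s] with z hz
        rw [Real.norm_eq_abs, abs_of_nonneg (ha₀.le.trans hz.1)]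
        exact hz.2)
    have := integral_mono_ae (integrable_const a₀) i2 ((hm w s).mono fun z hz => hz.1)
    simp only [integral_const, probReal_univ, smul_eq_mul, one_mul] at this
    exact ha₀.trans_le this
  obtain ⟨C, hC⟩ := Finite.exists_le fun j => |φ j|
  have hC0 : 0 ≤ C := (abs_nonneg _).trans (hC 0)
  -- One error `ζ` for the initial well and one for each of the at most `n` walls that become
  -- impassable.
  set ζ := η / (n + 1) with hζ
  have hn : (0 : ℝ) < n + 1 := by positivity
  have hζ0 : 0 < ζ := div_pos hη hn
  have hren : ∀ w : S.Well, ∃ D, ∀ᶠ ε in 𝓝[>] (0 : ℝ), ∃ u : Side → ℝ → ℝ,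
      (∀ s, Measurable (u s)) ∧ (∀ s x, |u s x| ≤ C) ∧ ∀ k (h : w.IsAbove k),
        (∀ s x, u s x = ∫ z, (if x ≤ logStep ε z then value b φ (Well.child h s)
          else u s.flip (x - logStep ε z)) ∂m w s) ∧
        ∀ s x, D ≤ x → |u s x - value b φ w| ≤ ζ := by
    intro w
    by_cases hex : ∃ k, w.IsAbove k
    · obtain ⟨k, h⟩ := hex
      obtain ⟨D, hD⟩ := exists_logStep_renewal (hprob w) ha₀ haA (hm w) (hmin w)
        (val := fun s => value b φ (Well.child h s)) (fun s => abs_value_le hbpos hC _) hζ0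
      refine ⟨D, hD.mono fun ε hε => ?_⟩
      obtain ⟨u, h1, h2, h3, h4⟩ := hε
      refine ⟨u, h1, h2, fun k' h' => ?_⟩
      obtain rfl := h.eq_wall h'
      exact ⟨h3, fun s x hx => by
        rw [value_of_isAbove b φ h]
        exact h4 s x hx⟩
    · exact ⟨0, Eventually.of_forall fun ε => ⟨fun _ _ => 0, fun _ => measurable_const,
        fun _ _ => by simpa using hC0, fun k h => absurd ⟨k, h⟩ hex⟩⟩
  choose D hD using hren
  obtain ⟨D', hD'⟩ := Finite.exists_le D
  have hfar : ∀ᶠ ε : ℝ in 𝓝[>] 0, ∀ i k, S.height i < S.height k →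
      S.height i < (1 - ε * A) * S.height k ∧
        D' ≤ Real.log ((1 - ε * A) * S.height k / S.height i) / ε := by
    refine eventually_all.2 fun i => eventually_all.2 fun k => ?_
    by_cases h : S.height i < S.height k
    · exact (eventually_far (S.height_pos i) h).mono fun ε hε _ => hε
    · exact Eventually.of_forall fun ε hε => absurd hε h
  have hstart : ∀ᶠ ε : ℝ in 𝓝[>] 0, ∀ k, x₀.well.IsAbove k →
      D' ≤ Real.log (x₀.speed / S.height k) / ε := by
    refine eventually_all.2 fun k => ?_
    by_cases h : x₀.well.IsAbove k
    · exact (eventually_le_log_div ((one_lt_div (S.height_pos k)).2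
        (lt_of_hasWall_wellAt h.hasWall))).mono fun ε hε _ => hε
    · exact Eventually.of_forall fun ε hε => absurd hε h
  filter_upwards [self_mem_nhdsWithin, eventually_mul_le (A := A) (half_pos one_pos),
    eventually_all.2 hD, hfar, hstart] with ε hε hεA hU hfar hstart M hM
  rw [mem_Ioi] at hε
  choose U hUm hUb hU using hU
  have hnear : ∀ (w : S.Well) (k : Fin n), w.IsAbove k → ∀ s y, D' ≤ y →
      |U w s y - value b φ w| ≤ ζ := fun w k h s y hy => (hU w k h).2 s y ((hD' w).trans hy)
  -- The error budget `ζ * passable` makes the potential a supermartingale: it is spent when the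
  -- particle enters a smaller well.
  set G : S.State → ℝ := fun x => potential U φ ε x + ζ * S.passable x.speed with hG
  have hpm : Measurable fun v : ℝ => (S.passable v : ℝ) :=
    Monotone.measurable fun v v' h => by exact_mod_cast passable_mono h
  have hpn : ∀ v, (S.passable v : ℝ) ≤ n := fun v => by
    have : S.passable v ≤ n := (Finset.card_le_univ _).trans_eq (Fintype.card_fin n)
    exact_mod_cast this
  have hGm : Measurable G := (measurable_potential hUm).add
    ((hpm.comp State.measurable_speed).const_mul ζ)
  have hGb : ∀ x, |G x| ≤ C + ζ * n := fun x => by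
    refine (abs_add_le _ _).trans (add_le_add (abs_potential_le hUb hC x) ?_)
    rw [abs_of_nonneg (by positivity)]
    exact mul_le_mul_of_nonneg_left (hpn _) hζ0.le
  have hrm : ∀ w s k, Measurable fun ω => 1 - ε * a w s k ω := fun w s k =>
    measurable_const.sub ((ha w s k).const_mul ε)
  have hrind : iIndepFun (fun (i : S.Well × Side × ℕ) ω => 1 - ε * a i.1 i.2.1 i.2.2 ω) P :=
    hind.comp (fun _ z => 1 - ε * z) fun _ => by fun_prop
  have haff : Measurable fun z : ℝ => 1 - ε * z := by fun_prop
  have hrlaw : ∀ w s k, P.map (fun ω => 1 - ε * a w s k ω) = (m w s).map fun z => 1 - ε * z := by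
    intro w s k
    rw [← hlaw w s k, Measure.map_map haff (ha w s k)]
    rfl
  have hmain := integral_orbit_le (A := fun x => 0 < x.speed) hrm hrind hGm hGb (fun x hx k => by
      rw [hrlaw]
      have hms : MeasurableSet {ρ : ℝ | 0 < (State.next (fun _ _ _ => ρ) x).speed} := by
        have : {ρ : ℝ | 0 < (State.next (fun _ _ _ => ρ) x).speed} = {ρ | 0 < x.speed * ρ} := rfl
        rw [this]
        exact measurableSet_lt measurable_const (measurable_id.const_mul _)
      refine (ae_map_iff haff.aemeasurable hms).2 ?_
      filter_upwards [hm x.well x.heading] with z hz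
      have : ε * z ≤ ε * A := mul_le_mul_of_nonneg_left hz.2 hε.le
      exact mul_pos hx (by linarith)) (fun x hx k => by
      have hp := hprob x.well x.heading
      have hmap : ∫ ρ, G (State.next (fun _ _ _ => ρ) x)
          ∂((m x.well x.heading).map fun z => 1 - ε * z) =
          ∫ z, G (State.next (fun _ _ _ => 1 - ε * z) x) ∂m x.well x.heading :=
        integral_map haff.aemeasurable
          (hGm.comp (measurable_next_const measurable_id x)).aestronglyMeasurable
      rw [hrlaw, hmap]
      have hint : Integrable (fun z => G (State.next (fun _ _ _ => 1 - ε * z) x))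
          (m x.well x.heading) := Integrable.of_bound
        (hGm.comp (measurable_next_const haff x)).aestronglyMeasurable (C + ζ * n)
        (Eventually.of_forall fun z => hGb _)
      by_cases hex : ∃ k, x.well.IsAbove k
      · obtain ⟨k, h⟩ := hex
        have hlog := measurable_logStep ε
        have hi2 : Integrable (fun z => if Real.log (x.speed / S.height k) / ε ≤ logStep ε z then
            value b φ (Well.child h x.heading)
            else U x.well x.heading.flip (Real.log (x.speed / S.height k) / ε - logStep ε z))
            (m x.well x.heading) := by
          refine Integrable.of_bound (C := C) (Measurable.aestronglyMeasurable
            ((measurable_step_right (hUm _ _) _ _).comp hlog)) (Eventually.of_forall fun z => ?_)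
          exact abs_step_le (abs_value_le hbpos hC _) (hUb _ _) _ _
        have hG0 : G x = ∫ z, ((if Real.log (x.speed / S.height k) / ε ≤ logStep ε z then
            value b φ (Well.child h x.heading)
            else U x.well x.heading.flip (Real.log (x.speed / S.height k) / ε - logStep ε z)) +
            ζ * S.passable x.speed) ∂m x.well x.heading := by
          -- By the renewal equation for `U`, the potential before the collision is the mean of the
          -- bound in `potential_next_le`.
          rw [integral_add hi2 (integrable_const _), ← (hU x.well k h).1]
          simp [hG, potential_of_isAbove h]
        rw [hG0]
        refine integral_mono_ae hint (hi2.add (integrable_const _)) ?_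
        filter_upwards [hm x.well x.heading] with z hz
        exact potential_next_le hε ha₀ hεA hζ0.le (fun i k h => (hfar i k h).1)
          (fun i k h => (hfar i k h).2) hnear hx h hz
      · have hno : ∀ i, ¬ x.well.HasWall i := fun i hi => hex (Well.exists_isAbove hi)
        have := integral_mono_ae hint (integrable_const (G x)) (by
          filter_upwards [hm x.well x.heading] with z hz
          have hz0 : 0 < z := ha₀.trans_le hz.1
          have hεz : 0 < ε * z := mul_pos hε hz0
          have hεz' : ε * z ≤ ε * A := mul_le_mul_of_nonneg_left hz.2 hε.le
          have hv : (State.next (fun _ _ _ => 1 - ε * z) x).speed ≤ x.speed :=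
            mul_le_of_le_one_right hx.le (by linarith)
          have hpass : (S.passable (State.next (fun _ _ _ => 1 - ε * z) x).speed : ℝ) ≤
            S.passable x.speed := by exact_mod_cast passable_mono hv
          simp only [hG]
          rw [potential_next_of_forall_not hx (by linarith) hno]
          have := mul_le_mul_of_nonneg_left hpass hζ0.le
          linarith)
        simpa using this) M hx₀
  have hGx₀ : G x₀ ≤ value b φ x₀.well + η := by
    have h1 : potential U φ ε x₀ ≤ value b φ x₀.well + ζ := by
      by_cases hex : ∃ k, x₀.well.IsAbove k
      · obtain ⟨k, h⟩ := hex
        rw [potential_of_isAbove h]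
        have := (abs_le.1 (hnear _ k h x₀.heading _ (hstart k h))).2
        linarith
      · have hno : ∀ i, ¬ x₀.well.HasWall i := fun i hi => hex (Well.exists_isAbove hi)
        rw [potential_of_forall_not hno, value_of_forall_not b φ hno,
          Well.cellAt_eq_of_forall_not_hasWall hno x₀.hasCell_well]
        linarith
    have h2 : ζ * S.passable x₀.speed ≤ ζ * n := mul_le_mul_of_nonneg_left (hpn _) hζ0.le
    have h3 : ζ + ζ * n = η := by
      rw [hζ]
      field_simp
      ring
    simp only [hG]
    linarith
  refine le_trans ?_ (hmain.trans hGx₀)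
  have hR : Measurable fun (ω : Ω) w s k => 1 - ε * a w s k ω :=
    measurable_pi_iff.2 fun _ => measurable_pi_iff.2 fun _ => measurable_pi_iff.2 fun _ => hrm _ _ _
  have horb := measurable_orbit_comp hR (measurable_const (a := x₀)) M
  refine integral_mono_ae ?_ ?_ ?_
  · exact Integrable.of_bound ((measurable_of_countable φ).comp
      (State.measurable_cell.comp horb)).aestronglyMeasurable C (Eventually.of_forall fun ω => hC _)
  · exact Integrable.of_bound (hGm.comp horb).aestronglyMeasurable (C + ζ * n)
      (Eventually.of_forall fun ω => hGb _)
  -- After `M` collisions no wall is passable, so the potential is `φ` of the present cell, and the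
  -- rest of the budget is nonnegative.
  · filter_upwards [hM] with ω hω
    have hno : ∀ i, ¬ (orbit (fun w s k => 1 - ε * a w s k ω) x₀ M).well.HasWall i := fun i hi =>
      absurd (lt_of_hasWall_wellAt hi) (not_lt.2 (hω i))
    simp only [hG]
    rw [potential_of_forall_not hno]
    exact le_add_of_nonneg_right (by positivity)

end Terminal

end WallSystem

/-! ### Weak convergence of the slow motion -/

namespace WallSystem

open AlternatingRenewal

variable {n : ℕ} {S : WallSystem n}

/-- Applied to `-φ`, the upper bound for the expectation at the final cell also gives the lower one.
-/
theorem value_neg (c : S.Well → Side → ℝ) (φ : Fin (n + 1) → ℝ) (w : S.Well) :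
    value c (fun j => -φ j) w = -value c φ w := by
  induction w using Well.induction_on with
  | leaf w h => rw [value_of_forall_not _ _ h, value_of_forall_not _ _ h]
  | node w k h ih =>
    rw [value_of_isAbove _ _ h, value_of_isAbove _ _ h, ih, ih]
    ring

/-- After a bounded number of collisions the particle cannot pass any wall. -/
theorem exists_orbit_speed_le {ε a₀ A : ℝ} (hε : 0 < ε) (ha₀ : 0 < a₀) (hεA : ε * A ≤ 1 / 2)
    {x : S.State} (hx : x.IsStart) :
    ∃ M, ∀ a : S.Well → Side → ℕ → ℝ, (∀ w s k, a w s k ∈ Icc a₀ A) →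
      ∀ i, (orbit (coefficients a ε) x M).speed ≤ S.height i := by
  by_cases hne : a₀ ≤ A
  swap
  · exact ⟨0, fun a ha => absurd ((ha (S.wellAt 0 0) .left 0).1.trans (ha _ _ _).2) hne⟩
  have h0 : 0 < ε * a₀ := mul_pos hε ha₀
  have h1 : ε * a₀ ≤ ε * A := mul_le_mul_of_nonneg_left hne hε.le
  have hlim : Tendsto (fun M : ℕ => (1 - ε * a₀) ^ M * x.speed) atTop (𝓝 0) := by
    have := (tendsto_pow_atTop_nhds_zero_of_lt_one (r := 1 - ε * a₀) (by linarith)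
      (by linarith)).mul_const x.speed
    rwa [zero_mul] at this
  obtain ⟨M, hM⟩ := (eventually_all.2 fun i : Fin n =>
    hlim.eventually (ge_mem_nhds (S.height_pos i))).exists
  refine ⟨M, fun a ha i => le_trans ?_ (hM i)⟩
  clear hM
  induction M with
  | zero => simp [orbit_zero]
  | succ M ih =>
    rw [orbit_succ, State.next_speed, pow_succ', mul_assoc, mul_comm]
    have h2 := ha (orbit (coefficients a ε) x M).well (orbit (coefficients a ε) x M).heading
      ((orbit (coefficients a ε) x M).hits ((orbit (coefficients a ε) x M).well,
        (orbit (coefficients a ε) x M).heading))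
    have h3 := mul_le_mul_of_nonneg_left h2.1 hε.le
    have h4 := mul_le_mul_of_nonneg_left h2.2 hε.le
    have hpos := orbit_speed_pos (r := coefficients a ε)
      (coefficients_pos (fun w s k => (ha w s k).2) hε hεA) hx M
    refine mul_le_mul ?_ ih hpos.le (by linarith)
    simp only [coefficients]
    linarith

section Path

variable {a : S.Well → Side → ℕ → ℝ} {ε a₀ A : ℝ} {x : S.State} {T : ℝ}

theorem continuous_slowPath_coefficients (hε : 0 < ε) (ha₀ : 0 < a₀) (hεA : ε * A ≤ 1 / 2)
    (hx : x.IsStart) (ha : ∀ w s k, a w s k ∈ Icc a₀ A) :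
    Continuous fun t : Icc (0 : ℝ) T => slowPath ε (coefficients a ε) x t := by
  obtain ⟨M, hM⟩ := exists_orbit_speed_le hε ha₀ hεA hx
  have hr0 := coefficients_pos (a := a) (fun w s k => (ha w s k).2) hε hεA
  have hr1 := coefficients_lt_one (a := a) (fun w s k => ha₀.trans_le (ha w s k).1) hε
  exact continuous_slowPath hr0 hr1 hx hε (isFinalCell_of_speed_le hr0 hr1 hx (hM a ha)) T

theorem toPath_slowPath_apply (hε : 0 < ε) (ha₀ : 0 < a₀) (hεA : ε * A ≤ 1 / 2)
    (hx : x.IsStart) (ha : ∀ w s k, a w s k ∈ Icc a₀ A) {J : Fin (n + 1)}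
    (hJ : IsFinalCell (coefficients a ε) x J) (t : Icc (0 : ℝ) T) :
    (toPath (slowPath ε (coefficients a ε) x) : C(Icc (0 : ℝ) T, S.Graph)) t =
      S.point J (linearInterpolation (fun m => ε * (orbit (coefficients a ε) x m).time)
        (fun m => (orbit (coefficients a ε) x m).speed ^ 2 / 2) t).toNNReal := by
  rw [toPath, dif_pos (continuous_slowPath_coefficients hε ha₀ hεA hx ha)]
  exact slowPath_eq (coefficients_pos (fun w s k => (ha w s k).2) hε hεA)
    (coefficients_lt_one (fun w s k => ha₀.trans_le (ha w s k).1) hε) hx hε hJ t.2.1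

/-- The slow motion is close to the averaged path with the same final cell. -/
theorem eventually_dist_limitPath_le {b : S.Well → Side → ℝ} (hb : ∀ w s, 0 < b w s)
    (ha₀ : 0 < a₀) (hx : x.IsStart) (ha : ∀ w s k, a w s k ∈ Icc a₀ A)
    (hlim : ∀ w s, Tendsto (fun k : ℕ => (∑ i ∈ Finset.range k, a w s i) / k) atTop (𝓝 (b w s)))
    (hT : 0 < T) {η : ℝ} (hη : 0 < η) :
    ∀ᶠ ε : ℝ in 𝓝[>] 0, ∀ J, IsFinalCell (coefficients a ε) x J →
      dist (toPath (slowPath ε (coefficients a ε) x)) (limitPath hb J hx.speed_pos T) ≤ η := by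
  filter_upwards [self_mem_nhdsWithin, eventually_mul_le (A := A) (half_pos one_pos),
    eventually_energy_close (fun w s k => ha₀.trans_le (ha w s k).1) (fun w s k => (ha w s k).2) hb
      hlim hx hT hη] with ε hε hεA h J hJ
  rw [mem_Ioi] at hε
  refine (ContinuousMap.dist_le hη.le).2 fun t => ?_
  -- Both paths lie over the same cell, so their distance in the graph is the difference of the
  -- energies.
  rw [toPath_slowPath_apply hε ha₀ hεA hx ha hJ, limitPath_apply, proj, dist_point_same,
    Real.coe_toNNReal', Real.coe_toNNReal']
  exact (abs_max_sub_max_le_abs _ _ _).trans (h J hJ t t.2)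

end Path

section Random

variable {Ω : Type*} [MeasurableSpace Ω] {P : Measure Ω} [IsProbabilityMeasure P]
  {a : S.Well → Side → ℕ → Ω → ℝ} {m : S.Well → Side → Measure ℝ} {a₀ A : ℝ} {x : S.State} {T : ℝ}

theorem measurableSet_forall_mem_Icc (ha : ∀ w s k, Measurable (a w s k)) :
    MeasurableSet {ω | ∀ w s k, a w s k ω ∈ Icc a₀ A} := by
  have : {ω | ∀ w s k, a w s k ω ∈ Icc a₀ A} =
      ⋂ (w : S.Well) (s : Side) (k : ℕ), a w s k ⁻¹' Icc a₀ A := by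
    ext ω; simp
  rw [this]
  exact MeasurableSet.iInter fun w => MeasurableSet.iInter fun s => MeasurableSet.iInter fun k =>
    ha w s k measurableSet_Icc

omit [IsProbabilityMeasure P] in
theorem aemeasurable_toPath (ha : ∀ w s k, Measurable (a w s k))
    (hbd : ∀ᵐ ω ∂P, ∀ w s k, a w s k ω ∈ Icc a₀ A) {ε : ℝ} (hε : 0 < ε) (ha₀ : 0 < a₀)
    (hεA : ε * A ≤ 1 / 2) (hx : x.IsStart) :
    AEMeasurable (fun ω => (toPath (slowPath ε (coefficients (fun w s k => a w s k ω) ε) x) :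
      C(Icc (0 : ℝ) T, S.Graph))) P := by
  classical
  obtain ⟨M, hM⟩ := exists_orbit_speed_le hε ha₀ hεA hx
  set B := {ω | ∀ w s k, a w s k ω ∈ Icc a₀ A} with hB
  have hBm : MeasurableSet B := measurableSet_forall_mem_Icc ha
  -- Outside the event `B`, of full measure, the path is replaced by a constant. On `B` the final
  -- cell is the cell after `M` collisions with a deterministic `M`, so the path is a measurable
  -- function of that cell and of the energy.
  set g : Ω → C(Icc (0 : ℝ) T, S.Graph) := fun ω => if ω ∈ B then
    toPath (slowPath ε (coefficients (fun w s k => a w s k ω) ε) x) else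
    ContinuousMap.const _ (S.point 0 0) with hg
  have hR : Measurable fun (ω : Ω) => coefficients (fun w s k => a w s k ω) ε :=
    measurable_pi_iff.2 fun w => measurable_pi_iff.2 fun s => measurable_pi_iff.2 fun k =>
      measurable_const.sub ((ha w s k).const_mul ε)
  have horb : ∀ m, Measurable fun ω => orbit (coefficients (fun w s k => a w s k ω) ε) x m :=
    fun m => measurable_orbit_comp hR measurable_const m
  refine ⟨g, ContinuousMap.measurable_of_measurable_dist_apply fun t y => ?_, ?_⟩
  · have hE := measurable_linearInterpolation
      (τ := fun ω m => ε * (orbit (coefficients (fun w s k => a w s k ω) ε) x m).time)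
      (e := fun ω m => (orbit (coefficients (fun w s k => a w s k ω) ε) x m).speed ^ 2 / 2)
      (fun m => (State.measurable_time.comp (horb m)).const_mul ε)
      (fun m => ((State.measurable_speed.comp (horb m)).pow_const 2).div_const 2) t
    have hd : Measurable fun ω => dist (S.point
        (orbit (coefficients (fun w s k => a w s k ω) ε) x M).cell (linearInterpolation
        (fun m => ε * (orbit (coefficients (fun w s k => a w s k ω) ε) x m).time)
        (fun m => (orbit (coefficients (fun w s k => a w s k ω) ε) x m).speed ^ 2 / 2)
        t).toNNReal) y :=
      measurable_of_countable_index (Φ := fun (j : Fin (n + 1)) ω => dist (S.point j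
        (linearInterpolation (fun m => ε * (orbit (coefficients (fun w s k => a w s k ω) ε) x m).time)
        (fun m => (orbit (coefficients (fun w s k => a w s k ω) ε) x m).speed ^ 2 / 2)
        t).toNNReal) y)
        (fun j => (((continuous_point j).dist continuous_const).measurable.comp
          (measurable_real_toNNReal.comp hE))) (State.measurable_cell.comp (horb M))
    have hite := @Measurable.ite _ _ _ _ _ _ (fun ω => ω ∈ B) (Classical.decPred _) hBm hd
      (measurable_const (a := dist (S.point 0 0) y))
    convert hite using 1
    funext ω
    by_cases hω : ω ∈ B
    · have hr0 := coefficients_pos (a := fun w s k => a w s k ω) (fun w s k => (hω w s k).2) hε hεA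
      have hr1 := coefficients_lt_one (a := fun w s k => a w s k ω)
        (fun w s k => ha₀.trans_le (hω w s k).1) hε
      simp only [hg, if_pos hω]
      rw [toPath_slowPath_apply hε ha₀ hεA hx hω
        (isFinalCell_of_speed_le hr0 hr1 hx (hM _ hω))]
    · simp only [hg, if_neg hω, ContinuousMap.const_apply]
  · filter_upwards [hbd] with ω hω
    exact (if_pos hω).symm

/-- The weak limit of the slow motion, as `ε` tends to zero. -/
theorem tendsto_integral_toPath (ha : ∀ w s k, Measurable (a w s k))
    (hind : iIndepFun (fun i : S.Well × Side × ℕ => a i.1 i.2.1 i.2.2) P)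
    (hlaw : ∀ w s k, P.map (a w s k) = m w s) (ha₀ : 0 < a₀) (haA : a₀ ≤ A)
    (hm : ∀ w s, ∀ᵐ z ∂m w s, z ∈ Icc a₀ A)
    (hmin : ∀ w s, ∃ κ p q, 0 < κ ∧ p < q ∧ Minorized κ p q (m w s))
    (hx : x.IsStart) {b : S.Well → Side → ℝ} (hb : ∀ w s, 0 < b w s)
    (hbm : ∀ w s, b w s = ∫ z, z ∂m w s) (hT : 0 < T)
    (F : BoundedContinuousFunction C(Icc (0 : ℝ) T, S.Graph) ℝ) :
    Tendsto (fun ε => ∫ ω, F (toPath (slowPath ε (coefficients (fun w s k => a w s k ω) ε) x)) ∂P)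
      (𝓝[>] 0) (𝓝 (value b (fun j => F (limitPath hb j hx.speed_pos T)) x.well)) := by
  classical
  have hbd : ∀ᵐ ω ∂P, ∀ w s k, a w s k ω ∈ Icc a₀ A := by
    refine ae_all_iff.2 fun w => ae_all_iff.2 fun s => ae_all_iff.2 fun k => ?_
    have := hm w s
    rw [← hlaw w s k] at this
    exact ae_of_ae_map (ha w s k).aemeasurable this
  have hslln : ∀ᵐ ω ∂P, ∀ w s,
      Tendsto (fun k : ℕ => (∑ i ∈ Finset.range k, a w s i ω) / k) atTop (𝓝 (b w s)) := by
    refine ae_all_iff.2 fun w => ae_all_iff.2 fun s => ?_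
    have hint : Integrable (a w s 0) P := Integrable.of_bound (ha w s 0).aestronglyMeasurable A (by
      filter_upwards [hbd] with ω hω
      rw [Real.norm_eq_abs, abs_of_nonneg (ha₀.le.trans (hω w s 0).1)]
      exact (hω w s 0).2)
    have hE : ∫ ω, a w s 0 ω ∂P = b w s := by
      rw [hbm, ← hlaw w s 0]
      exact (integral_map (f := fun z : ℝ => z) (ha w s 0).aemeasurable
        measurable_id.aestronglyMeasurable).symm
    rw [← hE]
    refine strong_law_ae_real (a w s) hint (fun i j hij => ?_) fun i =>
      ⟨(ha w s i).aemeasurable, (ha w s 0).aemeasurable, by rw [hlaw, hlaw]⟩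
    exact hind.indepFun (i := (w, s, i)) (j := (w, s, j)) (by simpa using hij)
  have hM : ∀ ε : ℝ, ∃ M, 0 < ε → ε * A ≤ 1 / 2 → ∀ a : S.Well → Side → ℕ → ℝ,
      (∀ w s k, a w s k ∈ Icc a₀ A) →
      ∀ i, (orbit (coefficients a ε) x M).speed ≤ S.height i := by
    intro ε
    by_cases h : 0 < ε ∧ ε * A ≤ 1 / 2
    · obtain ⟨M, hM⟩ := exists_orbit_speed_le h.1 ha₀ h.2 hx
      exact ⟨M, fun _ _ => hM⟩
    · exact ⟨0, fun h1 h2 => absurd ⟨h1, h2⟩ h⟩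
  choose M hM using hM
  set Φ : Fin (n + 1) → ℝ := fun j => F (limitPath hb j hx.speed_pos T) with hΦ
  set J : ℝ → Ω → Fin (n + 1) := fun ε ω =>
    (orbit (coefficients (fun w s k => a w s k ω) ε) x (M ε)).cell with hJ
  have hbeq : b = fun w s => ∫ z, z ∂m w s := by
    funext w s
    exact hbm w s
  have hcell : Tendsto (fun ε => ∫ ω, Φ (J ε ω) ∂P) (𝓝[>] 0) (𝓝 (value b Φ x.well)) := by
    rw [Metric.tendsto_nhds]
    intro η hη
    filter_upwards [self_mem_nhdsWithin, eventually_mul_le (A := A) (half_pos one_pos),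
      eventually_integral_cell_le ha hind hlaw ha₀ haA hm hmin hx.speed_pos Φ (half_pos hη),
      eventually_integral_cell_le ha hind hlaw ha₀ haA hm hmin hx.speed_pos (fun j => -Φ j)
        (half_pos hη)] with ε hε hεA h1 h2
    have hMε : ∀ᵐ ω ∂P, ∀ i, (orbit (coefficients (fun w s k => a w s k ω) ε) x (M ε)).speed ≤
        S.height i := by
      filter_upwards [hbd] with ω hω
      exact hM ε hε hεA _ hω
    have h1 := h1 (M ε) hMε
    have h2 := h2 (M ε) hMε
    rw [← hbeq] at h1 h2
    rw [integral_neg, value_neg] at h2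
    rw [Real.dist_eq, abs_lt]
    constructor <;> linarith
  have hRm : ∀ ε : ℝ, Measurable fun (ω : Ω) => coefficients (fun w s k => a w s k ω) ε := fun ε =>
    measurable_pi_iff.2 fun w => measurable_pi_iff.2 fun s => measurable_pi_iff.2 fun k =>
      measurable_const.sub ((ha w s k).const_mul ε)
  have hJm : ∀ ε, Measurable fun ω => Φ (J ε ω) := fun ε =>
    (measurable_of_countable Φ).comp (State.measurable_cell.comp
      (measurable_orbit_comp (hRm ε) measurable_const (M ε)))
  have hΦb : ∀ j, |Φ j| ≤ ‖F‖ := fun j => F.norm_coe_le_norm _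
  have hpath : ∀ᶠ ε in 𝓝[>] (0 : ℝ), AEStronglyMeasurable (fun ω =>
      F (toPath (slowPath ε (coefficients (fun w s k => a w s k ω) ε) x))) P := by
    filter_upwards [self_mem_nhdsWithin, eventually_mul_le (A := A) (half_pos one_pos)] with ε hε hεA
    exact (F.continuous.measurable.comp_aemeasurable
      (aemeasurable_toPath ha hbd hε ha₀ hεA hx)).aestronglyMeasurable
  -- The final cell `J ε ω` may keep changing as `ε` tends to zero. Pathwise only the distance to
  -- the averaged path over the current final cell tends to zero; the distribution of this cell is
  -- handled by `hcell`.
  have hdiff : Tendsto (fun ε => ∫ ω, (F (toPath (slowPath ε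
      (coefficients (fun w s k => a w s k ω) ε) x)) - Φ (J ε ω)) ∂P) (𝓝[>] 0)
      (𝓝 (∫ _, (0 : ℝ) ∂P)) := by
    refine tendsto_integral_filter_of_dominated_convergence (fun _ => 2 * ‖F‖) ?_ ?_
      (integrable_const _) ?_
    · filter_upwards [hpath] with ε hε
      exact hε.sub (hJm ε).aestronglyMeasurable
    · refine Eventually.of_forall fun ε => Eventually.of_forall fun ω => ?_
      refine (norm_sub_le _ _).trans ?_
      have h1 := F.norm_coe_le_norm
        (toPath (slowPath ε (coefficients (fun w s k => a w s k ω) ε) x))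
      have h2 := hΦb (J ε ω)
      rw [← Real.norm_eq_abs] at h2
      linarith
    · filter_upwards [hbd, hslln] with ω hω hlim
      rw [Metric.tendsto_nhds]
      intro η hη
      have hcont : ∀ j, ∃ ρ > 0, ∀ y, dist y (limitPath hb j hx.speed_pos T) < ρ →
          dist (F y) (Φ j) < η := fun j =>
        Metric.continuous_iff.1 F.continuous (limitPath hb j hx.speed_pos T) η hη
      choose ρ hρ hclose using hcont
      -- There are only finitely many averaged paths, so one radius of continuity of `F` serves them
      -- all.
      obtain ⟨j₀, hj₀⟩ := Finite.exists_min ρ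
      filter_upwards [self_mem_nhdsWithin, eventually_mul_le (A := A) (half_pos one_pos),
        eventually_dist_limitPath_le hb ha₀ hx hω hlim hT (half_pos (hρ j₀))] with ε hε hεA h
      have hfin := isFinalCell_of_speed_le
        (coefficients_pos (a := fun w s k => a w s k ω) (fun w s k => (hω w s k).2) hε hεA)
        (coefficients_lt_one (a := fun w s k => a w s k ω)
          (fun w s k => ha₀.trans_le (hω w s k).1) hε) hx (hM ε hε hεA _ hω)
      have hd := h _ hfin
      have := hclose (J ε ω) _ (lt_of_le_of_lt hd (by linarith [hj₀ (J ε ω), hρ j₀]))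
      rwa [Real.dist_eq, sub_zero, ← Real.dist_eq]
  rw [integral_zero] at hdiff
  have hsum := hdiff.add hcell
  rw [zero_add] at hsum
  refine hsum.congr' ?_
  filter_upwards [hpath] with ε hε
  have i1 : Integrable (fun ω => F (toPath (slowPath ε
      (coefficients (fun w s k => a w s k ω) ε) x))) P :=
    Integrable.of_bound hε ‖F‖ (Eventually.of_forall fun ω => F.norm_coe_le_norm _)
  have i2 : Integrable (fun ω => Φ (J ε ω)) P :=
    Integrable.of_bound (hJm ε).aestronglyMeasurable ‖F‖ (Eventually.of_forall fun ω => hΦb _)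
  rw [integral_sub i1 i2, sub_add_cancel]

end Random

/-- The initial state of the motion. -/
theorem isStart_start {j₀ : Fin (n + 1)} {q₀ p₀ : ℝ} (hp₀ : p₀ ≠ 0)
    (hright : 0 < p₀ → q₀ < S.pos j₀.succ) (hleft : p₀ < 0 → S.pos j₀.castSucc < q₀) :
    (S.start j₀ q₀ p₀).IsStart where
  speed_pos := abs_pos.2 hp₀
  pos_ne := by
    have hcell : (S.start j₀ q₀ p₀).well.HasCell j₀ := S.hasCell_wellAt j₀ |p₀|
    rcases hp₀.lt_or_gt with h | h
    · have hs : (S.start j₀ q₀ p₀).heading = .left := if_neg (not_lt.2 h.le)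
      rw [hs]
      exact ((S.pos_strictMono.monotone hcell.1).trans_lt (hleft h)).ne
    · have hs : (S.start j₀ q₀ p₀).heading = .right := if_pos h
      rw [hs]
      exact ((hright h).trans_le (S.pos_strictMono.monotone hcell.2)).ne'
  time_eq := rfl
  hits_eq _ := rfl

section Noise

variable {Ω : Type*} [MeasurableSpace Ω] {P : Measure Ω} [IsProbabilityMeasure P]
  {ξ : S.Well → Side → ℕ → Ω → ℝ} {c : S.Well → Side → ℝ}

theorem restitution_eq_coefficients (c : S.Well → Side → ℝ) (ε δ : ℝ)
    (ξ : S.Well → Side → ℕ → ℝ) :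
    restitution c ε δ ξ = coefficients (fun w s k => c w s + δ * ξ w s k) ε := by
  funext w s k
  simp only [restitution, coefficients]
  ring

omit [IsProbabilityMeasure P] in
theorem IsNoise.exists_bounds (hξ : IsNoise P ξ) (hc : ∀ w s, 0 < c w s) {δ : ℝ} (hδ : 0 < δ) :
    ∃ a₀ A, 0 < a₀ ∧ a₀ ≤ A ∧ ∀ᵐ ω ∂P, ∀ w s k, c w s + δ * ξ w s k ω ∈ Icc a₀ A := by
  obtain ⟨α, β, hα, hαβ, h⟩ := hξ.bounded
  obtain ⟨K, hK⟩ := Finite.exists_le fun p : S.Well × Side => c p.1 p.2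
  have hK0 : 0 < K := (hc (S.wellAt 0 0) .left).trans_le (hK (_, _))
  refine ⟨δ * α, K + δ * β, mul_pos hδ hα, ?_, ?_⟩
  · have := mul_le_mul_of_nonneg_left hαβ.le hδ.le
    linarith
  · refine ae_all_iff.2 fun w => ae_all_iff.2 fun s => ae_all_iff.2 fun k => ?_
    filter_upwards [h w s k] with ω hω
    have h1 := mul_le_mul_of_nonneg_left hω.1.le hδ.le
    have h2 := mul_le_mul_of_nonneg_left hω.2.le hδ.le
    exact ⟨by linarith [hc w s], by linarith [hK (w, s)]⟩

theorem IsNoise.integrable (hξ : IsNoise P ξ) (w : S.Well) (s : Side) (k : ℕ) :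
    Integrable (ξ w s k) P := by
  obtain ⟨α, β, hα, hαβ, h⟩ := hξ.bounded
  refine Integrable.of_bound (hξ.measurable w s k).aestronglyMeasurable β ?_
  filter_upwards [h w s k] with ω hω
  rw [Real.norm_eq_abs, abs_of_nonneg (hα.trans hω.1).le]
  exact hω.2.le

theorem IsNoise.mean_pos (hξ : IsNoise P ξ) (w : S.Well) (s : Side) :
    0 < ∫ ω, ξ w s 0 ω ∂P := by
  obtain ⟨α, β, hα, hαβ, h⟩ := hξ.bounded
  have := integral_mono_ae (integrable_const α) (hξ.integrable w s 0)
    ((h w s 0).mono fun ω hω => hω.1.le)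
  simp only [integral_const, probReal_univ, smul_eq_mul, one_mul] at this
  linarith

/-- The weak limit of the slow motion with random restitution coefficients. -/
theorem IsNoise.tendsto_integral_toPath (hξ : IsNoise P ξ) (hc : ∀ w s, 0 < c w s) {δ : ℝ}
    (hδ : 0 < δ) {x : S.State} (hx : x.IsStart) {b : S.Well → Side → ℝ} (hb : ∀ w s, 0 < b w s)
    (hbξ : ∀ w s, b w s = c w s + δ * ∫ ω, ξ w s 0 ω ∂P) {T : ℝ} (hT : 0 < T)
    (F : BoundedContinuousFunction C(Icc (0 : ℝ) T, S.Graph) ℝ) :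
    Tendsto (fun ε => ∫ ω, F (toPath (slowPath ε
      (restitution c ε δ fun w s k => ξ w s k ω) x)) ∂P)
      (𝓝[>] 0) (𝓝 (value b (fun j => F (limitPath hb j hx.speed_pos T)) x.well)) := by
  simp only [restitution_eq_coefficients]
  obtain ⟨a₀, A, ha₀, haA, hbd⟩ := hξ.exists_bounds hc hδ
  have haff : ∀ w s, Measurable fun z : ℝ => c w s + δ * z := fun w s => by fun_prop
  have hlaw : ∀ w s k, P.map (fun ω => c w s + δ * ξ w s k ω) =
      P.map (fun ω => c w s + δ * ξ w s 0 ω) := by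
    intro w s k
    obtain ⟨f, -, hf⟩ := hξ.density w s
    have : ∀ k, P.map (fun ω => c w s + δ * ξ w s k ω) =
        (P.map (ξ w s k)).map fun z => c w s + δ * z := fun k => by
      rw [Measure.map_map (haff w s) (hξ.measurable w s k)]
      rfl
    rw [this, this, hf, hf]
  have hm : ∀ w s k, Measurable fun ω => c w s + δ * ξ w s k ω := fun w s k =>
    (haff w s).comp (hξ.measurable w s k)
  refine WallSystem.tendsto_integral_toPath (P := P) (a := fun w s k ω => c w s + δ * ξ w s k ω)
    (m := fun w s => P.map fun ω => c w s + δ * ξ w s 0 ω) hm ?_ hlaw ha₀ haA (fun w s => ?_)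
    (fun w s => ?_) hx hb (fun w s => ?_) hT F
  · exact hξ.indep.comp (fun (i : S.Well × Side × ℕ) z => c i.1 i.2.1 + δ * z)
      fun i => haff i.1 i.2.1
  · refine (ae_map_iff (p := fun z => z ∈ Icc a₀ A) (hm w s 0).aemeasurable measurableSet_Icc).2 ?_
    filter_upwards [hbd] with ω hω
    exact hω w s 0
  · obtain ⟨f, hfc, hf⟩ := hξ.density w s
    have hp : IsProbabilityMeasure (volume.withDensity fun x => (f x : ℝ≥0∞)) :=
      hf 0 ▸ Measure.isProbabilityMeasure_map (hξ.measurable w s 0).aemeasurable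
    obtain ⟨κ, p, q, hκ, hpq, hmin⟩ := exists_minorized_withDensity hfc hp
    have e : P.map (fun ω => c w s + δ * ξ w s 0 ω) =
        (volume.withDensity fun x => (f x : ℝ≥0∞)).map fun z => c w s + δ * z := by
      rw [← hf 0, Measure.map_map (haff w s) (hξ.measurable w s 0)]
      rfl
    -- The loss is an affine image of the noise, so its interval is stretched by `δ` and its density
    -- divided by `δ`. This is where `δ > 0` is indispensable.
    refine ⟨κ * δ⁻¹, c w s + δ * p, c w s + δ * q, by positivity,
      by linarith [mul_lt_mul_of_pos_left hpq hδ], ?_⟩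
    rw [e]
    refine hmin.map hκ.le (haff w s) (Y := fun y => (y - c w s) / δ) (Y' := fun _ => 1 / δ)
      (fun y _ => ((hasDerivAt_id y).sub_const _).div_const δ) (fun y _ => ?_) (fun y hy => ?_)
      (fun y _ => ?_)
    · rw [one_div]
      exact le_abs_self _
    · constructor
      · rw [le_div_iff₀ hδ]
        linarith [hy.1]
      · rw [div_le_iff₀ hδ]
        linarith [hy.2]
    · show c w s + δ * ((y - c w s) / δ) = y
      rw [mul_div_cancel₀ _ hδ.ne', add_sub_cancel]
  · have e : ∫ z, z ∂(P.map fun ω => c w s + δ * ξ w s 0 ω) = ∫ ω, (c w s + δ * ξ w s 0 ω) ∂P :=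
      integral_map (f := fun z : ℝ => z) (hm w s 0).aemeasurable
        measurable_id.aestronglyMeasurable
    rw [hbξ, e, integral_add (integrable_const _) ((hξ.integrable w s 0).const_mul δ), integral_const_mul]
    simp

end Noise

end WallSystem

/-! ### Proof of the theorem -/

theorem theorem3p2 {n : ℕ} (S : WallSystem n)
    (c : S.Well → Side → ℝ) (hc : ∀ w s, 0 < c w s)
    {Ω : Type*} [MeasurableSpace Ω] (P : Measure Ω) [IsProbabilityMeasure P]
    (ξ : S.Well → Side → ℕ → Ω → ℝ) (hξ : WallSystem.IsNoise P ξ)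
    (T : ℝ) (hT : 0 < T)
    -- the initial point `(q₀, p₀)`, with `q₀` in (the closure of) the cell `j₀`, moving into it
    (j₀ : Fin (n + 1)) (q₀ p₀ : ℝ) (hp₀ : p₀ ≠ 0)
    (hq₀ : q₀ ∈ Set.Icc (S.pos j₀.castSucc) (S.pos j₀.succ))
    (hright : 0 < p₀ → q₀ < S.pos j₀.succ) (hleft : p₀ < 0 → S.pos j₀.castSucc < q₀)
    -- its projection is not an interior vertex
    (hvertex : ∀ k : Fin n, S.proj j₀ p₀ ≠ S.vertex k) :
    -- the limiting process exists and is unique in law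
    (∃! μ : ProbabilityMeasure C(Set.Icc (0 : ℝ) T, S.Graph),
      WallSystem.IsLimitLaw hT c (S.proj j₀ p₀) μ) ∧
    -- for small `ε`, the slow motion is a random element of `C([0,T], Γ)`
    (∀ δ : ℝ, 0 < δ → ∀ᶠ ε in 𝓝[>] (0 : ℝ),
      (∀ᵐ ω ∂P, Continuous fun t : Set.Icc (0 : ℝ) T =>
        WallSystem.slowPath ε
          (WallSystem.restitution c ε δ fun w s k => ξ w s k ω) (S.start j₀ q₀ p₀) t) ∧
      AEMeasurable (fun ω => (WallSystem.toPath (WallSystem.slowPath ε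
        (WallSystem.restitution c ε δ fun w s k => ξ w s k ω) (S.start j₀ q₀ p₀)) :
          C(Set.Icc (0 : ℝ) T, S.Graph))) P) ∧
    -- weak convergence, first as `ε ↓ 0` and then as `δ ↓ 0`
    (∀ μ : ProbabilityMeasure C(Set.Icc (0 : ℝ) T, S.Graph),
      WallSystem.IsLimitLaw hT c (S.proj j₀ p₀) μ →
      ∃ ν : ℝ → ProbabilityMeasure C(Set.Icc (0 : ℝ) T, S.Graph),
        (∀ δ : ℝ, 0 < δ → ∀ F : BoundedContinuousFunction C(Set.Icc (0 : ℝ) T, S.Graph) ℝ,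
          Tendsto (fun ε : ℝ => ∫ ω, F (WallSystem.toPath (WallSystem.slowPath ε
            (WallSystem.restitution c ε δ fun w s k => ξ w s k ω) (S.start j₀ q₀ p₀))) ∂P)
            (𝓝[>] 0) (𝓝 (∫ y, F y ∂(ν δ : Measure C(Set.Icc (0 : ℝ) T, S.Graph))))) ∧
        Tendsto ν (𝓝[>] 0) (𝓝 μ)) := by
  have hv₀ : 0 < |p₀| := abs_pos.2 hp₀
  have hx : (S.start j₀ q₀ p₀).IsStart := WallSystem.isStart_start hp₀ hright hleft
  have hedge : S.proj j₀ |p₀| ∈ (S.wellAt j₀ |p₀|).edge :=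
    WallSystem.proj_mem_edge_of_forall_ne_vertex hv₀ fun k => by
      rw [WallSystem.proj_abs]
      exact hvertex k
  rw [← WallSystem.proj_abs j₀ p₀]
  refine ⟨WallSystem.existsUnique_isLimitLaw hc hT hv₀ hedge, fun δ hδ => ?_, fun μ hμ => ?_⟩
  · obtain ⟨a₀, A, ha₀, haA, hbd⟩ := hξ.exists_bounds hc hδ
    filter_upwards [self_mem_nhdsWithin, eventually_mul_le (A := A) (half_pos one_pos)]
      with ε hε hεA
    rw [mem_Ioi] at hε
    simp only [WallSystem.restitution_eq_coefficients]
    refine ⟨?_, WallSystem.aemeasurable_toPath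
      (fun w s k => measurable_const.add ((hξ.measurable w s k).const_mul δ)) hbd hε ha₀ hεA hx⟩
    filter_upwards [hbd] with ω hω
    exact WallSystem.continuous_slowPath_coefficients hε ha₀ hεA hx hω
  -- The mean losses. The absolute value keeps them positive for every real `δ`, so that a limiting
  -- law `ν δ` with these coefficients can be chosen for all `δ`; only `δ > 0` matters.
  · set b : ℝ → S.Well → Side → ℝ := fun δ w s => c w s + |δ| * ∫ ω, ξ w s 0 ω ∂P with hb
    have hb0 : ∀ δ w s, 0 < b δ w s := fun δ w s =>
      add_pos_of_pos_of_nonneg (hc w s) (mul_nonneg (abs_nonneg δ) (hξ.mean_pos w s).le)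
    choose ν hν using fun δ => WallSystem.exists_isLimitLaw (hb0 δ) hT hv₀ hedge
    refine ⟨ν, fun δ hδ F => ?_, ?_⟩
    · rw [(hν δ).integral_eq (hb0 δ) hv₀ hedge F]
      exact hξ.tendsto_integral_toPath hc hδ hx (hb0 δ)
        (fun w s => by simp only [hb, abs_of_pos hδ]) hT F
    · refine ProbabilityMeasure.tendsto_iff_forall_integral_tendsto.2 fun F => ?_
      rw [hμ.integral_eq hc hv₀ hedge F]
      simp only [fun δ => (hν δ).integral_eq (hb0 δ) hv₀ hedge F]
      -- As `δ` tends to zero the noise drops out of the mean losses, and `value` is continuous in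
      -- the coefficients and in the paths at the leaves.
      have hblim : ∀ w s, Tendsto (fun δ => b δ w s) (𝓝[>] 0) (𝓝 (c w s)) := fun w s => by
        have : Tendsto (fun δ => b δ w s) (𝓝 0) (𝓝 (b 0 w s)) :=
          Continuous.tendsto (by simp only [hb]; fun_prop) 0
        simp only [hb, abs_zero, zero_mul, add_zero] at this
        exact this.mono_left nhdsWithin_le_nhds
      exact WallSystem.tendsto_value hc hblim (fun j => (F.continuous.tendsto _).comp
        (WallSystem.tendsto_limitPath hc hb0 hblim j hv₀ T)) _
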